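/- Throughout, graphs are finite, simple and undirected. A graph $H$ is a minor of a graph $G$ if it can be obtained from $G$ by deleting vertices, deleting edges and contracting edges; equivalently, if there are pairwise disjoint sets $B_h \subseteq V(G)$ $(h \in V(H))$, each inducing a non-empty connected subgraph of $G$, such that $G$ has an edge between $B_h$ and $B_{h'}$ whenever $hh' \in E(H)$. The graph $G$ is $H$-minor-free if $H$ is not a minor of $G$. Fix $k \in \mathbb{N}$. A network is a connected graph $G$ on $n$ vertices together with an injective assignment of identifiers $\mathrm{id}\colon V(G) \to \{1,\dots,n^k\}$. A verifier is a map $A$ which is evaluated at each vertex $v$ of a network whose vertices carry certificates $c(v) \in \{0,1\}^*$: its input is the identifier and the certificate of $v$, together with the set of pairs $(\mathrm{id}(w), c(w))$ over all neighbours $w$ of $v$, and its output is "accept" or "reject". A graph class $\mathcal{C}$ has a local certification (proof-labeling scheme) with $O(\log n)$-bit certificates if there are a verifier $A$ and a function $f\colon \mathbb{N} \to \mathbb{N}$ with $f(n) = O(\log n)$ such that, for every network $(G, \mathrm{id})$ with $n$ vertices: 1. if $G \in \mathcal{C}$, then there is an assignment $c$ of certificates of at most $f(n)$ bits each for which $A$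 accepts at every vertex; 2. if $G \notin \mathcal{C}$, then for every assignment $c$ of certificates, of any length, $A$ rejects at some vertex at least. **Theorem.** For every graph $H$ with at most $4$ vertices and every $k \in \mathbb{N}$, the class of $H$-minor-free graphs has a local certification with $O(\log n)$-bit certificates. -/

import Mathlib

/-- `H` is a minor of `G`: there are pairwise disjoint branch sets in `G`, one for each vertex
of `H`, each inducing a (nonempty) connected subgraph, with an edge of `G` between the branch
sets of any two adjacent vertices of `H`. -/
def IsMinor {W V : Type*} (H : SimpleGraph W) (G : SimpleGraph V) : Prop :=
  ∃ B : W → Set V,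
    (∀ i, (G.induce (B i)).Connected) ∧
    (∀ i j, i ≠ j → Disjoint (B i) (B j)) ∧
    (∀ i j, H.Adj i j → ∃ x ∈ B i, ∃ y ∈ B j, G.Adj x y)

/-- A class of graphs. -/
abbrev GraphClass : Type 1 := ∀ V : Type, SimpleGraph V → Prop

/-- The class of `H`-minor-free graphs. -/
def minorFree {W : Type*} (H : SimpleGraph W) : GraphClass :=
  fun _ G => ¬ IsMinor H G

/-- Certificates are bit strings; the size of a certificate is its length. -/
abbrev Certificate : Type := List Bool

/-- A verifier, run at a node, sees the identifier of the node, the certificate of the node, and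
the set of pairs (identifier, certificate) of its neighbours; it outputs `true` (accept) or
`false` (reject). -/
abbrev Verifier : Type := ℕ → Certificate → Finset (ℕ × Certificate) → Bool

/-- Unique identifiers in the polynomial range `[1, n ^ k]`, where `n` is the number of
vertices. -/
structure IsIdentifierAssignment (k : ℕ) {V : Type} [Fintype V] (ident : V → ℕ) : Prop where
  injective : Function.Injective ident
  one_le : ∀ v, 1 ≤ ident v
  le_pow : ∀ v, ident v ≤ Fintype.card V ^ k

open Classical in
/-- The pairs (identifier, certificate) of the neighbours of `v`. -/
noncomputable def neighborView {V : Type} [Fintype V] (G : SimpleGraph V) (ident : V → ℕ)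
    (c : V → Certificate) (v : V) : Finset (ℕ × Certificate) :=
  (Finset.univ.filter fun w => G.Adj v w).image fun w => (ident w, c w)

/-- The verifier accepts: all nodes output accept. -/
def Verifier.Accepts (A : Verifier) {V : Type} [Fintype V] (G : SimpleGraph V) (ident : V → ℕ)
    (c : V → Certificate) : Prop :=
  ∀ v, A (ident v) (c v) (neighborView G ident c v) = true

/-- `A` certifies the class `𝒞` with certificates of at most `f n` bits on `n`-vertex graphs.
Networks are finite connected graphs with unique identifiers in `[1, n ^ k]`. Soundness is
required against certificates of every length. -/
structure Verifier.Certifies (A : Verifier) (k : ℕ) (𝒞 : GraphClass) (f : ℕ → ℕ) : Prop where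
  complete : ∀ (V : Type) [Fintype V] (G : SimpleGraph V) (ident : V → ℕ),
    G.Connected → IsIdentifierAssignment k ident → 𝒞 V G →
      ∃ c : V → Certificate, (∀ v, (c v).length ≤ f (Fintype.card V)) ∧ A.Accepts G ident c
  sound : ∀ (V : Type) [Fintype V] (G : SimpleGraph V) (ident : V → ℕ),
    G.Connected → IsIdentifierAssignment k ident → ¬ 𝒞 V G →
      ∀ c : V → Certificate, ¬ A.Accepts G ident c

/-- The class `𝒞` has a local certification with `O(log n)`-bit certificates, for networks with
identifiers in `[1, n ^ k]`. -/
def HasLogCertification (k : ℕ) (𝒞 : GraphClass) : Prop :=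
  ∃ (A : Verifier) (f : ℕ → ℕ), A.Certifies k 𝒞 f ∧
    (fun n : ℕ => (f n : ℝ)) =O[Filter.atTop] (fun n : ℕ => Real.log n)

/-!
For connected graphs a minor can be replaced by a connected one: if every connected graph that
contains `L` and has the same vertices also contains `U`, then excluding `L`, excluding `U` and
excluding any graph between the two are the same. Up to that, the graphs on three or four vertices
are `K₄`, the diamond, `C₄`, `K₃`, the paw, the claw, `P₄` and `P₃`. Excluding the paw gives the
trees and the graphs of maximum degree two, excluding the claw only the latter, excluding `P₄` the
stars and the graphs on at most three vertices, and excluding `P₃` (possibly with an isolated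
vertex) a bound on the number of vertices. All of these properties are easy to certify.

A connected graph without a diamond minor is a cactus. In a depth-first search tree each of its
cycles consists of a tree path and one more edge, so the label of a vertex contains its parent, its
depth and the top of the cycle through its parent edge. For `C₄` all cycles have length three, for
`K₃` there are none.

In a graph without a `K₄` minor some vertex has at most two neighbours; otherwise a branch of a
depth-first search tree that is joined to two of the vertices above it yields the minor. Removing
such a vertex `x` and joining its neighbours `a` and `b` gives a smaller graph of the same kind, so
by induction there is a rooted tree decomposition of width two. The label of a vertex describes its
own place in this tree and that of its parent. As the edge `ab` may be missing, a vertex need not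
see its parent; it is then joined to the parent by a path through removed vertices, whose interior
vertices repeat the label of the parent. The decomposition is kept such that these paths have
disjoint interiors, so that every vertex repeats at most one label.
-/

open Relation

/-- A vector of natural numbers coded as a single one, by iterating the pairing function. -/
def vecCode : ∀ m : ℕ, (Fin m → ℕ) → ℕ
  | 0, _ => 0
  | m + 1, x => Nat.pair (x 0) (vecCode m (Fin.tail x))

theorem vecCode_injective : ∀ m, Function.Injective (vecCode m)
  | 0 => fun _ _ _ => Subsingleton.elim _ _
  | m + 1 => fun x y h => by
    obtain ⟨h0, h1⟩ := Nat.pair_eq_pair.mp h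
    rw [← Fin.cons_self_tail x, ← Fin.cons_self_tail y, h0, vecCode_injective m h1]

theorem vecCode_lt {B : ℕ} : ∀ (m : ℕ) (x : Fin m → ℕ), (∀ i, x i ≤ B) →
    vecCode m x < (B + 1) ^ 2 ^ m
  | 0, _, _ => by simp [vecCode]
  | m + 1, x, h => by
    have htail := vecCode_lt m (Fin.tail x) fun i => h i.succ
    have hmax : max (x 0) (vecCode m (Fin.tail x)) + 1 ≤ (B + 1) ^ 2 ^ m := by
      have hB : B + 1 ≤ (B + 1) ^ 2 ^ m := Nat.le_self_pow (by positivity) _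
      have h0 := h 0
      omega
    calc vecCode (m + 1) x < (max (x 0) (vecCode m (Fin.tail x)) + 1) ^ 2 :=
          Nat.pair_lt_max_add_one_sq _ _
      _ ≤ ((B + 1) ^ 2 ^ m) ^ 2 := Nat.pow_le_pow_left hmax 2
      _ = (B + 1) ^ 2 ^ (m + 1) := by rw [← pow_mul, pow_succ]

theorem bits_injective : Function.Injective Nat.bits := fun a b h =>
  Nat.digits.injective 2 (by rw [Nat.digits_two_eq_bits, Nat.digits_two_eq_bits, h])

/-- A bound on the length of the binary code of a vector of `m` numbers that are at most
`(n + 1) ^ K`. -/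
def certLength (K m n : ℕ) : ℕ := (Nat.log 2 n + 2) * ((K + 1) * 2 ^ m)

theorem length_bits_vecCode_le {K m n : ℕ} {x : Fin m → ℕ} (hx : ∀ i, x i ≤ (n + 1) ^ K) :
    (Nat.bits (vecCode m x)).length ≤ certLength K m n := by
  rw [Nat.size_eq_bits_len, Nat.size_le]
  have hn : n + 2 ≤ 2 ^ (Nat.log 2 n + 2) := by
    have := Nat.lt_pow_succ_log_self one_lt_two n
    rw [pow_succ] at this ⊢
    omega
  have hK : (n + 1) ^ K + 1 ≤ (n + 2) ^ (K + 1) := by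
    have h1 : (n + 1) ^ K ≤ (n + 2) ^ K := Nat.pow_le_pow_left (by omega) K
    have h2 : 1 ≤ (n + 2) ^ K := Nat.one_le_pow _ _ (by omega)
    rw [pow_succ]
    nlinarith
  calc vecCode m x < ((n + 1) ^ K + 1) ^ 2 ^ m := vecCode_lt m x hx
    _ ≤ ((n + 2) ^ (K + 1)) ^ 2 ^ m := Nat.pow_le_pow_left hK _
    _ = (n + 2) ^ ((K + 1) * 2 ^ m) := by rw [← pow_mul]
    _ ≤ (2 ^ (Nat.log 2 n + 2)) ^ ((K + 1) * 2 ^ m) := Nat.pow_le_pow_left hn _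
    _ = 2 ^ certLength K m n := by rw [← pow_mul, certLength]

theorem const_isBigO_log (c : ℝ) :
    (fun _ : ℕ => c) =O[Filter.atTop] (fun n : ℕ => Real.log n) :=
  (Asymptotics.isLittleO_const_left.mpr (Or.inr (Filter.tendsto_abs_atTop_atTop.comp
    (Real.tendsto_log_atTop.comp tendsto_natCast_atTop_atTop)))).isBigO

theorem certLength_isBigO (K m : ℕ) :
    (fun n : ℕ => (certLength K m n : ℝ)) =O[Filter.atTop] (fun n : ℕ => Real.log n) := by
  have hlog : (fun n : ℕ => (Nat.log 2 n : ℝ)) =O[Filter.atTop] (fun n : ℕ => Real.log n) := by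
    refine Asymptotics.IsBigO.of_bound (Real.log 2)⁻¹ (Filter.Eventually.of_forall fun n => ?_)
    rw [Real.norm_of_nonneg (Nat.cast_nonneg _), Real.norm_of_nonneg (Real.log_natCast_nonneg n),
      inv_mul_eq_div, Real.log_div_log]
    exact_mod_cast Real.natLog_le_logb n 2
  simp only [certLength, Nat.cast_mul, Nat.cast_add, mul_comm (_ + _ : ℝ)]
  exact (hlog.add (const_isBigO_log _)).const_mul_left _

/-- The pairs (identifier, label) of the neighbours of `v`; this is `neighborView` for labels of
an arbitrary type. -/
def labelView {V L : Type} (G : SimpleGraph V) (ident : V → ℕ) (c : V → L) (v : V) :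
    Set (ℕ × L) :=
  (fun w => (ident w, c w)) '' G.neighborSet v

theorem coe_neighborView {V : Type} [Fintype V] (G : SimpleGraph V) (ident : V → ℕ)
    (c : V → Certificate) (v : V) :
    (neighborView G ident c v : Set (ℕ × Certificate)) = labelView G ident c v := by
  ext q
  simp [neighborView, labelView]

theorem labelView_comp {V L M : Type} (G : SimpleGraph V) (ident : V → ℕ) (e : L → M) (c : V → L)
    (v : V) : labelView G ident (e ∘ c) v = Prod.map id e '' labelView G ident c v := by
  simp only [labelView, Set.image_image]
  rfl

theorem hasLogCertification_of_labels {k : ℕ} {𝒞 : GraphClass} {L ι : Type}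
    [Finite ι] (enc : L → ι → ℕ) (henc : Function.Injective enc)
    (A : ℕ → L → Set (ℕ × L) → Prop) (K : ℕ)
    (complete : ∀ (V : Type) [Fintype V] (G : SimpleGraph V) (ident : V → ℕ),
      G.Connected → IsIdentifierAssignment k ident → 𝒞 V G →
        ∃ c : V → L, (∀ v i, enc (c v) i ≤ (Fintype.card V + 1) ^ K) ∧
          ∀ v, A (ident v) (c v) (labelView G ident c v))
    (sound : ∀ (V : Type) [Fintype V] (G : SimpleGraph V) (ident : V → ℕ),
      G.Connected → IsIdentifierAssignment k ident → ∀ c : V → L,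
        (∀ v, A (ident v) (c v) (labelView G ident c v)) → 𝒞 V G) :
    HasLogCertification k 𝒞 := by
  classical
  let σ := Finite.equivFin ι
  let e : L → Certificate := fun l => Nat.bits (vecCode _ (enc l ∘ σ.symm))
  have he : Function.Injective e := bits_injective.comp
    ((vecCode_injective _).comp (σ.symm.surjective.injective_comp_right.comp henc))
  refine ⟨fun i b s => decide (∃ l, b = e l ∧
    ∃ t, (s : Set (ℕ × Certificate)) = Prod.map id e '' t ∧ A i l t),
    certLength K (Nat.card ι), ⟨?_, ?_⟩, certLength_isBigO K _⟩
  · intro V _ G ident hG hid hC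
    obtain ⟨c, hc, hA⟩ := complete V G ident hG hid hC
    refine ⟨e ∘ c, fun v => length_bits_vecCode_le fun _ => hc v _, fun v => ?_⟩
    exact decide_eq_true ⟨c v, rfl, _, by rw [coe_neighborView, labelView_comp], hA v⟩
  · intro V _ G ident hG hid hC b hacc
    choose c hb t ht hA using fun v => of_decide_eq_true (hacc v)
    obtain rfl : b = e ∘ c := funext hb
    refine hC (sound V G ident hG hid c fun v => ?_)
    have htv := ht v
    rw [coe_neighborView, labelView_comp] at htv
    exact (Function.injective_id.prodMap he).image_injective htv ▸ hA v

theorem HasLogCertification.congr {k : ℕ} {𝒞 𝒟 : GraphClass} (h : HasLogCertification k 𝒞)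
    (hiff : ∀ (V : Type) [Fintype V] (G : SimpleGraph V), G.Connected → (𝒞 V G ↔ 𝒟 V G)) :
    HasLogCertification k 𝒟 := by
  obtain ⟨A, f, hA, hf⟩ := h
  refine ⟨A, f, ⟨?_, ?_⟩, hf⟩
  · intro V _ G ident hG hid hC
    exact hA.complete V G ident hG hid ((hiff V G hG).mpr hC)
  · intro V _ G ident hG hid hC
    exact hA.sound V G ident hG hid fun h => hC ((hiff V G hG).mp h)

theorem eq_of_forall_adj_eq {V α : Type*} {G : SimpleGraph V} (hG : G.Connected)
    {f : V → α} (hf : ∀ x y, G.Adj x y → f x = f y) (x y : V) : f x = f y := by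
  obtain ⟨p⟩ := hG.preconnected x y
  induction p with
  | nil => rfl
  | cons h _ ih => exact (hf _ _ h).trans ih

open Classical in
/-- The verifier that runs `A x` on the rest of the certificates if they all start with the
bit `x`. -/
noncomputable def Verifier.switch (A : Bool → Verifier) : Verifier := fun i b s =>
  decide (∃ x c t, b = x :: c ∧ s = t.image (Prod.map id (List.cons x)) ∧ A x i c t = true)

open Classical in
theorem neighborView_cons {V : Type} [Fintype V] (G : SimpleGraph V) (ident : V → ℕ) (x : Bool)
    (c : V → Certificate) (v : V) :
    neighborView G ident (List.cons x ∘ c) v =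
      (neighborView G ident c v).image (Prod.map id (List.cons x)) := by
  simp only [neighborView, Finset.image_image]
  rfl

theorem Verifier.accepts_switch_iff {A : Bool → Verifier} {V : Type} [Fintype V]
    {G : SimpleGraph V} (hG : G.Connected) {ident : V → ℕ} {b : V → Certificate} :
    (switch A).Accepts G ident b ↔ ∃ x c, b = List.cons x ∘ c ∧ (A x).Accepts G ident c := by
  classical
  constructor
  · intro hacc
    choose x c t hb ht hA using fun v => of_decide_eq_true (hacc v)
    obtain ⟨v₀⟩ := hG.nonempty
    have hx : ∀ v, x v = x v₀ := fun v => by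
      refine eq_of_forall_adj_eq hG (fun v w hvw => ?_) v v₀
      have hw : (ident w, b w) ∈ neighborView G ident b v :=
        Finset.mem_image.mpr ⟨w, by simpa using hvw, rfl⟩
      rw [ht v] at hw
      obtain ⟨q, -, hq⟩ := Finset.mem_image.mp hw
      have : x v :: q.2 = x w :: c w := (congrArg Prod.snd hq).trans (hb w)
      exact (List.cons.inj this).1
    obtain rfl : b = List.cons (x v₀) ∘ c := funext fun v => by rw [hb, hx]; rfl
    refine ⟨x v₀, c, rfl, fun v => ?_⟩
    have htv := ht v
    rw [neighborView_cons, hx v] at htv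
    have hinj := (Function.injective_id (α := ℕ)).prodMap (List.cons_injective (a := x v₀))
    rw [Finset.image_injective hinj htv, ← hx v]
    exact hA v
  · rintro ⟨x, c, rfl, hacc⟩ v
    exact decide_eq_true ⟨x, c v, _, rfl, neighborView_cons G ident x c v, hacc v⟩

theorem HasLogCertification.exists_bool {k : ℕ} {𝒞 : Bool → GraphClass}
    (h : ∀ x, HasLogCertification k (𝒞 x)) : HasLogCertification k fun V G => ∃ x, 𝒞 x V G := by
  choose A f hA hf using h
  refine ⟨Verifier.switch A, fun n => f true n + f false n + 1, ⟨?_, ?_⟩, ?_⟩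
  · rintro V _ G ident hG hid ⟨x, hx⟩
    obtain ⟨c, hc, hacc⟩ := (hA x).complete V G ident hG hid hx
    refine ⟨List.cons x ∘ c, fun v => ?_, (Verifier.accepts_switch_iff hG).mpr ⟨x, c, rfl, hacc⟩⟩
    have hcv := hc v
    cases x <;> simp only [Function.comp_apply, List.length_cons] <;> omega
  · intro V _ G ident hG hid hC b hacc
    obtain ⟨x, c, rfl, hc⟩ := (Verifier.accepts_switch_iff hG).mp hacc
    exact (hA x).sound V G ident hG hid (fun hx => hC ⟨x, hx⟩) c hc
  · simpa using ((hf true).add (hf false)).add (const_isBigO_log 1)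

theorem HasLogCertification.union {k : ℕ} {𝒞 𝒟 : GraphClass} (h₁ : HasLogCertification k 𝒞)
    (h₂ : HasLogCertification k 𝒟) : HasLogCertification k fun V G => 𝒞 V G ∨ 𝒟 V G := by
  have h : ∀ x : Bool, HasLogCertification k (if x then 𝒞 else 𝒟) := by
    rintro (- | -)
    exacts [h₂, h₁]
  refine (exists_bool h).congr fun V _ G _ => ?_
  simp [or_comm]

section Connectivity

variable {V V' : Type*} {G : SimpleGraph V} {B : Set V}

theorem connected_induce_singleton (G : SimpleGraph V) (x : V) : (G.induce {x}).Connected :=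
  SimpleGraph.Connected.mk fun a b => by rw [Subsingleton.elim a b]

theorem connected_induce_of_reflTransGen {w : V} (hw : w ∈ B)
    (h : ∀ x ∈ B, ReflTransGen (fun a b => G.Adj a b ∧ b ∈ B) x w) :
    (G.induce B).Connected := by
  have hreach : ∀ x, ReflTransGen (fun a b => G.Adj a b ∧ b ∈ B) x w → ∀ hx : x ∈ B,
      (G.induce B).Reachable ⟨w, hw⟩ ⟨x, hx⟩ := by
    intro x hxw
    induction hxw using ReflTransGen.head_induction_on with
    | refl => exact fun _ => .refl _
    | @head x y hxy _ ih =>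
      exact fun _ => (ih hxy.2).trans (SimpleGraph.Adj.reachable (by simpa using hxy.1.symm))
  exact SimpleGraph.connected_iff_exists_forall_reachable _ |>.mpr
    ⟨⟨w, hw⟩, fun x => hreach x (h x x.2) x.2⟩

theorem exists_adj_of_connected_induce (h : (G.induce B).Connected) {C : Set V} {x y : V}
    (hx : x ∈ B) (hxC : x ∈ C) (hy : y ∈ B) (hyC : y ∉ C) :
    ∃ a ∈ B, ∃ b ∈ B, a ∈ C ∧ b ∉ C ∧ G.Adj a b := by
  obtain ⟨p⟩ := h.preconnected ⟨x, hx⟩ ⟨y, hy⟩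
  obtain ⟨d, -, hd, hd'⟩ := p.exists_boundary_dart (Subtype.val ⁻¹' C) hxC hyC
  exact ⟨d.fst, d.fst.2, d.snd, d.snd.2, hd, hd', d.adj⟩

theorem connected_induce_preimage {G' : SimpleGraph V'} {f : V → V'} {B : Set V'}
    (hf : ∀ y ∈ B, (G.induce (f ⁻¹' {y})).Connected)
    (hadj : ∀ u v, G'.Adj u v → ∃ x y, f x = u ∧ f y = v ∧ G.Adj x y)
    (hB : (G'.induce B).Connected) : (G.induce (f ⁻¹' B)).Connected := by
  have hfibre : ∀ x y : f ⁻¹' B, f x = f y → (G.induce (f ⁻¹' B)).Reachable x y := by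
    rintro ⟨x, hx⟩ ⟨y, hy⟩ hxy
    have hsub : f ⁻¹' {f y} ⊆ f ⁻¹' B := fun z hz => by
      rw [Set.mem_preimage, Set.mem_preimage.mp hz]
      exact hy
    exact ((hf (f y) hy).preconnected ⟨x, hxy⟩ ⟨y, rfl⟩).map
      (SimpleGraph.induceHomOfLE G hsub).toHom
  have hwalk : ∀ (u v : B), (G'.induce B).Walk u v → ∀ x y : f ⁻¹' B, f x = u → f y = v →
      (G.induce (f ⁻¹' B)).Reachable x y := by
    intro u v p
    induction p with
    | nil => exact fun x y hx hy => hfibre x y (hx.trans hy.symm)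
    | @cons u u' v huv _ ih =>
      intro x y hx hy
      obtain ⟨a, b, ha, hb, hab⟩ := hadj u u' huv
      have ha' : a ∈ f ⁻¹' B := by simp [ha]
      have hb' : b ∈ f ⁻¹' B := by simp [hb]
      have hxa := hfibre x ⟨a, ha'⟩ (hx.trans ha.symm)
      have hab : (G.induce (f ⁻¹' B)).Adj ⟨a, ha'⟩ ⟨b, hb'⟩ := hab
      exact (hxa.trans hab.reachable).trans (ih ⟨b, hb'⟩ y hb hy)
  obtain ⟨⟨u, hu⟩⟩ := hB.nonempty
  obtain ⟨⟨x, rfl⟩⟩ := (hf u hu).nonempty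
  have : Nonempty (f ⁻¹' B) := ⟨⟨x, hu⟩⟩
  refine SimpleGraph.Connected.mk fun x y => ?_
  obtain ⟨p⟩ := hB.preconnected ⟨f x, x.2⟩ ⟨f y, y.2⟩
  exact hwalk _ _ p x y rfl rfl

end Connectivity

section Minor

variable {V V' W U : Type*} {G : SimpleGraph V} {H : SimpleGraph W}

theorem IsMinor.of_isContained {K : SimpleGraph U} (h : IsMinor H G) (hKH : K.IsContained H) :
    IsMinor K G := by
  obtain ⟨B, hconn, hdisj, hadj⟩ := h
  obtain ⟨f⟩ := hKH
  exact ⟨fun i => B (f i), fun i => hconn _, fun i j hij => hdisj _ _ (f.injective.ne hij),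
    fun i j hij => hadj _ _ (f.toHom.map_adj hij)⟩

theorem IsMinor.isContained_right {G' : SimpleGraph V'} (h : IsMinor H G)
    (hG : G.IsContained G') : IsMinor H G' := by
  obtain ⟨B, hconn, hdisj, hadj⟩ := h
  obtain ⟨f⟩ := hG
  refine ⟨fun i => f '' B i, fun i => ?_,
    fun i j hij => Set.disjoint_image_of_injective f.injective (hdisj i j hij), fun i j hij => ?_⟩
  · refine (hconn i).map (SimpleGraph.induceHom f.toHom (Set.mapsTo_image f (B i))) ?_
    rintro ⟨-, x, hx, rfl⟩
    exact ⟨⟨x, hx⟩, rfl⟩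
  · obtain ⟨x, hx, y, hy, hxy⟩ := hadj i j hij
    exact ⟨f x, ⟨x, hx, rfl⟩, f y, ⟨y, hy, rfl⟩, f.toHom.map_adj hxy⟩

theorem IsMinor.refl (G : SimpleGraph V) : IsMinor G G :=
  ⟨fun x => {x}, connected_induce_singleton G, fun _ _ hxy => Set.disjoint_singleton.mpr hxy,
    fun x y hxy => ⟨x, rfl, y, rfl, hxy⟩⟩

theorem IsMinor.card_le [Fintype V] [Fintype W] (h : IsMinor H G) :
    Fintype.card W ≤ Fintype.card V := by
  obtain ⟨B, hconn, hdisj, -⟩ := h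
  choose f hf using fun i => Set.nonempty_coe_sort.mp (hconn i).nonempty
  refine Fintype.card_le_of_injective f fun i j hij => ?_
  by_contra hne
  exact Set.disjoint_left.mp (hdisj i j hne) (hf i) (hij ▸ hf j)

theorem IsMinor.of_contraction {G' : SimpleGraph V'} (h : IsMinor H G')
    (hH : ∀ i, ∃ j, H.Adj i j) {f : V → V'}
    (hf : ∀ y ∈ G'.support, (G.induce (f ⁻¹' {y})).Connected)
    (hadj : ∀ u v, G'.Adj u v → ∃ x y, f x = u ∧ f y = v ∧ G.Adj x y) : IsMinor H G := by
  obtain ⟨B, hconn, hdisj, hB⟩ := h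
  have hsupport : ∀ i, ∀ y ∈ B i, y ∈ G'.support := fun i y hy => by
    obtain ⟨j, hij⟩ := hH i
    obtain ⟨u, hu, v, -, huv⟩ := hB i j hij
    by_cases hyu : u = y
    · exact ⟨v, hyu ▸ huv⟩
    · obtain ⟨a, -, b, -, rfl, -, hab⟩ :=
        exists_adj_of_connected_induce (hconn i) hy (Set.mem_singleton y) hu hyu
      exact ⟨b, hab⟩
  refine ⟨fun i => f ⁻¹' B i,
    fun i => connected_induce_preimage (fun y hy => hf y (hsupport i y hy)) hadj (hconn i),
    fun i j hij => (hdisj i j hij).preimage f, fun i j hij => ?_⟩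
  obtain ⟨u, hu, v, hv, huv⟩ := hB i j hij
  obtain ⟨x, y, rfl, rfl, hxy⟩ := hadj u v huv
  exact ⟨x, hu, y, hv, hxy⟩

/-- Some edge joins a vertex of `A` to a vertex of `B`. -/
def Linked (G : SimpleGraph V) (A B : Set V) : Prop := ∃ x ∈ A, ∃ y ∈ B, G.Adj x y

theorem Linked.symm {A B : Set V} (h : Linked G A B) : Linked G B A :=
  let ⟨x, hx, y, hy, hxy⟩ := h
  ⟨y, hy, x, hx, hxy.symm⟩

theorem Linked.mono {A B A' B' : Set V} (h : Linked G A B) (hA : A ⊆ A') (hB : B ⊆ B') :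
    Linked G A' B' :=
  let ⟨x, hx, y, hy, hxy⟩ := h
  ⟨x, hA hx, y, hB hy, hxy⟩

theorem isMinor_of_lt [LinearOrder W] {B : W → Set V} (hconn : ∀ i, (G.induce (B i)).Connected)
    (hdisj : ∀ i j, i < j → Disjoint (B i) (B j))
    (hadj : ∀ i j, i < j → H.Adj i j → Linked G (B i) (B j)) : IsMinor H G := by
  refine ⟨B, hconn, fun i j hij => ?_, fun i j hij => ?_⟩
  · rcases hij.lt_or_gt with hlt | hlt
    exacts [hdisj i j hlt, (hdisj j i hlt).symm]
  · rcases hij.ne.lt_or_gt with hlt | hlt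
    exacts [hadj i j hlt hij, (hadj j i hlt hij.symm).symm]

theorem isMinor_of_four {H : SimpleGraph (Fin 4)} {A B C D : Set V}
    (hA : (G.induce A).Connected) (hB : (G.induce B).Connected) (hC : (G.induce C).Connected)
    (hD : (G.induce D).Connected) (hAB : Disjoint A B) (hAC : Disjoint A C) (hAD : Disjoint A D)
    (hBC : Disjoint B C) (hBD : Disjoint B D) (hCD : Disjoint C D)
    (l01 : H.Adj 0 1 → Linked G A B) (l02 : H.Adj 0 2 → Linked G A C)
    (l03 : H.Adj 0 3 → Linked G A D) (l12 : H.Adj 1 2 → Linked G B C)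
    (l13 : H.Adj 1 3 → Linked G B D) (l23 : H.Adj 2 3 → Linked G C D) : IsMinor H G := by
  refine isMinor_of_lt (B := ![A, B, C, D]) ?_ ?_ ?_
  · simp [Fin.forall_fin_succ, *]
  · simp [Fin.forall_fin_succ, *]
  · simpa [Fin.forall_fin_succ] using ⟨⟨l01, l02, l03⟩, ⟨l12, l13⟩, l23⟩

end Minor

section Forest

variable {V : Type*} {par : V → Option V} {depth : V → ℕ}

/-- The relation between a vertex and its parent, for a rooted forest that is given by its parent
function. The ancestors of `v` are the `a` with `ReflTransGen (IsParent par) v a`, the proper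
ancestors are those with `TransGen (IsParent par) v a`. -/
def IsParent (par : V → Option V) (v u : V) : Prop := par v = some u

theorem isParent_rightUnique (par : V → Option V) : Relator.RightUnique (IsParent par) :=
  fun _ _ _ h₁ h₂ => Option.some.inj (h₁.symm.trans h₂)

theorem ancestors_comparable {x v w : V} (hv : ReflTransGen (IsParent par) x v)
    (hw : ReflTransGen (IsParent par) x w) :
    ReflTransGen (IsParent par) v w ∨ ReflTransGen (IsParent par) w v :=
  ReflTransGen.total_of_right_unique (isParent_rightUnique par) hv hw

/-- The function `par` has no cycles, as witnessed by the numbering `depth`, which need not be the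
distance to the root. -/
def IsForest (par : V → Option V) (depth : V → ℕ) : Prop :=
  ∀ ⦃v u⦄, IsParent par v u → depth u < depth v

namespace IsForest

theorem depth_le (h : IsForest par depth) {v a : V} (hva : ReflTransGen (IsParent par) v a) :
    depth a ≤ depth v := by
  induction hva with
  | refl => exact le_rfl
  | tail _ hbc ih => exact (h hbc).le.trans ih

theorem depth_lt (h : IsForest par depth) {v a : V} (hva : TransGen (IsParent par) v a) :
    depth a < depth v := by
  obtain ⟨b, hb, hba⟩ := TransGen.tail'_iff.mp hva
  exact (h hba).trans_le (h.depth_le hb)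

theorem not_transGen (h : IsForest par depth) {x y : V}
    (hxy : ReflTransGen (IsParent par) x y) : ¬ TransGen (IsParent par) y x :=
  fun hyx => (h.depth_lt (TransGen.trans_left hyx hxy)).false

theorem eq_of_depth_le (h : IsForest par depth) {v a : V}
    (hva : ReflTransGen (IsParent par) v a) (hd : depth v ≤ depth a) : v = a := by
  rcases reflTransGen_iff_eq_or_transGen.mp hva with rfl | hva
  · rfl
  · exact absurd hd (h.depth_lt hva).not_ge

end IsForest

end Forest

section HubTree

variable {V W : Type*} {G : SimpleGraph V} {H : SimpleGraph W} {par hub : V → Option V}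
  {depth : V → ℕ} {B : Set V}

/-- A vertex is linked to its parent and to its hub. -/
def IsLink (par hub : V → Option V) (v u : V) : Prop := par v = some u ∨ hub v = some u

/-- A rooted forest in which some vertices have, besides the parent, a hub: a proper ancestor, such
that every edge of `G` joins a vertex to its parent or hub. If the hub of `v` is not the parent of
`v`, then it is the parent or the hub of that parent, so the subtree of `v` is attached to the rest
of `G` at the parent and the hub of `v` only; this is a tree decomposition of width two. -/
structure HubTree (G : SimpleGraph V) (par hub : V → Option V) (depth : V → ℕ) : Prop where
  isForest : IsForest par depth
  hub_step : ∀ {v a}, hub v = some a → ∃ u, par v = some u ∧ (u = a ∨ IsLink par hub u a)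
  adj : ∀ {x y}, G.Adj x y → IsLink par hub x y ∨ IsLink par hub y x

namespace HubTree

theorem transGen_of_isLink (h : HubTree G par hub depth) {v a : V} (hva : IsLink par hub v a) :
    TransGen (IsParent par) v a := by
  induction hd : depth v using Nat.strong_induction_on generalizing v with
  | _ n ih =>
    rcases hva with hva | hva
    · exact TransGen.single hva
    · obtain ⟨u, hu, rfl | hua⟩ := h.hub_step hva
      · exact TransGen.single hu
      · exact TransGen.head hu (ih _ (hd ▸ h.isForest hu) hua rfl)

theorem isLink_of_descendant (h : HubTree G par hub depth) {w x y : V}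
    (hx : ReflTransGen (IsParent par) x w) (hxy : IsLink par hub x y) :
    ReflTransGen (IsParent par) y w ∨ IsLink par hub w y := by
  induction hx using ReflTransGen.head_induction_on generalizing y with
  | refl => exact Or.inr hxy
  | @head a b hab hbw ih =>
    rcases hxy with hxy | hxy
    · rw [isParent_rightUnique par hxy hab]
      exact Or.inl hbw
    · obtain ⟨u, hu, huy⟩ := h.hub_step hxy
      obtain rfl := isParent_rightUnique par hu hab
      rcases huy with rfl | huy
      · exact Or.inl hbw
      · exact ih huy

theorem adj_of_descendant (h : HubTree G par hub depth) {w x y : V}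
    (hx : ReflTransGen (IsParent par) x w) (hxy : G.Adj x y) :
    ReflTransGen (IsParent par) y w ∨ IsLink par hub w y := by
  rcases h.adj hxy with hxy | hyx
  · exact h.isLink_of_descendant hx hxy
  · exact Or.inl ((h.transGen_of_isLink hyx).to_reflTransGen.trans hx)

theorem exists_mem_forall_descendant (h : HubTree G par hub depth) (hB : (G.induce B).Connected) :
    ∃ w ∈ B, ∀ x ∈ B, ReflTransGen (IsParent par) x w := by
  have hne : B.Nonempty := Set.nonempty_coe_sort.mp hB.nonempty
  let w := Function.argminOn depth B hne
  have hw : w ∈ B := Function.argminOn_mem depth B hne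
  refine ⟨w, hw, fun x hx => ?_⟩
  by_contra hxw
  obtain ⟨a, -, b, hb, haw, hbw, hab⟩ := exists_adj_of_connected_induce hB
    (C := {z | ReflTransGen (IsParent par) z w}) hw ReflTransGen.refl hx hxw
  have hwb := (h.adj_of_descendant haw hab).resolve_left hbw
  exact Function.not_lt_argminOn depth B hb (h.isForest.depth_lt (h.transGen_of_isLink hwb))

/-- For the branch set whose top vertex `w` is deepest, the neighbouring branch sets are entered by
edges that leave the subtree of `w`, since none of them lies inside that subtree. -/
theorem exists_deepest_branch [Finite W] [Nonempty W] (h : HubTree G par hub depth)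
    {B : W → Set V} (hconn : ∀ i, (G.induce (B i)).Connected)
    (hdisj : ∀ i j, i ≠ j → Disjoint (B i) (B j))
    (hadj : ∀ i j, H.Adj i j → ∃ x ∈ B i, ∃ y ∈ B j, G.Adj x y) :
    ∃ i, ∃ w ∈ B i, ∀ j, H.Adj i j → ∃ x, ReflTransGen (IsParent par) x w ∧
      ∃ y ∈ B j, ¬ ReflTransGen (IsParent par) y w ∧ G.Adj x y := by
  choose t ht htop using fun i => h.exists_mem_forall_descendant (hconn i)
  obtain ⟨i, hi⟩ := Finite.exists_max fun i => depth (t i)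
  refine ⟨i, t i, ht i, fun j hij => ?_⟩
  have hout : ¬ ReflTransGen (IsParent par) (t j) (t i) := fun hji =>
    Set.disjoint_left.mp (hdisj j i hij.ne') (ht j) (h.isForest.eq_of_depth_le hji (hi j) ▸ ht i)
  obtain ⟨x, hx, y, hy, hxy⟩ := hadj i j hij
  by_cases hyw : ReflTransGen (IsParent par) y (t i)
  · obtain ⟨a, -, b, hb, haw, hbw, hab⟩ := exists_adj_of_connected_induce (hconn j)
      (C := {z | ReflTransGen (IsParent par) z (t i)}) hy hyw (ht j) hout
    exact ⟨a, haw, b, hb, hbw, hab⟩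
  · exact ⟨x, htop i x hx, y, hy, hyw, hxy⟩

theorem exists_degree_le_of_isMinor [Fintype W] [Nonempty W] [DecidableRel H.Adj]
    (h : HubTree G par hub depth) (hHG : IsMinor H G) :
    ∃ i w, H.degree i ≤ (par w).toFinset.card + (hub w).toFinset.card := by
  classical
  obtain ⟨B, hconn, hdisj, hadj⟩ := hHG
  obtain ⟨i, w, -, hlink⟩ := h.exists_deepest_branch hconn hdisj hadj
  have : Nonempty V := ⟨w⟩
  choose! x hx z hz hout hxz using hlink
  have hwz : ∀ j, H.Adj i j → IsLink par hub w (z j) := fun j hij =>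
    (h.adj_of_descendant (hx j hij) (hxz j hij)).resolve_left (hout j hij)
  refine ⟨i, w, ?_⟩
  calc H.degree i ≤ ((par w).toFinset ∪ (hub w).toFinset).card := by
        refine Finset.card_le_card_of_injOn z (fun j hj => ?_) fun j hj j' hj' hjj' => ?_
        · rw [Finset.mem_coe, SimpleGraph.mem_neighborFinset] at hj
          simpa [IsLink] using hwz j hj
        · rw [Finset.mem_coe, SimpleGraph.mem_neighborFinset] at hj hj'
          by_contra hne
          exact Set.disjoint_left.mp (hdisj j j' hne) (hz j hj) (hjj' ▸ hz j' hj')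
    _ ≤ _ := Finset.card_union_le _ _

theorem not_isMinor_of_three_le_degree [Fintype W] [Nonempty W] [DecidableRel H.Adj]
    (h : HubTree G par hub depth) (hH : ∀ i, 3 ≤ H.degree i) : ¬ IsMinor H G := by
  intro hHG
  obtain ⟨i, w, hiw⟩ := h.exists_degree_le_of_isMinor hHG
  have hi := hH i
  have hp : (par w).toFinset.card ≤ 1 := by cases par w <;> simp
  have hh : (hub w).toFinset.card ≤ 1 := by cases hub w <;> simp
  omega

theorem not_isMinor_of_two_le_degree [Fintype W] [Nonempty W] [DecidableRel H.Adj]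
    (h : HubTree G par (fun _ => none) depth) (hH : ∀ i, 2 ≤ H.degree i) : ¬ IsMinor H G := by
  intro hHG
  obtain ⟨i, w, hiw⟩ := h.exists_degree_le_of_isMinor hHG
  have hi := hH i
  have hp : (par w).toFinset.card ≤ 1 := by cases par w <;> simp
  rw [Option.toFinset_none, Finset.card_empty] at hiw
  omega

end HubTree

end HubTree

section NormalTree

variable {V : Type*} {G : SimpleGraph V} {r : V} {par : V → Option V} {depth : V → ℕ}

/-- A spanning tree of `G` with root `r`, where `depth` is the distance to the root in the tree. -/
structure SpanningTree (G : SimpleGraph V) (r : V) (par : V → Option V) (depth : V → ℕ) :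
    Prop where
  root : ∀ v, par v = none ↔ v = r
  depth_root : depth r = 0
  adj : ∀ {v u}, IsParent par v u → G.Adj v u
  depth_eq : ∀ {v u}, IsParent par v u → depth v = depth u + 1

namespace SpanningTree

theorem isForest (h : SpanningTree G r par depth) : IsForest par depth := fun _ _ hvu => by
  rw [h.depth_eq hvu]
  exact Nat.lt_succ_self _

theorem exists_isParent (h : SpanningTree G r par depth) {v : V} (hv : v ≠ r) :
    ∃ u, IsParent par v u :=
  Option.ne_none_iff_exists'.mp fun hnone => hv ((h.root v).mp hnone)

theorem reflTransGen_root (h : SpanningTree G r par depth) (v : V) :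
    ReflTransGen (IsParent par) v r := by
  induction hd : depth v using Nat.strong_induction_on generalizing v with
  | _ n ih =>
    by_cases hv : v = r
    · rw [hv]
    · obtain ⟨u, hu⟩ := h.exists_isParent hv
      exact ReflTransGen.head hu (ih (depth u) (hd ▸ h.isForest hu) u rfl)

theorem exists_depth_eq (h : SpanningTree G r par depth) (v : V) {m : ℕ} (hm : m ≤ depth v) :
    ∃ u, depth u = m := by
  induction hm using Nat.decreasingInduction with
  | self => exact ⟨v, rfl⟩
  | of_succ m _ ih =>
    obtain ⟨u, hu⟩ := ih
    have hur : u ≠ r := by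
      rintro rfl
      rw [h.depth_root] at hu
      omega
    obtain ⟨w, hw⟩ := h.exists_isParent hur
    exact ⟨w, by have := h.depth_eq hw; omega⟩

theorem depth_lt_card [Fintype V] (h : SpanningTree G r par depth) (v : V) :
    depth v < Fintype.card V := by
  classical
  have hsub : Finset.range (depth v + 1) ⊆ Finset.univ.image depth := fun m hm => by
    obtain ⟨u, hu⟩ := h.exists_depth_eq v (Nat.lt_succ_iff.mp (Finset.mem_range.mp hm))
    exact Finset.mem_image.mpr ⟨u, Finset.mem_univ _, hu⟩
  simpa [Nat.succ_le_iff] using (Finset.card_le_card hsub).trans Finset.card_image_le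

theorem connected_induce (h : SpanningTree G r par depth) {B : Set V} {v : V} (hv : v ∈ B)
    (hB : ∀ x ∈ B, ReflTransGen (IsParent par) x v)
    (hcl : ∀ x ∈ B, x ≠ v → ∀ y, IsParent par x y → y ∈ B) : (G.induce B).Connected := by
  refine connected_induce_of_reflTransGen hv fun x hx => ?_
  induction hB x hx using ReflTransGen.head_induction_on with
  | refl => exact ReflTransGen.refl
  | @head x y hxy _ ih =>
    by_cases hxv : x = v
    · rw [hxv]
    · have hy := hcl x hx hxv y hxy
      exact ReflTransGen.head ⟨h.adj hxy, hy⟩ (ih hy)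

end SpanningTree

theorem exists_adj_dist_eq_succ (hG : G.Connected) {v r : V} (hv : v ≠ r) :
    ∃ u, G.Adj v u ∧ G.dist v r = G.dist u r + 1 := by
  obtain ⟨p, hp⟩ := hG.exists_walk_length_eq_dist v r
  cases p with
  | nil => exact absurd rfl hv
  | @cons _ u _ hvu p =>
    refine ⟨u, hvu, le_antisymm ?_ ?_⟩
    · have htri := hG.dist_triangle (u := v) (v := u) (w := r)
      rw [SimpleGraph.dist_eq_one_iff_adj.mpr hvu] at htri
      omega
    · rw [← hp, SimpleGraph.Walk.length_cons]
      exact Nat.succ_le_succ (SimpleGraph.dist_le p)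

theorem exists_spanningTree (hG : G.Connected) (r : V) :
    ∃ par depth, SpanningTree G r par depth := by
  classical
  choose f hadj hdist using fun (v : V) (hv : v ≠ r) => exists_adj_dist_eq_succ hG hv
  have hpar : ∀ v u, (if hv : v = r then none else some (f v hv)) = some u →
      ∃ hv : v ≠ r, f v hv = u := by
    intro v u huv
    split_ifs at huv with hv
    exact ⟨hv, Option.some.inj huv⟩
  refine ⟨fun v => if hv : v = r then none else some (f v hv), fun v => G.dist v r,
    fun v => ?_, SimpleGraph.dist_self, fun {v u} huv => ?_, fun {v u} huv => ?_⟩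
  · by_cases hv : v = r <;> simp [hv]
  · obtain ⟨hv, rfl⟩ := hpar v u huv
    exact hadj v hv
  · obtain ⟨hv, rfl⟩ := hpar v u huv
    exact hdist v hv

/-- Making `x` a child of `y` increases the depth of the subtree of `x` and changes no other
depth. -/
theorem SpanningTree.exists_sum_depth_lt [Fintype V] (h : SpanningTree G r par depth) {x y : V}
    (hxy : G.Adj x y) (hyx : ¬ ReflTransGen (IsParent par) y x) (hd : depth x ≤ depth y) :
    ∃ par' depth', SpanningTree G r par' depth' ∧ ∑ v, depth v < ∑ v, depth' v := by
  classical
  have hrx : ¬ ReflTransGen (IsParent par) r x := fun hrx =>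
    hyx (h.isForest.eq_of_depth_le hrx (by simp [h.depth_root]) ▸ h.reflTransGen_root y)
  have hxr : x ≠ r := fun hxr => hrx (hxr ▸ ReflTransGen.refl)
  let e := depth y + 1 - depth x
  let depth' : V → ℕ := fun v => depth v + if ReflTransGen (IsParent par) v x then e else 0
  refine ⟨Function.update par x (some y), depth', ⟨fun v => ?_, ?_, fun {v u} huv => ?_,
    fun {v u} huv => ?_⟩, Finset.sum_lt_sum (fun v _ => Nat.le_add_right _ _)
      ⟨x, Finset.mem_univ x, ?_⟩⟩
  · by_cases hv : v = x
    · simp [hv, hxr]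
    · rw [Function.update_of_ne hv, h.root v]
  · simp only [depth', hrx, if_false, h.depth_root]
  · by_cases hv : v = x
    · obtain rfl : y = u := by simpa [hv, IsParent] using huv
      rwa [hv]
    · rw [IsParent, Function.update_of_ne hv] at huv
      exact h.adj huv
  · by_cases hv : v = x
    · obtain rfl : y = u := by simpa [hv, IsParent] using huv
      simp only [depth', hv, ReflTransGen.refl, if_true, hyx, if_false, e]
      omega
    · rw [IsParent, Function.update_of_ne hv] at huv
      have hiff : ReflTransGen (IsParent par) v x ↔ ReflTransGen (IsParent par) u x := by
        rw [ReflTransGen.cases_head_iff]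
        refine ⟨?_, fun hux => Or.inr ⟨u, huv, hux⟩⟩
        rintro (rfl | ⟨w, hw, hwx⟩)
        · exact absurd rfl hv
        · rwa [isParent_rightUnique par huv hw]
      simp only [depth', hiff, h.depth_eq huv]
      omega
  · simp only [depth', ReflTransGen.refl, if_true, e]
    omega

/-- A rooted spanning tree is normal if the ends of every edge of the graph are comparable in it;
these are the depth-first search trees. -/
structure NormalTree (G : SimpleGraph V) (r : V) (par : V → Option V) (depth : V → ℕ) : Prop
    extends SpanningTree G r par depth where
  comparable_of_adj : ∀ {x y}, G.Adj x y →
    ReflTransGen (IsParent par) x y ∨ ReflTransGen (IsParent par) y x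

/-- A spanning tree that maximises the sum of the depths is normal. -/
theorem exists_normalTree [Finite V] (hG : G.Connected) (r : V) :
    ∃ par depth, NormalTree G r par depth := by
  have := Fintype.ofFinite V
  let sums : Set ℕ := {n | ∃ par depth, SpanningTree G r par depth ∧ ∑ v, depth v = n}
  have hne : sums.Nonempty := by
    obtain ⟨par, depth, h⟩ := exists_spanningTree hG r
    exact ⟨_, par, depth, h, rfl⟩
  have hbdd : BddAbove sums := by
    refine ⟨Fintype.card V * Fintype.card V, ?_⟩
    rintro n ⟨par, depth, h, rfl⟩
    exact Finset.sum_le_card_nsmul _ _ _ fun v _ => (h.depth_lt_card v).le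
  obtain ⟨par, depth, h, hsum⟩ := Nat.sSup_mem hne hbdd
  have hanc : ∀ x y, G.Adj x y → depth x ≤ depth y → ReflTransGen (IsParent par) y x := by
    intro x y hxy hd
    by_contra hyx
    obtain ⟨par', depth', h', hlt⟩ := h.exists_sum_depth_lt hxy hyx hd
    exact absurd (le_csSup hbdd ⟨par', depth', h', rfl⟩) (hsum ▸ hlt).not_ge
  refine ⟨par, depth, h, fun {x y} hxy => ?_⟩
  rcases le_total (depth x) (depth y) with hd | hd
  · exact Or.inr (hanc x y hxy hd)
  · exact Or.inl (hanc y x hxy.symm hd)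

/-- The vertex set of the subtree of `v`. -/
def subtree (par : V → Option V) (v : V) : Set V := {x | ReflTransGen (IsParent par) x v}

/-- The path in the tree from `x` to its proper ancestor `y`, without the end `y`. -/
def treePath (par : V → Option V) (x y : V) : Set V :=
  {z | ReflTransGen (IsParent par) x z ∧ TransGen (IsParent par) z y}

theorem subtree_subset {v w : V} (h : ReflTransGen (IsParent par) v w) :
    subtree par v ⊆ subtree par w := fun _ hx => hx.trans h

namespace SpanningTree

theorem connected_subtree (h : SpanningTree G r par depth) (v : V) :
    (G.induce (subtree par v)).Connected := by
  refine h.connected_induce (v := v) ReflTransGen.refl (fun x hx => hx) fun x hx hxv y hxy => ?_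
  obtain rfl | ⟨z, hz, hzv⟩ := ReflTransGen.cases_head hx
  · exact absurd rfl hxv
  · exact isParent_rightUnique par hxy hz ▸ hzv

theorem connected_subtree_diff (h : SpanningTree G r par depth) {v w : V}
    (hvw : ¬ ReflTransGen (IsParent par) v w) :
    (G.induce (subtree par v \ subtree par w)).Connected := by
  refine h.connected_induce (v := v) ⟨ReflTransGen.refl, hvw⟩ (fun x hx => hx.1)
    fun x hx hxv y hxy => ⟨?_, fun hyw => hx.2 (ReflTransGen.head hxy hyw)⟩
  obtain rfl | ⟨z, hz, hzv⟩ := ReflTransGen.cases_head hx.1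
  · exact absurd rfl hxv
  · exact isParent_rightUnique par hxy hz ▸ hzv

theorem connected_ancestors (h : SpanningTree G r par depth) (v : V) :
    (G.induce {x | ReflTransGen (IsParent par) v x}).Connected :=
  h.connected_induce (h.reflTransGen_root v) (fun x _ => h.reflTransGen_root x)
    fun _ hx _ _ hxy => hx.tail hxy

end SpanningTree

theorem NormalTree.transGen_of_adj (h : NormalTree G r par depth) {x y : V} (hxy : G.Adj x y) :
    TransGen (IsParent par) x y ∨ TransGen (IsParent par) y x := by
  simpa only [reflTransGen_iff_eq_or_transGen, hxy.ne, hxy.ne', false_or] using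
    h.comparable_of_adj hxy

end NormalTree

section CompleteGraphFour

variable {V : Type*} {G : SimpleGraph V} {r : V} {par : V → Option V} {depth : V → ℕ}

/-- The set of the proper ancestors of `b`. -/
def properAncestors (par : V → Option V) (b : V) : Set V := {a | TransGen (IsParent par) b a}

/-- The subtree of `v` is joined to a proper ancestor `b` of the parent of `v` and to some vertex
above `b`. -/
def DoubleLink (G : SimpleGraph V) (par : V → Option V) (v b : V) : Prop :=
  ∃ p, IsParent par v p ∧ TransGen (IsParent par) p b ∧ Linked G (subtree par v) {b} ∧
    Linked G (subtree par v) (properAncestors par b)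

theorem SpanningTree.connected_properAncestors (h : SpanningTree G r par depth) {b u : V}
    (hbu : IsParent par b u) : (G.induce (properAncestors par b)).Connected := by
  have heq : properAncestors par b = {x | ReflTransGen (IsParent par) u x} := by
    ext a
    refine TransGen.head'_iff.trans ⟨?_, fun hua => ⟨u, hbu, hua⟩⟩
    rintro ⟨w, hbw, hwa⟩
    rwa [← isParent_rightUnique par hbw hbu]
  exact heq ▸ h.connected_ancestors u

namespace NormalTree

theorem exists_leaf_mem_subtree [Finite V] (h : NormalTree G r par depth) (u : V) :
    ∃ l ∈ subtree par u, ∀ w, G.Adj l w → TransGen (IsParent par) l w := by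
  obtain ⟨l, hl, hmax⟩ := (Set.toFinite (subtree par u)).exists_maximalFor depth _
    ⟨u, ReflTransGen.refl⟩
  refine ⟨l, hl, fun w hlw => (h.transGen_of_adj hlw).resolve_right fun hwl => ?_⟩
  have hlt := h.isForest.depth_lt hwl
  exact absurd (hmax (TransGen.to_reflTransGen hwl |>.trans hl) hlt.le) hlt.not_ge

variable (hdeg : ∀ v a b, ∃ w, G.Adj v w ∧ w ≠ a ∧ w ≠ b)
include hdeg

theorem exists_doubleLink_mem_subtree [Finite V] (h : NormalTree G r par depth) (u : V) :
    ∃ l ∈ subtree par u, ∃ b, DoubleLink G par l b := by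
  obtain ⟨l, hl, hanc⟩ := h.exists_leaf_mem_subtree u
  obtain ⟨w, hlw, -⟩ := hdeg l l l
  obtain ⟨p, hp, -⟩ := TransGen.head'_iff.mp (hanc w hlw)
  have habove : ∀ w, G.Adj l w → w ≠ p → TransGen (IsParent par) p w := fun w hlw hwp => by
    obtain ⟨p', hp', hpw⟩ := TransGen.head'_iff.mp (hanc w hlw)
    obtain rfl := isParent_rightUnique par hp hp'
    exact (reflTransGen_iff_eq_or_transGen.mp hpw).resolve_left hwp
  have hlink : ∀ a b, G.Adj l a → G.Adj l b → TransGen (IsParent par) p b →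
      TransGen (IsParent par) b a → DoubleLink G par l b := fun a b hla hlb hpb hba =>
    ⟨p, hp, hpb, ⟨l, ReflTransGen.refl, b, rfl, hlb⟩, ⟨l, ReflTransGen.refl, a, hba, hla⟩⟩
  obtain ⟨x, hlx, hxp, -⟩ := hdeg l p p
  obtain ⟨y, hly, hyp, hyx⟩ := hdeg l p x
  have hpx := habove x hlx hxp
  have hpy := habove y hly hyp
  rcases ancestors_comparable hpx.to_reflTransGen hpy.to_reflTransGen with hxy | hyx'
  · exact ⟨l, hl, x, hlink y x hly hlx hpx
      ((reflTransGen_iff_eq_or_transGen.mp hxy).resolve_left hyx)⟩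
  · exact ⟨l, hl, y, hlink x y hlx hly hpy
      ((reflTransGen_iff_eq_or_transGen.mp hyx').resolve_left hyx.symm)⟩

theorem linked_properAncestors_of_maximal [Finite V] (h : NormalTree G r par depth) {b : V}
    (hmax : ∀ v b', DoubleLink G par v b' → depth b' ≤ depth b) {u : V}
    (hub : TransGen (IsParent par) u b) : Linked G (subtree par u) (properAncestors par b) := by
  obtain ⟨l, hlu, b', hlb'⟩ := h.exists_doubleLink_mem_subtree hdeg u
  have hd := hmax l b' hlb'
  obtain ⟨p, hp, hpb', -, hlink⟩ := hlb'
  have hbb' : ReflTransGen (IsParent par) b b' := by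
    rcases ancestors_comparable (hlu.trans hub.to_reflTransGen)
      (ReflTransGen.head hp hpb'.to_reflTransGen) with hbb' | hbb'
    · exact hbb'
    · rw [h.isForest.eq_of_depth_le hbb' hd]
  exact hlink.mono (subtree_subset hlu) fun a ha => TransGen.trans_right hbb' ha

/-- The parent `p` of `v` has a neighbour other than `b` and `v`. It is above `b`, or in another
branch at `p`, which is joined to the vertices above `b` as `b` is maximal, or in the subtree of a
child `u` of `v`; in the last case the double link from `u` to `p` contradicts the choice of `b`. -/
theorem linked_subtree_diff_of_maximal [Finite V] (h : NormalTree G r par depth) {v p b : V}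
    (hmax : ∀ v b', DoubleLink G par v b' → depth b' ≤ depth b) (hvp : IsParent par v p)
    (hpb : IsParent par p b) :
    Linked G (subtree par p \ subtree par v) (properAncestors par b) := by
  obtain ⟨w, hpw, hwb, hwv⟩ := hdeg p b v
  rcases h.transGen_of_adj hpw with hanc | hdesc
  · obtain ⟨b', hpb', hbw⟩ := TransGen.head'_iff.mp hanc
    obtain rfl := isParent_rightUnique par hpb hpb'
    exact ⟨p, ⟨ReflTransGen.refl, fun hpv => h.isForest.not_transGen hpv (TransGen.single hvp)⟩,
      w, (reflTransGen_iff_eq_or_transGen.mp hbw).resolve_left hwb, hpw⟩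
  obtain ⟨u, hwu, hup⟩ := TransGen.tail'_iff.mp hdesc
  by_cases huv : u = v
  · subst huv
    obtain ⟨u', hwu', hu'u⟩ :=
      TransGen.tail'_iff.mp ((reflTransGen_iff_eq_or_transGen.mp hwu).resolve_left (Ne.symm hwv))
    have hdouble : DoubleLink G par u' p := by
      refine ⟨u, hu'u, TransGen.single hvp, ⟨w, hwu', p, rfl, hpw.symm⟩, ?_⟩
      refine (h.linked_properAncestors_of_maximal hdeg hmax
        (TransGen.head hu'u (TransGen.head hvp (TransGen.single hpb)))).mono subset_rfl ?_
      exact fun a ha => TransGen.head hpb ha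
    exact absurd (hmax u' p hdouble) (h.isForest hpb).not_ge
  · refine (h.linked_properAncestors_of_maximal hdeg hmax
      (TransGen.head hup (TransGen.single hpb))).mono ?_ subset_rfl
    refine fun x hxu => ⟨hxu.tail hup, fun hxv => ?_⟩
    have hne : ∀ {x y}, IsParent par x p → IsParent par y p → ReflTransGen (IsParent par) x y →
        x = y := fun {x y} hx hy hxy => by
      refine h.isForest.eq_of_depth_le hxy ?_
      rw [h.depth_eq hx, h.depth_eq hy]
    rcases ancestors_comparable hxu hxv with huv' | hvu
    exacts [huv (hne hup hvp huv'), huv (hne hvp hup hvu).symm]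

end NormalTree

/-- Among the double links to a deepest `b`, the one with the highest `v` starts at a grandchild
of `b`. The branch sets are the subtree of `v`, the rest of the subtree of the parent of `v`, `b`
itself and the vertices above `b`. -/
theorem isMinor_top_four_of_three_neighbors [Finite V] (hG : G.Connected)
    (hdeg : ∀ v a b, ∃ w, G.Adj v w ∧ w ≠ a ∧ w ≠ b) : IsMinor (⊤ : SimpleGraph (Fin 4)) G := by
  have := Fintype.ofFinite V
  obtain ⟨r⟩ := hG.nonempty
  obtain ⟨par, depth, h⟩ := exists_normalTree hG r
  obtain ⟨l, -, b₀, hb₀⟩ := h.exists_doubleLink_mem_subtree hdeg r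
  obtain ⟨b, ⟨v₀, hv₀⟩, hmax⟩ := (Set.toFinite {b | ∃ v, DoubleLink G par v b}).exists_maximalFor
    depth _ ⟨b₀, l, hb₀⟩
  replace hmax : ∀ v b', DoubleLink G par v b' → depth b' ≤ depth b := fun v b' hvb' =>
    (le_total _ _).elim (hmax ⟨v, hvb'⟩) id
  obtain ⟨v, ⟨p, hvp, hpb, hvb, hlink⟩, hmin⟩ :=
    (Set.toFinite {v | DoubleLink G par v b}).exists_minimalFor depth _ ⟨v₀, hv₀⟩
  have hpb' : IsParent par p b := by
    obtain ⟨q, hpq, hqb⟩ := TransGen.head'_iff.mp hpb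
    rcases reflTransGen_iff_eq_or_transGen.mp hqb with rfl | hqb
    · exact hpq
    · have hsub := subtree_subset (ReflTransGen.single hvp)
      have hlt := h.isForest hvp
      exact absurd (hmin ⟨q, hpq, hqb, hvb.mono hsub subset_rfl, hlink.mono hsub subset_rfl⟩
        hlt.le) hlt.not_ge
  obtain ⟨-, -, a, hba, -⟩ := hlink
  obtain ⟨u, hbu, -⟩ := TransGen.head'_iff.mp hba
  have hpv : ¬ ReflTransGen (IsParent par) p v := fun hpv =>
    h.isForest.not_transGen hpv (TransGen.single hvp)
  have hbnot : b ∉ subtree par p := fun hbp => h.isForest.not_transGen hbp hpb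
  have hanc : Disjoint (subtree par p) (properAncestors par b) :=
    Set.disjoint_left.mpr fun x hxp hbx => h.isForest.not_transGen hxp (hpb.trans hbx)
  have hvp' : subtree par v ⊆ subtree par p := subtree_subset (ReflTransGen.single hvp)
  refine isMinor_of_four (h.connected_subtree v) (h.connected_subtree_diff hpv)
    (connected_induce_singleton G b) (h.connected_properAncestors hbu)
    Set.disjoint_sdiff_right (Set.disjoint_singleton_right.mpr fun hb => hbnot (hvp' hb))
    (hanc.mono_left hvp') (Set.disjoint_singleton_right.mpr fun hb => hbnot hb.1)
    (hanc.mono_left Set.sdiff_subset) ?_ ?_ ?_ ?_ ?_ ?_ ?_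
  · exact Set.disjoint_singleton_left.mpr (h.isForest.not_transGen ReflTransGen.refl)
  · exact fun _ => ⟨v, ReflTransGen.refl, p, ⟨ReflTransGen.refl, hpv⟩, h.adj hvp⟩
  · exact fun _ => hvb
  · exact fun _ => h.linked_properAncestors_of_maximal hdeg hmax (TransGen.head hvp hpb)
  · exact fun _ => ⟨p, ⟨ReflTransGen.refl, hpv⟩, b, rfl, h.adj hpb'⟩
  · exact fun _ => h.linked_subtree_diff_of_maximal hdeg hmax hvp hpb'
  · exact fun _ => ⟨b, rfl, u, TransGen.single hbu, h.adj hbu⟩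

end CompleteGraphFour

section Elimination

variable {V : Type*} {G G' : SimpleGraph V} {x a b : V}

/-- The neighbours of `x` in `G` are `a` and `b`, possibly equal, and `G'` arises from `G` by
isolating `x` and joining `a` to `b` if they are distinct. -/
structure Elimination (G G' : SimpleGraph V) (x a b : V) : Prop where
  adj_left : G.Adj x a
  adj_right : G.Adj x b
  eq_or_eq : ∀ {w}, G.Adj x w → w = a ∨ w = b
  adj_iff : ∀ {u v}, G'.Adj u v ↔ u ≠ v ∧ u ≠ x ∧ v ≠ x ∧ (G.Adj u v ∨ s(u, v) = s(a, b))

namespace Elimination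

theorem symm (e : Elimination G G' x a b) : Elimination G G' x b a where
  adj_left := e.adj_right
  adj_right := e.adj_left
  eq_or_eq hw := (e.eq_or_eq hw).symm
  adj_iff := by
    rw [Sym2.eq_swap (a := b)]
    exact e.adj_iff

theorem not_adj (e : Elimination G G' x a b) (w : V) : ¬ G'.Adj x w := fun h =>
  (e.adj_iff.mp h).2.1 rfl

theorem adj_or_eq (e : Elimination G G' x a b) {u v : V} (h : G'.Adj u v) :
    G.Adj u v ∨ s(u, v) = s(a, b) :=
  (e.adj_iff.mp h).2.2.2

theorem adj_cases (e : Elimination G G' x a b) {u v : V} (h : G.Adj u v) :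
    G'.Adj u v ∨ (u = x ∧ (v = a ∨ v = b)) ∨ (v = x ∧ (u = a ∨ u = b)) := by
  by_cases hu : u = x
  · exact Or.inr (Or.inl ⟨hu, e.eq_or_eq (hu ▸ h)⟩)
  by_cases hv : v = x
  · exact Or.inr (Or.inr ⟨hv, e.eq_or_eq (hv ▸ h.symm)⟩)
  · exact Or.inl (e.adj_iff.mpr ⟨h.ne, hu, hv, Or.inl h⟩)

theorem support_ssubset (e : Elimination G G' x a b) : G'.support ⊂ G.support := by
  refine ⟨fun u ⟨v, huv⟩ => ?_, fun hsub => ?_⟩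
  · rcases e.adj_or_eq huv with huv | huv
    · exact ⟨v, huv⟩
    · rcases Sym2.eq_iff.mp huv with ⟨rfl, -⟩ | ⟨rfl, -⟩
      exacts [⟨x, e.adj_left.symm⟩, ⟨x, e.adj_right.symm⟩]
  · obtain ⟨w, hw⟩ := hsub ⟨a, e.adj_left⟩
    exact e.not_adj w hw

/-- Contract the edge from `x` to `a`. -/
theorem isMinor {W : Type*} {H : SimpleGraph W} (e : Elimination G G' x a b)
    (hH : ∀ i, ∃ j, H.Adj i j) (h : IsMinor H G') : IsMinor H G := by
  classical
  refine h.of_contraction hH (f := Function.update id x a) (fun y ⟨w, hyw⟩ => ?_)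
    fun u v huv => ?_
  · have hyx : y ≠ x := (e.adj_iff.mp hyw).2.1
    refine connected_induce_of_reflTransGen (w := y) (by simp [hyx]) fun z hz => ?_
    by_cases hzx : z = x
    · obtain rfl : a = y := by simpa [hzx] using hz
      exact ReflTransGen.single ⟨hzx ▸ e.adj_left, by simp [hyx]⟩
    · obtain rfl : z = y := by simpa [hzx] using hz
      exact ReflTransGen.refl
  · obtain ⟨-, hu, hv, huv | huv⟩ := e.adj_iff.mp huv
    · exact ⟨u, v, by simp [hu], by simp [hv], huv⟩
    · rcases Sym2.eq_iff.mp huv with ⟨rfl, rfl⟩ | ⟨rfl, rfl⟩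
      · exact ⟨x, v, by simp, by simp [hv], e.adj_right⟩
      · exact ⟨u, x, by simp [hu], by simp, e.adj_right.symm⟩

end Elimination

theorem exists_neighbors_pair_of_not_isMinor [Finite V]
    (hK : ¬ IsMinor (⊤ : SimpleGraph (Fin 4)) G) (hG : G ≠ ⊥) :
    ∃ x a b, G.Adj x a ∧ G.Adj x b ∧ ∀ w, G.Adj x w → w = a ∨ w = b := by
  by_contra! hdeg
  obtain ⟨v, v', hvv'⟩ := SimpleGraph.ne_bot_iff_exists_adj.mp hG
  let C := G.connectedComponentMk v
  have hnbr : ∀ u ∈ C, ∃ w, G.Adj u w := by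
    intro u hu
    by_cases huv : u = v
    · exact ⟨v', huv ▸ hvv'⟩
    · obtain ⟨_ | ⟨huw, -⟩⟩ := SimpleGraph.ConnectedComponent.exact hu
      exacts [absurd rfl huv, ⟨_, huw⟩]
  have hthree : ∀ u a b : C, ∃ w, C.toSimpleGraph.Adj u w ∧ w ≠ a ∧ w ≠ b := by
    intro u a b
    have hrepl : ∀ a : C, ∃ a', G.Adj u a' ∧ (G.Adj u a → a' = a) := fun a => by
      by_cases hua : G.Adj u a
      · exact ⟨a, hua, fun _ => rfl⟩
      · obtain ⟨w, huw⟩ := hnbr u u.2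
        exact ⟨w, huw, fun h => absurd h hua⟩
    obtain ⟨a', hua', haa'⟩ := hrepl a
    obtain ⟨b', hub', hbb'⟩ := hrepl b
    obtain ⟨w, huw, hwa, hwb⟩ := hdeg u a' b' hua' hub'
    refine ⟨⟨w, C.mem_supp_of_adj_mem_supp u.2 huw⟩, huw, ?_, ?_⟩
    · rintro rfl
      exact hwa (haa' huw).symm
    · rintro rfl
      exact hwb (hbb' huw).symm
  exact hK ((isMinor_top_four_of_three_neighbors C.connected_toSimpleGraph hthree).isContained_right
    ⟨(SimpleGraph.Embedding.induce C.supp).toCopy⟩)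

theorem exists_elimination [Finite V] (hK : ¬ IsMinor (⊤ : SimpleGraph (Fin 4)) G) (hG : G ≠ ⊥) :
    ∃ G' x a b, Elimination G G' x a b := by
  obtain ⟨x, a, b, hxa, hxb, hN⟩ := exists_neighbors_pair_of_not_isMinor hK hG
  refine ⟨SimpleGraph.mk (fun u v => u ≠ v ∧ u ≠ x ∧ v ≠ x ∧ (G.Adj u v ∨ s(u, v) = s(a, b)))
    ⟨fun u v => ?_⟩ ⟨fun u => ?_⟩, x, a, b, hxa, hxb, fun {w} => hN w, Iff.rfl⟩
  · rw [G.adj_comm v u, Sym2.eq_swap (a := v)]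
    tauto
  · exact fun h => h.1 rfl

end Elimination

section RoutedTree

variable {V : Type*} {G G' : SimpleGraph V} {par par' hub via : V → Option V} {depth : V → ℕ}
  {col : Sym2 V → Option V} {o : Option V} {x a b c : V}

/-- The edges of colour `c` for a partial edge colouring whose colours are vertices. They contain a
path from `c` to its parent when these two are not adjacent. -/
def route (col : Sym2 V → Option V) (c : V) : SimpleGraph V :=
  SimpleGraph.fromEdgeSet {e | col e = some c}

theorem route_adj {u v : V} : (route col c).Adj u v ↔ col s(u, v) = some c ∧ u ≠ v :=
  SimpleGraph.fromEdgeSet_adj _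

/-- The route of `c` connects `c` to its parent. -/
def Leads (par : V → Option V) (col : Sym2 V → Option V) (c : V) : Prop :=
  ∃ u, par c = some u ∧ (route col c).Reachable c u

/-- Edge-disjoint routes in `G` for the colours of `col`. Different routes may meet only at their
ends: `via y` is the only colour of which `y` can be an interior vertex. -/
structure Routing (G : SimpleGraph V) (par via : V → Option V) (col : Sym2 V → Option V) :
    Prop where
  mem_edgeSet : ∀ {e c}, col e = some c → e ∈ G.edgeSet
  via_eq : ∀ {e c y}, col e = some c → y ∈ e → y = c ∨ par c = some y ∨ via y = some c
  leads : ∀ {e c}, col e = some c → Leads par col c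

/-- A tree decomposition of width two in which every vertex is joined to its parent by an edge or
by a route. The field `double` is what keeps the construction going: a parent-child pair `a`, `b`
that is needed by a child `y` of `a` can be separated by subdividing its edge. -/
structure RoutedTree (G : SimpleGraph V) (par hub via : V → Option V) (depth : V → ℕ)
    (col : Sym2 V → Option V) : Prop
    extends HubTree G par hub depth, Routing G par via col where
  hub_ne : ∀ {v a}, par v = some a → hub v ≠ some a
  par_adj : ∀ {v a}, par v = some a → G.Adj v a ∨ Leads par col v
  double : ∀ {y a b}, par y = some a → par a = some b → hub y = some b → Leads par col a

theorem Leads.of_reachable {col' : Sym2 V → Option V} (h : Leads par col c)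
    (hpar : par' c = par c)
    (hcol : ∀ {u v}, u ≠ v → col s(u, v) = some c → (route col' c).Reachable u v) :
    Leads par' col' c := by
  obtain ⟨u, hcu, hreach⟩ := h
  refine ⟨u, hpar.trans hcu, ?_⟩
  rw [SimpleGraph.reachable_iff_reflTransGen] at hreach
  clear hcu
  induction hreach with
  | refl => rfl
  | tail _ huv ih => exact ih.trans (hcol (route_adj.mp huv).2 (route_adj.mp huv).1)

theorem Routing.mem_support (h : Routing G par via col) {u v : V}
    (hr : (route col c).Reachable u v) (hne : u ≠ v) : u ∈ G.support ∧ v ∈ G.support := by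
  have hend : ∀ {u v : V}, (route col c).Reachable u v → u ≠ v → u ∈ G.support := by
    rintro u v ⟨_ | ⟨hadj, -⟩⟩ hne
    exacts [absurd rfl hne, ⟨_, h.mem_edgeSet (route_adj.mp hadj).1⟩]
  exact ⟨hend hr hne, hend hr.symm hne.symm⟩

namespace RoutedTree

theorem mem_support_of_par (h : RoutedTree G par hub via depth col) {u v : V}
    (hvu : par v = some u) : v ∈ G.support ∧ u ∈ G.support := by
  rcases h.par_adj hvu with hadj | ⟨w, hvw, hr⟩
  · exact ⟨⟨u, hadj⟩, ⟨v, hadj.symm⟩⟩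
  · obtain rfl := isParent_rightUnique par hvu hvw
    exact h.toRouting.mem_support hr (ne_of_apply_ne depth (h.isForest hvu).ne')

theorem mem_support_of_hub (h : RoutedTree G par hub via depth col) {v u : V}
    (hvu : hub v = some u) : v ∈ G.support ∧ u ∈ G.support := by
  obtain ⟨w, hvw, -⟩ := h.hub_step hvu
  refine ⟨(h.mem_support_of_par hvw).1, ?_⟩
  obtain ⟨w, -, hwu⟩ := TransGen.tail'_iff.mp (h.transGen_of_isLink (Or.inr hvu))
  exact (h.mem_support_of_par hwu).2

theorem bot : RoutedTree (⊥ : SimpleGraph V) (fun _ => none) (fun _ => none) (fun _ => none)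
    (fun _ => 0) (fun _ => none) where
  isForest _ _ h := nomatch h
  hub_step h := nomatch h
  adj h := h.elim
  mem_edgeSet h := nomatch h
  via_eq h := nomatch h
  leads h := nomatch h
  hub_ne h := nomatch h
  par_adj h := nomatch h
  double h := nomatch h

end RoutedTree

/-- The colouring that reroutes the colour of the edge `ab` along the path `a`, `x`, `b` and gives
the edge `ab` the colour `o` instead. -/
def detour [DecidableEq V] (x a b : V) (o : Option V) (col : Sym2 V → Option V) (e : Sym2 V) :
    Option V :=
  if e = s(x, a) ∨ e = s(x, b) then col s(a, b) else if e = s(a, b) then o else col e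

variable [DecidableEq V]

theorem detour_eq_some {e : Sym2 V} (h : detour x a b o col e = some c) :
    (e = s(x, a) ∨ e = s(x, b)) ∧ col s(a, b) = some c ∨ e = s(a, b) ∧ o = some c ∨
      e ≠ s(a, b) ∧ col e = some c := by
  unfold detour at h
  split_ifs at h <;> tauto

theorem Elimination.detour_edge (e : Elimination G G' x a b) :
    detour x a b o col s(a, b) = o := by
  rw [detour, if_neg, if_pos rfl]
  simp [e.adj_left.ne', e.adj_right.ne']

theorem Elimination.leads_detour (e : Elimination G G' x a b) (hr : Routing G' par via col)
    (h : Leads par col c) (hpar : par' c = par c) : Leads par' (detour x a b o col) c := by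
  have hx : ∀ w, col s(x, w) ≠ some c := fun w hw => e.not_adj w (hr.mem_edgeSet hw)
  refine h.of_reachable hpar fun {u v} huv hcol => ?_
  by_cases hab : s(u, v) = s(a, b)
  · have hstep : ∀ w, w = a ∨ w = b → (route (detour x a b o col) c).Reachable x w := by
      intro w hw
      have hadj : G.Adj x w := by rcases hw with rfl | rfl; exacts [e.adj_left, e.adj_right]
      refine SimpleGraph.Adj.reachable (route_adj.mpr ⟨?_, hadj.ne⟩)
      rw [detour, if_pos (by rcases hw with rfl | rfl <;> simp), ← hab, hcol]
    have hu : u = a ∨ u = b := by simpa [hab] using Sym2.mem_mk_left u v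
    have hv : v = a ∨ v = b := by simpa [hab] using Sym2.mem_mk_right u v
    exact (hstep u hu).symm.trans (hstep v hv)
  · refine SimpleGraph.Adj.reachable (route_adj.mpr ⟨?_, huv⟩)
    rw [detour, if_neg, if_neg hab, hcol]
    rintro (h | h) <;> exact hx _ (h ▸ hcol)

theorem Elimination.routing (e : Elimination G G' x a b) (h : Routing G' par via col)
    (hpar : ∀ c, Leads par col c → par' c = par c)
    (ho : ∀ c, o = some c → c = a ∧ G.Adj a b ∧ par' a = some b) :
    Routing G par' (Function.update via x (col s(a, b))) (detour x a b o col) := by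
  have hvia : ∀ {e c y}, y ≠ x → col e = some c → y ∈ e →
      y = c ∨ par' c = some y ∨ Function.update via x (col s(a, b)) y = some c := by
    intro e c y hyx hec hye
    rw [hpar c (h.leads hec), Function.update_of_ne hyx]
    exact h.via_eq hec hye
  refine ⟨fun {f c} hf => ?_, fun {f c y} hf hy => ?_, fun {f c} hf => ?_⟩ <;>
    rcases detour_eq_some hf with ⟨hfx, hab⟩ | ⟨rfl, hoc⟩ | ⟨hfab, hfc⟩
  · rcases hfx with rfl | rfl
    exacts [e.adj_left, e.adj_right]
  · exact (ho c hoc).2.1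
  · induction f with
    | _ u v => exact (e.adj_or_eq (h.mem_edgeSet hfc)).resolve_right hfab
  · by_cases hyx : y = x
    · subst hyx
      exact Or.inr (Or.inr (by simpa using hab))
    · refine hvia hyx hab ?_
      rcases hfx with rfl | rfl <;> simp_all
  · obtain ⟨rfl, -, hcb⟩ := ho c hoc
    rcases Sym2.mem_iff.mp hy with rfl | rfl
    exacts [Or.inl rfl, Or.inr (Or.inl hcb)]
  · refine hvia ?_ hfc hy
    rintro rfl
    obtain ⟨w, rfl⟩ := hy
    exact e.not_adj w (h.mem_edgeSet hfc)
  · exact e.leads_detour h (h.leads hab) (hpar c (h.leads hab))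
  · obtain ⟨rfl, hadj, hcb⟩ := ho c hoc
    refine ⟨b, hcb, SimpleGraph.Adj.reachable (route_adj.mpr ⟨?_, hadj.ne⟩)⟩
    rwa [e.detour_edge]
  · exact e.leads_detour h (h.leads hfc) (hpar c (h.leads hfc))

end RoutedTree

section Extension

variable {V : Type*} {G G' : SimpleGraph V} {par hub via : V → Option V} {depth : V → ℕ}
  {col : Sym2 V → Option V} {x a b : V}

theorem HubTree.attach [DecidableEq V] {par' hub' : V → Option V} (h : HubTree G' par hub depth)
    (e : Elimination G G' x a b) (hx : ∀ {v u}, IsLink par hub v u → v ≠ x ∧ u ≠ x)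
    (hpar : ∀ {v}, v ≠ x → par' v = par v) (hhub : ∀ {v}, v ≠ x → hub' v = hub v)
    (hxa : par' x = some a) (hxb : IsLink par' hub' x b)
    (hhub_x : ∀ {c}, hub' x = some c → b = c ∧ IsLink par hub a b) :
    HubTree G par' hub' (Function.update depth x (depth a + 1)) := by
  have hlink : ∀ {v u}, IsLink par hub v u → IsLink par' hub' v u := fun hvu => by
    rwa [IsLink, hpar (hx hvu).1, hhub (hx hvu).1]
  refine ⟨fun v u hvu => ?_, fun {v c} hvc => ?_, fun {u v} huv => ?_⟩
  · by_cases hv : v = x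
    · obtain rfl : a = u := Option.some.inj (hxa.symm.trans (hv ▸ hvu))
      simp [hv, e.adj_left.ne']
    · have hvu : par v = some u := (hpar hv).symm.trans hvu
      simpa [hv, (hx (Or.inl hvu)).2] using h.isForest hvu
  · by_cases hv : v = x
    · obtain ⟨rfl, hab⟩ := hhub_x (hv ▸ hvc)
      exact ⟨a, hv ▸ hxa, Or.inr (hlink hab)⟩
    · obtain ⟨u, hvu, huc⟩ := h.hub_step ((hhub hv).symm.trans hvc)
      exact ⟨u, (hpar hv).trans hvu, huc.imp_right hlink⟩
  · have hxw : ∀ {w}, w = a ∨ w = b → IsLink par' hub' x w := by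
      rintro w (rfl | rfl)
      exacts [Or.inl hxa, hxb]
    rcases e.adj_cases huv with huv | ⟨rfl, hv⟩ | ⟨rfl, hu⟩
    exacts [(h.adj huv).imp hlink hlink, Or.inl (hxw hv), Or.inr (hxw hu)]

theorem IsForest.insert [DecidableEq V] {par' : V → Option V} (h : IsForest par depth)
    (hx : ∀ {v}, par v ≠ some x) (hpar : ∀ {v}, v ≠ x → v ≠ a → par' v = par v)
    (hax : par' a = some x) (hxb : par' x = some b) (hab : par a = some b) (hxa : a ≠ x) :
    IsForest par' (Function.update (fun v => 2 * depth v) x (2 * depth a - 1)) := by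
  have hxb' : b ≠ x := fun hb => hx (hb ▸ hab)
  have hdepth : depth b < depth a := h hab
  intro v u hvu
  rcases eq_or_ne v x with rfl | hv
  · obtain rfl := isParent_rightUnique par' hvu hxb
    simp only [Function.update_self, Function.update_of_ne hxb']
    omega
  rcases eq_or_ne v a with rfl | hva
  · obtain rfl := isParent_rightUnique par' hvu hax
    simp only [Function.update_self, Function.update_of_ne hxa]
    omega
  · have hvu : par v = some u := (hpar hv hva).symm.trans hvu
    have hux : u ≠ x := fun hu => hx (hu ▸ hvu)
    simpa [hv, hux] using h hvu

theorem HubTree.insert [DecidableEq V] {par' hub' : V → Option V} (h : HubTree G' par hub depth)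
    (e : Elimination G G' x a b) (hx : ∀ {v u}, IsLink par hub v u → v ≠ x ∧ u ≠ x)
    (hpar : ∀ {v}, v ≠ x → v ≠ a → par' v = par v) (hhub : ∀ {v}, v ≠ x → hub' v = hub v)
    (hax : par' a = some x) (hxb : par' x = some b) (hhub_x : hub' x = hub a)
    (hab : par a = some b) (hne : hub a ≠ some b) (hchild : ∀ {y}, par y = some a → hub y ≠ some b)
    (hadj : ¬ G.Adj a b) :
    HubTree G par' hub' (Function.update (fun v => 2 * depth v) x (2 * depth a - 1)) := by
  have hxa : a ≠ x := e.adj_left.ne'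
  have hba : b ≠ a := ne_of_apply_ne depth (h.isForest hab).ne
  have hlink : ∀ {v u}, IsLink par hub v u → v = a ∧ u = b ∨ IsLink par' hub' v u := by
    rintro v u (hvu | hvu)
    · by_cases hv : v = a
      · exact Or.inl ⟨hv, isParent_rightUnique par (hv ▸ hvu) hab⟩
      · exact Or.inr (Or.inl ((hpar (hx (Or.inl hvu)).1 hv).trans hvu))
    · exact Or.inr (Or.inr ((hhub (hx (Or.inr hvu)).1).trans hvu))
  refine ⟨h.isForest.insert (fun hv => (hx (Or.inl hv)).2 rfl) hpar hax hxb hab hxa,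
    fun {v c} hvc => ?_, fun {u v} huv => ?_⟩
  · rcases eq_or_ne v x with rfl | hv
    · obtain ⟨u, hau, huc⟩ := h.hub_step (hhub_x.symm.trans hvc)
      obtain rfl := isParent_rightUnique par hau hab
      refine ⟨u, hxb, huc.imp_right fun huc => (hlink huc).resolve_left fun h => hba h.1⟩
    rcases eq_or_ne v a with rfl | hva
    · exact ⟨x, hax, Or.inr (Or.inr (hhub_x.trans ((hhub hv).symm.trans hvc)))⟩
    · obtain ⟨u, hvu, huc⟩ := h.hub_step ((hhub hv).symm.trans hvc)
      refine ⟨u, (hpar hv hva).trans hvu, huc.imp_right fun huc => (hlink huc).resolve_left ?_⟩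
      rintro ⟨rfl, rfl⟩
      exact hchild hvu ((hhub hv).symm.trans hvc)
  · rcases e.adj_cases huv with huv' | ⟨rfl, rfl | rfl⟩ | ⟨rfl, rfl | rfl⟩
    · have hne : ∀ {u v}, G.Adj u v → ¬ (u = a ∧ v = b) := fun h ⟨hu, hv⟩ => hadj (hu ▸ hv ▸ h)
      exact (h.adj huv').imp (fun h => (hlink h).resolve_left (hne huv))
        fun h => (hlink h).resolve_left (hne huv.symm)
    exacts [Or.inr (Or.inl hax), Or.inl (Or.inl hxb), Or.inl (Or.inl hax), Or.inr (Or.inl hxb)]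

namespace RoutedTree

theorem par_ne_of_elimination (h : RoutedTree G' par hub via depth col) (e : Elimination G G' x a b)
    {v u : V} (hvu : par v = some u) : v ≠ x ∧ u ≠ x := by
  obtain ⟨⟨w, hw⟩, ⟨w', hw'⟩⟩ := h.mem_support_of_par hvu
  exact ⟨(e.adj_iff.mp hw).2.1, (e.adj_iff.mp hw').2.1⟩

theorem isLink_ne_of_elimination (h : RoutedTree G' par hub via depth col)
    (e : Elimination G G' x a b) {v u : V} (hvu : IsLink par hub v u) : v ≠ x ∧ u ≠ x := by
  rcases hvu with hvu | hvu
  · exact h.par_ne_of_elimination e hvu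
  · obtain ⟨⟨w, hw⟩, ⟨w', hw'⟩⟩ := h.mem_support_of_hub hvu
    exact ⟨(e.adj_iff.mp hw).2.1, (e.adj_iff.mp hw').2.1⟩

theorem attach_of_routing [DecidableEq V] {par' hub' via' : V → Option V}
    {col' : Sym2 V → Option V} (h : RoutedTree G' par hub via depth col)
    (e : Elimination G G' x a b) (hpar : ∀ {v}, v ≠ x → par' v = par v)
    (hhub : ∀ {v}, v ≠ x → hub' v = hub v) (hxa : par' x = some a) (hxb : IsLink par' hub' x b)
    (hhub_x : ∀ {c}, hub' x = some c → b = c ∧ IsLink par hub a b)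
    (hrouting : Routing G par' via' col') (hlead : ∀ {c}, Leads par col c → Leads par' col' c)
    (hlead_a : par a = some b → Leads par' col' a) :
    RoutedTree G par' hub' via' (Function.update depth x (depth a + 1)) col' := by
  have hab : IsLink par hub a b → depth b < depth a := fun hab =>
    h.isForest.depth_lt (h.transGen_of_isLink hab)
  refine { toHubTree := h.toHubTree.attach e (h.isLink_ne_of_elimination e) hpar hhub hxa hxb hhub_x
           toRouting := hrouting, hub_ne := fun {v u} hvu hvh => ?_
           par_adj := fun {v u} hvu => ?_, double := fun {v c d} hvc hcd hvd => ?_ }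
  all_goals by_cases hv : v = x
  · obtain rfl : a = u := Option.some.inj (hxa.symm.trans (hv ▸ hvu))
    obtain ⟨rfl, hlink⟩ := hhub_x (hv ▸ hvh)
    exact (hab hlink).false
  · exact h.hub_ne ((hpar hv).symm.trans hvu) ((hhub hv).symm.trans hvh)
  · obtain rfl : a = u := Option.some.inj (hxa.symm.trans (hv ▸ hvu))
    exact Or.inl (hv ▸ e.adj_left)
  · have hvu : par v = some u := (hpar hv).symm.trans hvu
    rcases h.par_adj hvu with hadj | hvu'
    · rcases e.adj_or_eq hadj with hadj | heq
      · exact Or.inl hadj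
      · rcases Sym2.eq_iff.mp heq with ⟨rfl, rfl⟩ | ⟨rfl, rfl⟩
        · exact Or.inr (hlead_a hvu)
        · rcases hxb with hxb | hxb
          · exact absurd (Option.some.inj (hxa.symm.trans hxb)) hadj.ne'
          · exact absurd (h.isForest hvu) (hab (hhub_x hxb).2).asymm
    · exact Or.inr (hlead hvu')
  · obtain rfl : a = c := Option.some.inj (hxa.symm.trans (hv ▸ hvc))
    obtain ⟨rfl, -⟩ := hhub_x (hv ▸ hvd)
    exact hlead_a ((hpar e.adj_left.ne').symm.trans hcd)
  · have hvc : par v = some c := (hpar hv).symm.trans hvc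
    have hc : c ≠ x := (h.par_ne_of_elimination e hvc).2
    exact hlead (h.double hvc ((hpar hc).symm.trans hcd) ((hhub hv).symm.trans hvd))

theorem attach (h : RoutedTree G' par hub via depth col) (e : Elimination G G' x a b)
    (hab : a = b ∨ hub a = some b ∨ par a = some b ∧ (G.Adj a b ∨ Leads par col a)) :
    ∃ par hub via depth col, RoutedTree G par hub via depth col := by
  classical
  let par' := Function.update par x (some a)
  let hub' := Function.update hub x (if a = b then none else some b)
  let o := if G.Adj a b ∧ par a = some b then some a else none
  have hpar : ∀ {v}, v ≠ x → par' v = par v := fun hv => Function.update_of_ne hv ..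
  have hxa : par' x = some a := Function.update_self ..
  have hroute : ∀ {c}, Leads par col c → par' c = par c := fun ⟨_, hc, _⟩ =>
    hpar (h.par_ne_of_elimination e hc).1
  have hrouting : Routing G par' (Function.update via x (col s(a, b))) (detour x a b o col) := by
    refine e.routing h.toRouting (fun c => hroute) fun c hc => ?_
    simp only [o, Option.ite_none_right_eq_some, Option.some.injEq] at hc
    exact ⟨hc.2.symm, hc.1.1, (hpar e.adj_left.ne').trans hc.1.2⟩
  have hlead : ∀ {c}, Leads par col c → Leads par' (detour x a b o col) c := fun hc =>
    e.leads_detour h.toRouting hc (hroute hc)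
  refine ⟨par', hub', _, _, _, h.attach_of_routing e hpar
    (fun hv => Function.update_of_ne hv ..) hxa ?_ (fun {c} hc => ?_) hrouting hlead fun hpab => ?_⟩
  · by_cases hne : a = b
    exacts [Or.inl (hne ▸ hxa), Or.inr (by simp [hub', hne])]
  · obtain ⟨hne, rfl⟩ : a ≠ b ∧ b = c := by simpa [hub'] using hc
    rcases hab with hab | hab | ⟨hab, -⟩
    exacts [absurd hab hne, ⟨rfl, Or.inr hab⟩, ⟨rfl, Or.inl hab⟩]
  · by_cases hadj : G.Adj a b
    · exact hrouting.leads (e := s(a, b)) (by simp [e.detour_edge, o, hadj, hpab])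
    · rcases hab with rfl | hab | ⟨-, hab | hab⟩
      exacts [absurd (h.isForest hpab) (lt_irrefl _), absurd hab (h.hub_ne hpab),
        absurd hab hadj, hlead hab]

theorem insert_of_routing [DecidableEq V] {par' hub' via' : V → Option V}
    {col' : Sym2 V → Option V} (h : RoutedTree G' par hub via depth col)
    (e : Elimination G G' x a b) (hpar : ∀ {v}, v ≠ x → v ≠ a → par' v = par v)
    (hhub : ∀ {v}, v ≠ x → hub' v = hub v) (hax : par' a = some x) (hxb : par' x = some b)
    (hhub_x : hub' x = hub a) (hab : par a = some b) (hadj : ¬ G.Adj a b)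
    (hleads : ¬ Leads par col a) (hrouting : Routing G par' via' col')
    (hlead : ∀ {c}, Leads par col c → Leads par' col' c) :
    RoutedTree G par' hub' via' (Function.update (fun v => 2 * depth v) x (2 * depth a - 1))
      col' := by
  have hhub_x_ne : ∀ {v}, hub v ≠ some x := fun hv =>
    (h.isLink_ne_of_elimination e (Or.inr hv)).2 rfl
  refine { toHubTree := h.toHubTree.insert e (h.isLink_ne_of_elimination e) hpar hhub hax hxb hhub_x
             hab (h.hub_ne hab) (fun hya hyb => hleads (h.double hya hab hyb)) hadj
           toRouting := hrouting, hub_ne := fun {v u} hvu hvh => ?_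
           par_adj := fun {v u} hvu => ?_, double := fun {v c d} hvc hcd hvd => ?_ }
  all_goals rcases eq_or_ne v x with rfl | hv
  · obtain rfl := isParent_rightUnique par' hvu hxb
    exact h.hub_ne hab (hhub_x.symm.trans hvh)
  · rcases eq_or_ne v a with rfl | hva
    · obtain rfl := isParent_rightUnique par' hvu hax
      exact hhub_x_ne ((hhub hv).symm.trans hvh)
    · exact h.hub_ne ((hpar hv hva).symm.trans hvu) ((hhub hv).symm.trans hvh)
  · obtain rfl := isParent_rightUnique par' hvu hxb
    exact Or.inl e.adj_right
  · rcases eq_or_ne v a with rfl | hva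
    · obtain rfl := isParent_rightUnique par' hvu hax
      exact Or.inl e.adj_left.symm
    · have hvu : par v = some u := (hpar hv hva).symm.trans hvu
      refine (h.par_adj hvu).imp (fun h' => (e.adj_or_eq h').resolve_right fun heq => ?_) hlead
      rcases Sym2.eq_iff.mp heq with ⟨rfl, -⟩ | ⟨rfl, rfl⟩
      exacts [hva rfl, (h.isForest hvu).asymm (h.isForest hab)]
  · obtain rfl := isParent_rightUnique par' hvc hxb
    have hca : c ≠ a := ne_of_apply_ne depth (h.isForest hab).ne
    exact hlead (h.double hab ((hpar e.adj_right.ne' hca).symm.trans hcd) (hhub_x.symm.trans hvd))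
  · have hvd : hub v = some d := (hhub hv).symm.trans hvd
    rcases eq_or_ne v a with rfl | hva
    · obtain rfl := isParent_rightUnique par' hvc hax
      obtain rfl := isParent_rightUnique par' hcd hxb
      exact absurd hvd (h.hub_ne hab)
    · have hvc : par v = some c := (hpar hv hva).symm.trans hvc
      rcases eq_or_ne c a with rfl | hca
      · exact absurd (isParent_rightUnique par' hcd hax ▸ hvd) hhub_x_ne
      · have hc : c ≠ x := (h.par_ne_of_elimination e hvc).2
        exact hlead (h.double hvc ((hpar hc hca).symm.trans hcd) hvd)

theorem insert (h : RoutedTree G' par hub via depth col) (e : Elimination G G' x a b)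
    (hab : par a = some b) (hadj : ¬ G.Adj a b) (hleads : ¬ Leads par col a) :
    ∃ par hub via depth col, RoutedTree G par hub via depth col := by
  classical
  let par' := Function.update (Function.update par a (some x)) x (some b)
  have hpar : ∀ {v}, v ≠ x → v ≠ a → par' v = par v := fun hv hva => by simp [par', hv, hva]
  have hroute : ∀ {c}, Leads par col c → par' c = par c := fun hc =>
    hpar (h.par_ne_of_elimination e hc.choose_spec.1).1 fun hca => hleads (hca ▸ hc)
  exact ⟨par', Function.update hub x (hub a), _, _, _, h.insert_of_routing e hpar
    (fun hv => Function.update_of_ne hv ..) (by simp [par', e.adj_left.ne'])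
    (Function.update_self ..) (Function.update_self ..) hab hadj hleads
    (e.routing h.toRouting (o := none) (fun c => hroute) nofun)
    fun hc => e.leads_detour h.toRouting hc (hroute hc)⟩

theorem exists_of_not_isMinor [Finite V] (hK : ¬ IsMinor (⊤ : SimpleGraph (Fin 4)) G) :
    ∃ par hub via depth col, RoutedTree G par hub via depth col := by
  induction hn : G.support.ncard using Nat.strong_induction_on generalizing G with
  | _ n ih =>
    by_cases hG : G = ⊥
    · exact ⟨_, _, _, _, _, hG ▸ bot⟩
    obtain ⟨G', x, a, b, e⟩ := exists_elimination hK hG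
    obtain ⟨par, hub, via, depth, col, h⟩ := ih _ (hn ▸ Set.ncard_lt_ncard e.support_ssubset)
      (fun hK' => hK (e.isMinor (fun i => ⟨i + 1, by simp⟩) hK')) rfl
    by_cases hab : a = b
    · exact h.attach e (Or.inl hab)
    have hab' : G'.Adj a b := e.adj_iff.mpr ⟨hab, e.adj_left.ne', e.adj_right.ne', Or.inr rfl⟩
    wlog hlink : IsLink par hub a b generalizing a b
    · exact this b a e.symm (Ne.symm hab) hab'.symm ((h.adj hab').resolve_left hlink)
    by_cases hattach : hub a = some b ∨ par a = some b ∧ (G.Adj a b ∨ Leads par col a)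
    · exact h.attach e (Or.inr hattach)
    · have hpar : par a = some b := by rcases hlink with h | h <;> tauto
      exact h.insert e hpar (by tauto) (by tauto)

end RoutedTree

end Extension

section Routes

theorem exists_card_bounded_rank {V α : Type*} [Fintype V] [LinearOrder α] (f : V → α) :
    ∃ g : V → ℕ, (∀ v, g v ≤ Fintype.card V) ∧ ∀ u v, f u < f v → g u < g v := by
  refine ⟨fun v => Finset.card {u | f u < f v}, fun v => Finset.card_le_univ _,
    fun u v huv => Finset.card_lt_card (Finset.ssubset_iff_of_subset ?_ |>.mpr ⟨u, ?_, ?_⟩)⟩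
  · exact Finset.monotone_filter_right _ fun w _ hw => hw.trans huv
  · simpa using huv
  · simp

variable {V : Type*} {G : SimpleGraph V} {par hub via : V → Option V} {depth : V → ℕ}
  {col : Sym2 V → Option V}

theorem exists_adj_dist_lt {u v : V} (h : G.Reachable u v) (hne : u ≠ v) :
    ∃ w, G.Adj u w ∧ G.Reachable w v ∧ G.dist w v < G.dist u v := by
  obtain ⟨p, hp⟩ := h.exists_walk_length_eq_dist
  cases p with
  | nil => exact absurd rfl hne
  | @cons _ w _ huw q =>
    exact ⟨w, huw, q.reachable, hp ▸ Nat.lt_succ_of_le (SimpleGraph.dist_le q)⟩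

/-- The vertex `z` is an interior vertex of a shortest path along a route; the pair `p` consists of
the end of the route and of the distance of `z` from it. -/
def OnRoute (par via : V → Option V) (col : Sym2 V → Option V) (z : V) (p : V × ℕ) : Prop :=
  ∃ c u, via z = some c ∧ par c = some u ∧ z ≠ u ∧ (route col c).Reachable z u ∧
    (route col c).dist z u < (route col c).dist c u ∧ p = (u, (route col c).dist z u)

theorem onRoute_rightUnique : Relator.RightUnique (OnRoute par via col) := by
  rintro z _ _ ⟨c, u, hzc, hcu, -, -, -, rfl⟩ ⟨c', u', hzc', hcu', -, -, -, rfl⟩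
  obtain rfl : c = c' := Option.some.inj (hzc.symm.trans hzc')
  obtain rfl : u = u' := Option.some.inj (hcu.symm.trans hcu')
  rfl

theorem Routing.exists_onRoute (h : Routing G par via col) {c u z : V} (hcu : par c = some u)
    (hz : (route col c).Reachable z u) (hne : z ≠ u)
    (hd : (route col c).dist z u ≤ (route col c).dist c u) :
    ∃ w, G.Adj z w ∧ (w = u ∨ ∃ d < (route col c).dist z u, OnRoute par via col w (u, d)) := by
  obtain ⟨w, hzw, hw, hlt⟩ := exists_adj_dist_lt hz hne
  have hcol := (route_adj.mp hzw).1
  refine ⟨w, h.mem_edgeSet hcol, or_iff_not_imp_left.mpr fun hwu => ⟨_, hlt, c, u, ?_, hcu, hwu,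
    hw, hlt.trans_le hd, rfl⟩⟩
  rcases h.via_eq hcol (Sym2.mem_mk_right z w) with rfl | hcw | hvia
  · exact absurd hd hlt.not_ge
  · exact absurd (Option.some.inj (hcw.symm.trans hcu)) hwu
  · exact hvia

theorem RoutedTree.exists_target (h : RoutedTree G par hub via depth col) :
    ∃ (target : V → Option V) (dist : V → ℕ),
      (∀ v u, par v = some u → ∃ w, G.Adj v w ∧ (w = u ∨ target w = some u)) ∧
      ∀ v u, target v = some u →
        ∃ w, G.Adj v w ∧ (w = u ∨ target w = some u ∧ dist w < dist v) := by
  have hex : ∀ z, ∃ o : Option (V × ℕ), ∀ p, o = some p ↔ OnRoute par via col z p := fun z => by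
    by_cases hz : ∃ p, OnRoute par via col z p
    · obtain ⟨p, hp⟩ := hz
      exact ⟨some p, fun q => ⟨fun hq => Option.some.inj hq ▸ hp,
        fun hq => congrArg some (onRoute_rightUnique hp hq)⟩⟩
    · exact ⟨none, fun q => ⟨nofun, fun hq => absurd ⟨q, hq⟩ hz⟩⟩
  choose o ho using hex
  refine ⟨fun z => (o z).map Prod.fst, fun z => (o z).elim 0 Prod.snd, fun v u hvu => ?_,
    fun v u hvu => ?_⟩
  · rcases h.par_adj hvu with hadj | ⟨u', hvu', hreach⟩
    · exact ⟨u, hadj, Or.inl rfl⟩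
    obtain rfl := isParent_rightUnique par hvu hvu'
    obtain ⟨w, hvw, hw⟩ := h.exists_onRoute hvu hreach (ne_of_apply_ne depth (h.isForest hvu).ne')
      le_rfl
    exact ⟨w, hvw, hw.imp_right fun ⟨d, _, hd⟩ => by simp [(ho w _).mpr hd]⟩
  · obtain ⟨p, hv, rfl⟩ := Option.map_eq_some_iff.mp hvu
    obtain ⟨c, u, -, hcu, hne, hreach, hlt, rfl⟩ := (ho v _).mp hv
    obtain ⟨w, hvw, hw⟩ := h.exists_onRoute hcu hreach hne hlt.le
    exact ⟨w, hvw, hw.imp_right fun ⟨d, hd, hwd⟩ => by simpa [(ho w _).mpr hwd, hv] using hd⟩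

end Routes

section TreeLabels

/-- The position of a vertex in a rooted forest with hubs: its depth and the identifiers of its
parent and of its hub. -/
structure TreeLabel where
  depth : ℕ
  par : Option ℕ
  hub : Option ℕ

/-- The coordinates of a label, to be encoded in a certificate. -/
def TreeLabel.toVec (l : TreeLabel) : Fin 3 → ℕ :=
  ![l.depth, Encodable.encode l.par, Encodable.encode l.hub]

theorem TreeLabel.toVec_injective : Function.Injective TreeLabel.toVec := by
  rintro ⟨_, _, _⟩ ⟨_, _, _⟩ h
  simpa [toVec] using h

variable {V : Type} {par hub : V → Option V} {depth : V → ℕ} {ident : V → ℕ}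

/-- The labels that describe the forest given by `par`, `hub` and `depth`. -/
def treeLabel (ident : V → ℕ) (par hub : V → Option V) (depth : V → ℕ) (v : V) : TreeLabel :=
  ⟨depth v, (par v).map ident, (hub v).map ident⟩

theorem IsIdentifierAssignment.encode_map_le [Fintype V] {k : ℕ}
    (hid : IsIdentifierAssignment k ident) (o : Option V) :
    Encodable.encode (o.map ident) ≤ (Fintype.card V + 1) ^ (k + 1) := by
  cases o with
  | none => simp
  | some v =>
    calc Encodable.encode ((some v).map ident) = ident v + 1 := by simp
      _ ≤ (Fintype.card V + 1) ^ k + 1 := by grw [hid.le_pow v, Nat.le_succ (Fintype.card V)]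
      _ ≤ (Fintype.card V + 1) ^ (k + 1) :=
        Nat.pow_lt_pow_right (by have := Fintype.card_pos_iff.mpr ⟨v⟩; omega) (Nat.lt_succ_self k)

theorem IsIdentifierAssignment.toVec_treeLabel_le [Fintype V] {k : ℕ}
    (hid : IsIdentifierAssignment k ident) (hdepth : ∀ v, depth v ≤ Fintype.card V) (v : V)
    (i : Fin 3) :
    (treeLabel ident par hub depth v).toVec i ≤ (Fintype.card V + 1) ^ (k + 1) := by
  have hcard : Fintype.card V ≤ (Fintype.card V + 1) ^ (k + 1) :=
    (Nat.le_succ _).trans (Nat.le_self_pow k.succ_ne_zero _)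
  fin_cases i
  exacts [(hdepth v).trans hcard, hid.encode_map_le _, hid.encode_map_le _]

/-- The partial function on the vertices whose values have the identifiers given by `f`. -/
noncomputable def decode (ident : V → ℕ) (f : V → Option ℕ) (v : V) : Option V :=
  (f v).bind (Function.partialInv ident)

theorem decode_eq_some (hid : Function.Injective ident) {f : V → Option ℕ} {v u : V} :
    decode ident f v = some u ↔ f v = some (ident u) := by
  simp [decode, Option.bind_eq_some_iff, hid.isPartialInv _ _]

end TreeLabels

section RouteLabels

/-- The label of a vertex in the certification of `K₄`-minor-free graphs. The route of a child of
the vertex with identifier `target` is traced by the interior vertices, which repeat the label of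
the target as `claim`, at decreasing values of `dist`. -/
structure RouteLabel where
  own : TreeLabel
  parent : TreeLabel
  target : Option ℕ
  claim : TreeLabel
  dist : ℕ

/-- The coordinates of a label, to be encoded in a certificate. -/
def RouteLabel.toVec (l : RouteLabel) : Fin 3 ⊕ Fin 3 ⊕ Fin 3 ⊕ Fin 2 → ℕ :=
  Sum.elim l.own.toVec (Sum.elim l.parent.toVec
    (Sum.elim l.claim.toVec ![Encodable.encode l.target, l.dist]))

theorem RouteLabel.toVec_injective : Function.Injective RouteLabel.toVec := by
  rintro ⟨_, _, _, _, _⟩ ⟨_, _, _, _, _⟩ h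
  simpa [toVec, Sum.elim_eq_iff, TreeLabel.toVec_injective.eq_iff, and_left_comm] using h

/-- The local conditions on the label `l` of the vertex with identifier `i`, given the identifiers
and labels `s` of the neighbours. -/
structure RouteCheck (i : ℕ) (l : RouteLabel) (s : Set (ℕ × RouteLabel)) : Prop where
  root : l.own.par = none → l.own.hub = none
  depth_lt : ∀ p, l.own.par = some p → l.parent.depth < l.own.depth
  parent : ∀ p, l.own.par = some p →
    ∃ q ∈ s, q.1 = p ∧ q.2.own = l.parent ∨ q.2.target = some p ∧ q.2.claim = l.parent
  hub : ∀ a, l.own.hub = some a →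
    l.own.par = some a ∨ l.parent.par = some a ∨ l.parent.hub = some a
  target : ∀ t, l.target = some t → ∃ q ∈ s, q.1 = t ∧ q.2.own = l.claim ∨
    q.2.target = some t ∧ q.2.claim = l.claim ∧ q.2.dist < l.dist
  edge : ∀ q ∈ s, (l.own.par = some q.1 ∨ l.own.hub = some q.1) ∨
    q.2.own.par = some i ∨ q.2.own.hub = some i

variable {V : Type} {G : SimpleGraph V} {ident : V → ℕ} {c : V → RouteLabel}

theorem own_eq_claim (hc : ∀ v, RouteCheck (ident v) (c v) (labelView G ident c v)) {v : V}
    {t : ℕ} (ht : (c v).target = some t) : ∃ u, ident u = t ∧ (c u).own = (c v).claim := by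
  induction hd : (c v).dist using Nat.strong_induction_on generalizing v with
  | _ d ih =>
    obtain ⟨_, ⟨w, -, rfl⟩, ⟨hw, hown⟩ | ⟨htw, hclaim, hlt⟩⟩ := (hc v).target t ht
    · exact ⟨w, hw, hown⟩
    · exact hclaim ▸ ih _ (hd ▸ hlt) htw rfl

theorem own_eq_parent (hc : ∀ v, RouteCheck (ident v) (c v) (labelView G ident c v)) {v : V}
    {p : ℕ} (hp : (c v).own.par = some p) : ∃ u, ident u = p ∧ (c u).own = (c v).parent := by
  obtain ⟨_, ⟨w, -, rfl⟩, ⟨hw, hown⟩ | ⟨htw, hclaim⟩⟩ := (hc v).parent p hp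
  · exact ⟨w, hw, hown⟩
  · exact hclaim ▸ own_eq_claim hc htw

theorem hubTree_of_routeCheck (hid : Function.Injective ident)
    (hc : ∀ v, RouteCheck (ident v) (c v) (labelView G ident c v)) :
    HubTree G (decode ident fun v => (c v).own.par) (decode ident fun v => (c v).own.hub)
      (fun v => (c v).own.depth) where
  isForest v u hvu := by
    have hp := (decode_eq_some hid).mp hvu
    obtain ⟨w, hw, hown⟩ := own_eq_parent hc hp
    obtain rfl := hid hw
    simpa only [hown] using (hc v).depth_lt _ hp
  hub_step {v a} hva := by
    rw [decode_eq_some hid] at hva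
    obtain ⟨p, hp⟩ := Option.ne_none_iff_exists'.mp fun hnone =>
      Option.some_ne_none _ (hva.symm.trans ((hc v).root hnone))
    obtain ⟨u, rfl, hown⟩ := own_eq_parent hc hp
    refine ⟨u, (decode_eq_some hid).mpr hp, ?_⟩
    simp only [IsLink, decode_eq_some hid, hown]
    refine ((hc v).hub _ hva).imp_left fun hpa => hid ?_
    simpa [hp] using hpa
  adj {x y} hxy := by
    simp only [IsLink, decode_eq_some hid]
    exact (hc x).edge _ ⟨y, hxy, rfl⟩

/-- The labels that describe a forest and the routes of its vertices to their parents. -/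
def routeLabel (ident : V → ℕ) (par hub target : V → Option V) (depth dist : V → ℕ) (v : V) :
    RouteLabel where
  own := treeLabel ident par hub depth v
  parent := treeLabel ident par hub depth ((par v).getD v)
  target := (target v).map ident
  claim := treeLabel ident par hub depth ((target v).getD v)
  dist := dist v

variable {par hub target : V → Option V} {depth dist : V → ℕ}

theorem IsIdentifierAssignment.toVec_routeLabel_le [Fintype V] {k : ℕ}
    (hid : IsIdentifierAssignment k ident) (hdepth : ∀ v, depth v ≤ Fintype.card V)
    (hdist : ∀ v, dist v ≤ Fintype.card V) (v : V) (i) :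
    (routeLabel ident par hub target depth dist v).toVec i ≤ (Fintype.card V + 1) ^ (k + 1) := by
  have hown := hid.toVec_treeLabel_le (par := par) (hub := hub) hdepth
  have hv : dist v ≤ (Fintype.card V + 1) ^ (k + 1) :=
    ((hdist v).trans (Nat.le_succ _)).trans (Nat.le_self_pow k.succ_ne_zero _)
  revert i
  simp [routeLabel, RouteLabel.toVec, hown, Fin.forall_fin_two, hid.encode_map_le, hv]

theorem HubTree.routeCheck (h : HubTree G par hub depth) (hid : Function.Injective ident)
    (hpar : ∀ v u, par v = some u → ∃ w, G.Adj v w ∧ (w = u ∨ target w = some u))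
    (htarget : ∀ v u, target v = some u →
      ∃ w, G.Adj v w ∧ (w = u ∨ target w = some u ∧ dist w < dist v)) (v : V) :
    RouteCheck (ident v) (routeLabel ident par hub target depth dist v)
      (labelView G ident (routeLabel ident par hub target depth dist) v) where
  root hroot := by
    refine Option.map_eq_none_iff.mpr (Option.eq_none_iff_forall_ne_some.mpr fun a ha => ?_)
    obtain ⟨u, hu, -⟩ := h.hub_step ha
    simp [routeLabel, treeLabel, hu] at hroot
  depth_lt p hp := by
    obtain ⟨u, hu, rfl⟩ := Option.map_eq_some_iff.mp hp
    simpa [routeLabel, treeLabel, hu] using h.isForest hu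
  parent p hp := by
    obtain ⟨u, hu, rfl⟩ := Option.map_eq_some_iff.mp hp
    obtain ⟨w, hvw, hw⟩ := hpar v u hu
    refine ⟨_, ⟨w, hvw, rfl⟩, hw.imp ?_ fun hw => ?_⟩
    · rintro rfl
      simp [routeLabel, hu]
    · simp [routeLabel, hu, hw]
  hub a ha := by
    obtain ⟨a, hva, rfl⟩ := Option.map_eq_some_iff.mp ha
    obtain ⟨u, hu, hua⟩ := h.hub_step hva
    simpa [routeLabel, treeLabel, hu, hid.eq_iff, IsLink] using hua
  target t ht := by
    obtain ⟨u, hu, rfl⟩ := Option.map_eq_some_iff.mp ht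
    obtain ⟨w, hvw, hw⟩ := htarget v u hu
    refine ⟨_, ⟨w, hvw, rfl⟩, hw.imp ?_ fun hw => ?_⟩
    · rintro rfl
      simp [routeLabel, hu]
    · simp [routeLabel, hu, hw]
  edge := by
    rintro _ ⟨w, hvw, rfl⟩
    simpa [routeLabel, treeLabel, hid.eq_iff, IsLink] using h.adj hvw

theorem hasLogCertification_minorFree_top_four (k : ℕ) :
    HasLogCertification k (minorFree (⊤ : SimpleGraph (Fin 4))) := by
  refine hasLogCertification_of_labels RouteLabel.toVec RouteLabel.toVec_injective RouteCheck
    (k + 1) (fun V _ G ident _ hid hG => ?_) fun V _ G ident _ hid c hc => ?_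
  · obtain ⟨par, hub, via, depth, col, h⟩ := RoutedTree.exists_of_not_isMinor hG
    obtain ⟨depth', hdepth, hlt⟩ := exists_card_bounded_rank depth
    obtain ⟨target, dist, hpar, htarget⟩ := h.exists_target
    obtain ⟨dist', hdist, hdlt⟩ := exists_card_bounded_rank dist
    refine ⟨routeLabel ident par hub target depth' dist', hid.toVec_routeLabel_le hdepth hdist,
      HubTree.routeCheck ⟨fun _ _ hvu => hlt _ _ (h.isForest hvu), h.hub_step, h.adj⟩
        hid.injective hpar fun v u hvu => ?_⟩
    obtain ⟨w, hvw, hw⟩ := htarget v u hvu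
    exact ⟨w, hvw, hw.imp_right fun hw => ⟨hw.1, hdlt _ _ hw.2⟩⟩
  · exact (hubTree_of_routeCheck hid.injective hc).not_isMinor_of_three_le_degree (by simp)

end RouteLabels

section SmallGraphs

/-- The graph whose edges are the pairs in the list `l`. -/
def graphOfList {α : Type*} [DecidableEq α] (l : List (α × α)) : SimpleGraph α :=
  SimpleGraph.fromRel fun i j => (i, j) ∈ l

instance {α : Type*} [DecidableEq α] (l : List (α × α)) : DecidableRel (graphOfList l).Adj :=
  fun i j => inferInstanceAs (Decidable (i ≠ j ∧ ((i, j) ∈ l ∨ (j, i) ∈ l)))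

/-- The complete graph `K₄` without the edge `23`. -/
abbrev diamondGraph : SimpleGraph (Fin 4) := graphOfList [(0, 1), (0, 2), (0, 3), (1, 2), (1, 3)]

/-- The cycle of length four, with the numbering that makes it a subgraph of `diamondGraph`. -/
abbrev fourCycle : SimpleGraph (Fin 4) := graphOfList [(0, 2), (0, 3), (1, 2), (1, 3)]

end SmallGraphs

section CactusTree

variable {V W : Type*} {G : SimpleGraph V} {H : SimpleGraph W} {par hub : V → Option V}
  {depth : V → ℕ}

/-- A rooted forest that exhibits `G` as a graph whose cycles are pairwise edge-disjoint. If the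
edge from `v` to its parent lies on a cycle, then the hub of `v` is the topmost vertex of that
cycle, so the hub may be the parent. -/
structure CactusTree (G : SimpleGraph V) (par hub : V → Option V) (depth : V → ℕ) : Prop where
  isForest : IsForest par depth
  hub_step : ∀ {v a}, hub v = some a → ∃ u, par v = some u ∧ (u = a ∨ hub u = some a)
  adj : ∀ {x y}, G.Adj x y → IsLink par hub x y ∨ IsLink par hub y x
  child_unique : ∀ {v c c' a}, par c = some v → par c' = some v → hub c = some a →
    hub c' = some a → a ≠ v → c = c'
  closing : ∀ {v c a}, par c = some v → hub c = some a → G.Adj v a → par v = some a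

theorem exists_isParent_notMem {S : Set V} {x y : V} (hxy : ReflTransGen (IsParent par) x y)
    (hx : x ∈ S) (hy : y ∉ S) :
    ∃ z ∈ S, ∃ z' ∉ S, ReflTransGen (IsParent par) x z ∧ IsParent par z z' ∧
      ReflTransGen (IsParent par) z' y := by
  induction hxy using ReflTransGen.head_induction_on with
  | refl => exact absurd hx hy
  | @head a b hab hby ih =>
    by_cases hb : b ∈ S
    · obtain ⟨z, hz, z', hz', hbz, hzz', hzy⟩ := ih hb
      exact ⟨z, hz, z', hz', hbz.head hab, hzz', hzy⟩
    · exact ⟨a, hx, b, hb, .refl, hab, hby⟩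

theorem eq_of_isParent_of_notMem {x y w : V} (hx : ReflTransGen (IsParent par) x w)
    (hy : ¬ ReflTransGen (IsParent par) y w) (hxy : IsParent par x y) : x = w := by
  obtain rfl | ⟨z, hz, hzw⟩ := ReflTransGen.cases_head hx
  · rfl
  · exact absurd (isParent_rightUnique par hz hxy ▸ hzw) hy

namespace CactusTree

theorem hubTree (h : CactusTree G par hub depth) : HubTree G par hub depth where
  isForest := h.isForest
  hub_step hva := by
    obtain ⟨u, hu, hua⟩ := h.hub_step hva
    exact ⟨u, hu, hua.imp_right Or.inr⟩
  adj := h.adj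

theorem transGen_of_hub (h : CactusTree G par hub depth) {v a : V} (hva : hub v = some a) :
    TransGen (IsParent par) v a :=
  h.hubTree.transGen_of_isLink (Or.inr hva)

theorem hub_eq_of_ancestor (h : CactusTree G par hub depth) {v z a : V} (hv : hub v = some a)
    (hvz : ReflTransGen (IsParent par) v z) (hza : TransGen (IsParent par) z a) :
    hub z = some a := by
  induction hvz using ReflTransGen.head_induction_on with
  | refl => exact hv
  | @head x y hxy hyz ih =>
    obtain ⟨u, hu, hua⟩ := h.hub_step hv
    obtain rfl := isParent_rightUnique par hu hxy
    refine hua.elim ?_ ih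
    rintro rfl
    exact absurd hza (h.isForest.not_transGen hyz)

theorem hub_eq_of_adj (h : CactusTree G par hub depth) {w x y : V}
    (hx : ReflTransGen (IsParent par) x w) (hy : ¬ ReflTransGen (IsParent par) y w)
    (hxy : G.Adj x y) (hpar : par x ≠ some y) : hub w = some y := by
  have hyx : ¬ IsLink par hub y x := fun hyx =>
    hy ((h.hubTree.transGen_of_isLink hyx).to_reflTransGen.trans hx)
  have hhub : hub x = some y := ((h.adj hxy).resolve_right hyx).resolve_left hpar
  refine h.hub_eq_of_ancestor hhub hx ?_
  obtain hwy | hyw := ancestors_comparable hx (h.transGen_of_hub hhub).to_reflTransGen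
  · exact (reflTransGen_iff_eq_or_transGen.mp hwy).resolve_left fun hwy => hy (hwy ▸ .refl)
  · exact absurd hyw hy

theorem eq_of_adj_hub (h : CactusTree G par hub depth) {v x x' a : V}
    (hx : ReflTransGen (IsParent par) x v) (hx' : ReflTransGen (IsParent par) x' v)
    (ha : ¬ ReflTransGen (IsParent par) a v) (hxa : G.Adj x a) (hpar : par x ≠ some a)
    (hxa' : G.Adj x' a) (hpar' : par x' ≠ some a) : x = x' := by
  have hnot : ∀ {b c}, ¬ ReflTransGen (IsParent par) a b → IsParent par c b →
      ¬ ReflTransGen (IsParent par) a c := fun hb hcb hac => hb (hac.tail hcb)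
  induction hx with
  | refl =>
    obtain rfl | ⟨c, hc, hcv⟩ := ReflTransGen.cases_tail hx'
    · rfl
    · exact absurd (h.closing hcv (h.hub_eq_of_adj hc (hnot ha hcv) hxa' hpar') hxa) hpar
  | @tail b v hxb hbv ih =>
    have hb := h.hub_eq_of_adj hxb (hnot ha hbv) hxa hpar
    obtain rfl | ⟨c, hc, hcv⟩ := ReflTransGen.cases_tail hx'
    · exact absurd (h.closing hbv hb hxa') hpar'
    · obtain rfl := h.child_unique hbv hcv hb (h.hub_eq_of_adj hc (hnot ha hcv) hxa' hpar')
        fun hav => ha (hav ▸ .refl)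
      exact ih hc (hnot ha hbv)

/-- Let the cycle with topmost vertex `a` leave the subtree of `w` upwards, through the parent `q`
of `w`, and close with the edge from `x` to `a`. Then no other edges than those two tree edges of
the cycle leave the part between `w` and `z`. -/
theorem eq_or_eq_of_adj_of_notMem (h : CactusTree G par hub depth) {w q z z' a x : V}
    (hwq : par w = some q) (hhub : hub w = some a) (hqz : ReflTransGen (IsParent par) q z)
    (hzz' : par z = some z') (hz'a : ReflTransGen (IsParent par) z' a)
    (hx : ReflTransGen (IsParent par) x w) (hxa : G.Adj x a) (hpar : par x ≠ some a)
    {b c : V} (hb : b ∈ subtree par z \ subtree par w) (hc : c ∉ subtree par z \ subtree par w)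
    (hbc : G.Adj b c) : (b = q ∧ c = w) ∨ (b = z ∧ c = z') := by
  have hza : TransGen (IsParent par) z a := TransGen.head' hzz' hz'a
  have haz : ¬ ReflTransGen (IsParent par) a z := fun haz => h.isForest.not_transGen haz hza
  have hwz : ReflTransGen (IsParent par) w z := hqz.head hwq
  by_cases hcw : c ∈ subtree par w
  · left
    by_cases hcb : par c = some b
    · obtain rfl := eq_of_isParent_of_notMem hcw hb.2 hcb
      exact ⟨isParent_rightUnique par hcb hwq, rfl⟩
    · obtain rfl := Option.some.inj (hhub.symm.trans (h.hub_eq_of_adj hcw hb.2 hbc.symm hcb))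
      exact absurd hb.1 haz
  · right
    have hcz : ¬ ReflTransGen (IsParent par) c z := fun hcz => hc ⟨hcz, hcw⟩
    by_cases hcb : par b = some c
    · obtain rfl := eq_of_isParent_of_notMem hb.1 hcz hcb
      exact ⟨rfl, isParent_rightUnique par hcb hzz'⟩
    · obtain rfl := Option.some.inj ((h.hub_eq_of_adj hb.1 hcz hbc hcb).symm.trans
        (h.hub_eq_of_ancestor hhub hwz hza))
      exact absurd (h.eq_of_adj_hub (hx.trans hwz) hb.1 haz hxa hpar hbc hcb ▸ hx) hb.2

end CactusTree

/-- If two edges `qw` and `zz'` are all that leaves `M`, with `q` and `z` in the branch set of `j`,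
then the branch sets next to that of `j` outside `M` are those of `w` and `z'`. -/
theorem mem_of_two_edge_cut {B : W → Set V} {M : Set V} {i j l k : W} {q w z z' a : V}
    (hconn : ∀ i, (G.induce (B i)).Connected) (hdisj : ∀ i j, i ≠ j → Disjoint (B i) (B j))
    (hadj : ∀ i j, H.Adj i j → ∃ x ∈ B i, ∃ y ∈ B j, G.Adj x y)
    (hM : ∀ b ∈ M, ∀ c ∉ M, G.Adj b c → (b = q ∧ c = w) ∨ (b = z ∧ c = z'))
    (hij : i ≠ j) (hil : i ≠ l) (hjl : j ≠ l) (hw : w ∈ B i) (hq : q ∈ B j) (hqM : q ∈ M)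
    (hz : z ∈ B j) (hz' : z' ∉ B j) (ha : a ∈ B l) (haM : a ∉ M)
    (hki : k ≠ i) (hjk : H.Adj j k) (hkl : k = l ∨ H.Adj k l) : z' ∈ B k := by
  have hw' : ∀ {m}, m ≠ i → w ∉ B m := fun hm hwm => Set.disjoint_left.mp (hdisj _ _ hm) hwm hw
  have hz'' : ∀ {m}, m ≠ j → z ∉ B m := fun hm hzm => Set.disjoint_left.mp (hdisj _ _ hm) hzm hz
  have hjM : ∀ x ∈ B j, x ∈ M := fun x hx => by
    by_contra hxM
    obtain ⟨b, -, c, hc, hb, hcM, hbc⟩ := exists_adj_of_connected_induce (hconn j) hq hqM hx hxM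
    rcases hM b hb c hcM hbc with ⟨-, rfl⟩ | ⟨-, rfl⟩
    exacts [hw' hij.symm hc, hz' hc]
  have hsub : ∀ {m}, m ≠ i → m ≠ j → ∀ x ∈ B m, x ∈ M → ∀ y ∈ B m, y ∈ M := by
    intro m hmi hmj x hx hxM y hy
    by_contra hyM
    obtain ⟨b, hbm, c, hc, hb, hcM, hbc⟩ :=
      exists_adj_of_connected_induce (hconn m) hx hxM hy hyM
    rcases hM b hb c hcM hbc with ⟨-, rfl⟩ | ⟨rfl, -⟩
    exacts [hw' hmi hc, hz'' hmj hbm]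
  have hlM : ∀ y ∈ B l, y ∉ M := fun y hy hyM => haM (hsub hil.symm hjl.symm y hy hyM a ha)
  obtain ⟨x, hx, y, hy, hxy⟩ := hadj j k hjk
  by_cases hyM : y ∈ M
  · rcases hkl with rfl | hkl
    · exact absurd hyM (hlM y hy)
    · obtain ⟨b, hbk, c, hc, hbc⟩ := hadj k l hkl
      rcases hM b (hsub hki hjk.ne' y hy hyM b hbk) c (hlM c hc) hbc with ⟨-, rfl⟩ | ⟨rfl, -⟩
      exacts [absurd hc (hw' hil.symm), absurd hbk (hz'' hjk.ne')]
  · rcases hM x (hjM x hx) y hyM hxy with ⟨-, rfl⟩ | ⟨-, rfl⟩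
    exacts [absurd hy (hw' hki), hy]

namespace CactusTree

theorem exists_deepest_branch_of_two_neighbors [Finite W] [Nonempty W]
    (h : CactusTree G par hub depth) {B : W → Set V} (hconn : ∀ i, (G.induce (B i)).Connected)
    (hdisj : ∀ i j, i ≠ j → Disjoint (B i) (B j))
    (hadj : ∀ i j, H.Adj i j → ∃ x ∈ B i, ∃ y ∈ B j, G.Adj x y)
    (hH : ∀ i, ∃ j l, j ≠ l ∧ H.Adj i j ∧ H.Adj i l) :
    ∃ i j l, j ≠ l ∧ (∀ k, H.Adj i k ↔ k = j ∨ k = l) ∧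
      ∃ w ∈ B i, ∃ q ∈ B j, ∃ a ∈ B l, par w = some q ∧ hub w = some a ∧
        ∃ x, ReflTransGen (IsParent par) x w ∧ G.Adj x a ∧ par x ≠ some a := by
  obtain ⟨i, w, hw, hlink⟩ := h.hubTree.exists_deepest_branch hconn hdisj hadj
  have : Nonempty V := ⟨w⟩
  choose! x hx z hz hout hxz using hlink
  have hwz : ∀ j, H.Adj i j → IsLink par hub w (z j) := fun j hij =>
    (h.hubTree.adj_of_descendant (hx j hij) (hxz j hij)).resolve_left (hout j hij)
  have hinj : ∀ {j l}, H.Adj i j → H.Adj i l → z j = z l → j = l := by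
    intro j l hij hil hjl
    by_contra hne
    exact Set.disjoint_left.mp (hdisj j l hne) (hz j hij) (hjl ▸ hz l hil)
  have hpair : ∃ j l, H.Adj i j ∧ H.Adj i l ∧ par w = some (z j) ∧ hub w = some (z l) ∧ j ≠ l := by
    obtain ⟨j, l, hjl, hij, hil⟩ := hH i
    rcases hwz j hij with hj | hj <;> rcases hwz l hil with hl | hl
    · exact absurd (hinj hij hil (Option.some.inj (hj.symm.trans hl))) hjl
    · exact ⟨j, l, hij, hil, hj, hl, hjl⟩
    · exact ⟨l, j, hil, hij, hl, hj, hjl.symm⟩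
    · exact absurd (hinj hij hil (Option.some.inj (hj.symm.trans hl))) hjl
  obtain ⟨j, l, hij, hil, hj, hl, hjl⟩ := hpair
  refine ⟨i, j, l, hjl, fun k => ⟨fun hik => ?_, ?_⟩, w, hw, z j, hz j hij, z l, hz l hil, hj, hl,
    x l, hx l hil, hxz l hil, fun hpar => hjl ?_⟩
  · exact (hwz k hik).imp (fun hk => hinj hik hij (Option.some.inj (hk.symm.trans hj)))
      fun hk => hinj hik hil (Option.some.inj (hk.symm.trans hl))
  · rintro (rfl | rfl)
    exacts [hij, hil]
  · obtain hxw := eq_of_isParent_of_notMem (hx l hil) (hout l hil) hpar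
    exact hinj hij hil (Option.some.inj (hj.symm.trans (hxw ▸ hpar)))

theorem exists_mem_of_isMinor [Finite W] [Nonempty W] (h : CactusTree G par hub depth)
    {B : W → Set V} (hconn : ∀ i, (G.induce (B i)).Connected)
    (hdisj : ∀ i j, i ≠ j → Disjoint (B i) (B j))
    (hadj : ∀ i j, H.Adj i j → ∃ x ∈ B i, ∃ y ∈ B j, G.Adj x y)
    (hH : ∀ i, ∃ j l, j ≠ l ∧ H.Adj i j ∧ H.Adj i l) :
    ∃ i j l, j ≠ l ∧ (∀ k, H.Adj i k ↔ k = j ∨ k = l) ∧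
      ∃ w q a z z', par w = some q ∧ hub w = some a ∧ ReflTransGen (IsParent par) q z ∧
        par z = some z' ∧ ReflTransGen (IsParent par) z' a ∧ a ∈ B l ∧
        ∀ k ≠ i, H.Adj j k → k = l ∨ H.Adj k l → z' ∈ B k := by
  obtain ⟨i, j, l, hjl, hi, w, hw, q, hq, a, ha, hwq, hwa, x, hx, hxa, hpar⟩ :=
    h.exists_deepest_branch_of_two_neighbors hconn hdisj hadj hH
  obtain ⟨u, hu, hua⟩ := h.hub_step hwa
  obtain rfl := isParent_rightUnique par hu hwq
  have hqa : ReflTransGen (IsParent par) u a := hua.elim (fun hua => hua ▸ .refl)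
    fun hua => (h.transGen_of_hub hua).to_reflTransGen
  obtain ⟨z, hz, z', hz', hqz, hzz', hza⟩ := exists_isParent_notMem hqa hq
    (Set.disjoint_right.mp (hdisj j l hjl) ha)
  have hij : H.Adj i j := (hi j).mpr (Or.inl rfl)
  have hil : H.Adj i l := (hi l).mpr (Or.inr rfl)
  refine ⟨i, j, l, hjl, hi, w, u, a, z, z', hwq, hwa, hqz, hzz', hza, ha, fun k hki hjk hkl =>
    mem_of_two_edge_cut hconn hdisj hadj (fun b hb c hc => h.eq_or_eq_of_adj_of_notMem hwq hwa hqz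
      hzz' hza hx hxa hpar hb hc) hij.ne hil.ne hjl hw hq
      ⟨hqz, fun huw => h.isForest.not_transGen huw (.single hwq)⟩ hz hz' ha
      (fun haM => h.isForest.not_transGen haM.1 (TransGen.head' hzz' hza)) hki hjk hkl⟩

theorem not_isMinor_diamondGraph (h : CactusTree G par hub depth) : ¬ IsMinor diamondGraph G := by
  rintro ⟨B, hconn, hdisj, hadj⟩
  obtain ⟨i, j, l, hjl, hi, _, _, _, _, z', -, -, -, -, -, -, hz'⟩ :=
    h.exists_mem_of_isMinor hconn hdisj hadj (by decide)
  have hcommon : ∀ i j l, j ≠ l → (∀ k, diamondGraph.Adj i k ↔ k = j ∨ k = l) →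
      diamondGraph.Adj j l ∧ ∃ k ≠ i, k ≠ l ∧ diamondGraph.Adj j k ∧ diamondGraph.Adj k l := by
    decide
  obtain ⟨hadj_jl, k, hki, hkl, hjk, hadj_kl⟩ := hcommon i j l hjl hi
  exact Set.disjoint_left.mp (hdisj k l hkl) (hz' k hki hjk (Or.inr hadj_kl))
    (hz' l ((hi l).mpr (Or.inr rfl)).ne' hadj_jl (Or.inl rfl))

theorem not_isMinor_fourCycle (h : CactusTree G par hub depth)
    (htriangle : ∀ v p a, par v = some p → hub v = some a → a = p ∨ par p = some a) :
    ¬ IsMinor fourCycle G := by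
  rintro ⟨B, hconn, hdisj, hadj⟩
  obtain ⟨i, j, l, hjl, hi, w, q, a, z, z', hwq, hwa, hqz, hzz', hza, ha, hz'⟩ :=
    h.exists_mem_of_isMinor hconn hdisj hadj (by decide)
  have hz'a : z' = a := by
    have haz : ¬ ReflTransGen (IsParent par) a z := fun haz =>
      h.isForest.not_transGen haz (TransGen.head' hzz' hza)
    obtain rfl | ⟨b, hqb, hbz⟩ := ReflTransGen.cases_head hqz
    · rcases htriangle w q a hwq hwa with rfl | hqa
      · exact absurd hqz haz
      · exact isParent_rightUnique par hzz' hqa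
    · rcases htriangle w q a hwq hwa with rfl | hqa
      · exact absurd hqz haz
      · exact absurd (isParent_rightUnique par hqb hqa ▸ hbz) haz
  have hopposite : ∀ i j l, j ≠ l → (∀ k, fourCycle.Adj i k ↔ k = j ∨ k = l) →
      ∃ k ≠ i, k ≠ l ∧ fourCycle.Adj j k ∧ fourCycle.Adj k l := by
    decide
  obtain ⟨k, hki, hkl, hjk, hadj_kl⟩ := hopposite i j l hjl hi
  exact Set.disjoint_left.mp (hdisj k l hkl) (hz' k hki hjk (Or.inr hadj_kl)) (hz'a ▸ ha)

end CactusTree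

end CactusTree

section TreeSets

variable {V : Type*} {G : SimpleGraph V} {r : V} {par : V → Option V} {depth : V → ℕ}

namespace IsForest

theorem disjoint_subtree_singleton (h : IsForest par depth) {v a : V}
    (hva : TransGen (IsParent par) v a) : Disjoint (subtree par v) {a} :=
  Set.disjoint_singleton_right.mpr fun hav => h.not_transGen hav hva

theorem disjoint_subtree_treePath (h : IsForest par depth) {v x y : V}
    (hvx : TransGen (IsParent par) v x) : Disjoint (subtree par v) (treePath par x y) :=
  Set.disjoint_left.mpr fun _ hzv hz => h.not_transGen (hz.1.trans hzv) hvx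

theorem disjoint_treePath_singleton (h : IsForest par depth) {x y z : V}
    (hyz : ReflTransGen (IsParent par) y z) : Disjoint (treePath par x y) {z} :=
  Set.disjoint_singleton_right.mpr fun hz => h.not_transGen hyz hz.2

theorem disjoint_treePath_treePath (h : IsForest par depth) {x y z : V} :
    Disjoint (treePath par x y) (treePath par y z) :=
  Set.disjoint_left.mpr fun _ hw hw' => h.not_transGen hw'.1 hw.2

theorem disjoint_subtree_subtree (h : IsForest par depth) {v c d : V} (hc : IsParent par c v)
    (hd : IsParent par d v) (hcd : c ≠ d) : Disjoint (subtree par c) (subtree par d) := by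
  have hnot : ∀ {c d}, IsParent par c v → IsParent par d v → c ≠ d →
      ¬ ReflTransGen (IsParent par) c d := by
    intro c d hc hd hcd h_cd
    obtain rfl | ⟨w, hw, hwd⟩ := ReflTransGen.cases_head h_cd
    · exact hcd rfl
    · exact h.not_transGen (isParent_rightUnique par hw hc ▸ hwd) (.single hd)
  exact Set.disjoint_left.mpr fun z hzc hzd =>
    (ancestors_comparable hzc hzd).elim (hnot hc hd hcd) (hnot hd hc hcd.symm)

end IsForest

namespace SpanningTree

theorem connected_treePath (h : SpanningTree G r par depth) {x y : V}
    (hxy : TransGen (IsParent par) x y) : (G.induce (treePath par x y)).Connected := by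
  obtain ⟨b, hxb, hby⟩ := TransGen.tail'_iff.mp hxy
  refine h.connected_induce (v := b) ⟨hxb, .single hby⟩ (fun z hz => ?_) fun z hz hzb w hzw => ?_
  all_goals
    obtain ⟨b', hzb', hb'y⟩ := TransGen.tail'_iff.mp hz.2
    have hdepth : depth b = depth b' := (h.depth_eq hby).trans (h.depth_eq hb'y).symm
    obtain rfl : b = b' := (ancestors_comparable hxb (hz.1.trans hzb')).elim
      (fun hbb' => h.isForest.eq_of_depth_le hbb' hdepth.le)
      fun hb'b => (h.isForest.eq_of_depth_le hb'b hdepth.ge).symm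
  · exact hzb'
  · obtain rfl | ⟨u, hu, hub⟩ := ReflTransGen.cases_head hzb'
    · exact absurd rfl hzb
    · exact ⟨hz.1.tail hzw, isParent_rightUnique par hu hzw ▸ .tail' hub hby⟩

theorem linked_treePath (h : SpanningTree G r par depth) {x y : V} {A : Set V}
    (hxy : TransGen (IsParent par) x y) (hy : y ∈ A) : Linked G (treePath par x y) A := by
  obtain ⟨b, hxb, hby⟩ := TransGen.tail'_iff.mp hxy
  exact ⟨b, ⟨hxb, .single hby⟩, y, hy, h.adj hby⟩

end SpanningTree

theorem mem_treePath {x y : V} (hxy : TransGen (IsParent par) x y) : x ∈ treePath par x y :=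
  ⟨.refl, hxy⟩

theorem transGen_of_ne {x y : V} (hxy : ReflTransGen (IsParent par) x y) (hne : y ≠ x) :
    TransGen (IsParent par) x y :=
  (reflTransGen_iff_eq_or_transGen.mp hxy).resolve_left hne

theorem exists_isParent_of_transGen {x y : V} (hxy : TransGen (IsParent par) x y)
    (hne : ¬ IsParent par x y) : ∃ u, IsParent par x u ∧ TransGen (IsParent par) u y := by
  obtain ⟨u, hu, huy⟩ := TransGen.head'_iff.mp hxy
  exact ⟨u, hu, transGen_of_ne huy fun hyu => hne (hyu ▸ hu)⟩

end TreeSets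

section CycleTop

variable {V : Type*} {G : SimpleGraph V} {r : V} {par : V → Option V} {depth : V → ℕ}

/-- Some edge outside the tree joins the subtree of `v` to the proper ancestor `a` of `v`, so that
the edge from `v` to its parent lies on a cycle with topmost vertex `a`. -/
def IsCycleTop (G : SimpleGraph V) (par : V → Option V) (v a : V) : Prop :=
  TransGen (IsParent par) v a ∧ ∃ x ∈ subtree par v, G.Adj x a ∧ ¬ IsParent par x a

theorem IsCycleTop.linked {v a : V} {A : Set V} (hva : IsCycleTop G par v a) (ha : a ∈ A) :
    Linked G (subtree par v) A :=
  let ⟨_, x, hx, hxa, _⟩ := hva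
  ⟨x, hx, a, ha, hxa⟩

theorem IsCycleTop.of_isParent {v p a : V} (hva : IsCycleTop G par v a) (hvp : IsParent par v p)
    (hpa : p ≠ a) : IsCycleTop G par p a := by
  obtain ⟨hT, x, hx, hxa⟩ := hva
  obtain ⟨u, hu, hua⟩ := TransGen.head'_iff.mp hT
  obtain rfl := isParent_rightUnique par hu hvp
  exact ⟨transGen_of_ne hua hpa.symm, x, hx.tail hvp, hxa⟩

namespace NormalTree

theorem isMinor_diamondGraph_of_child (h : NormalTree G r par depth) {v c : V} {P A : Set V}
    (hcv : IsParent par c v) (hP : (G.induce P).Connected) (hA : (G.induce A).Connected)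
    (hvP : Disjoint (subtree par v) P) (hvA : Disjoint (subtree par v) A) (hPA : Disjoint P A)
    (hlinkP : Linked G (subtree par v \ subtree par c) P) (hlinkP' : Linked G (subtree par c) P)
    (hlinkA : Linked G P A) (hlinkA' : Linked G (subtree par v) A) :
    IsMinor diamondGraph G := by
  have hvc : ¬ ReflTransGen (IsParent par) v c := fun hvc =>
    h.isForest.not_transGen hvc (.single hcv)
  have hC := h.connected_subtree c
  have hD := h.connected_subtree_diff hvc
  have hCv : subtree par c ⊆ subtree par v := subtree_subset (.single hcv)
  have hCD : Linked G (subtree par c) (subtree par v \ subtree par c) :=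
    ⟨c, .refl, v, ⟨.refl, hvc⟩, h.adj hcv⟩
  obtain ⟨x, hxv, a, ha, hxa⟩ := hlinkA'
  by_cases hxc : x ∈ subtree par c
  · exact isMinor_of_four hP hC hD hA (hvP.mono_left hCv).symm
      (hvP.mono_left Set.sdiff_subset).symm hPA Set.disjoint_sdiff_right (hvA.mono_left hCv)
      (hvA.mono_left Set.sdiff_subset) (fun _ => hlinkP'.symm) (fun _ => hlinkP.symm)
      (fun _ => hlinkA) (fun _ => hCD) (fun _ => ⟨x, hxc, a, ha, hxa⟩)
      fun hadj => absurd hadj (by decide)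
  · exact isMinor_of_four hP hD hC hA (hvP.mono_left Set.sdiff_subset).symm
      (hvP.mono_left hCv).symm hPA Set.disjoint_sdiff_left (hvA.mono_left Set.sdiff_subset)
      (hvA.mono_left hCv) (fun _ => hlinkP.symm) (fun _ => hlinkP'.symm) (fun _ => hlinkA)
      (fun _ => hCD.symm) (fun _ => ⟨x, ⟨hxv, hxc⟩, a, ha, hxa⟩)
      fun hadj => absurd hadj (by decide)

theorem isMinor_diamondGraph_of_two_tops (h : NormalTree G r par depth) {v a a' : V}
    (ha : IsCycleTop G par v a) (ha' : IsCycleTop G par v a')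
    (haa' : TransGen (IsParent par) a a') : IsMinor diamondGraph G := by
  obtain ⟨p, hvp, hpa⟩ := TransGen.head'_iff.mp ha.1
  by_cases hap : a = p
  · subst hap
    obtain ⟨-, x, hxv, hxa, hx⟩ := ha
    obtain rfl | ⟨c, hxc, hcv⟩ := ReflTransGen.cases_tail hxv
    · exact absurd hvp hx
    exact h.isMinor_diamondGraph_of_child hcv (h.connected_treePath haa')
      (connected_induce_singleton G a') (h.isForest.disjoint_subtree_treePath (.single hvp))
      (h.isForest.disjoint_subtree_singleton ha'.1) (h.isForest.disjoint_treePath_singleton .refl)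
      ⟨v, ⟨.refl, fun hvc => h.isForest.not_transGen hvc (.single hcv)⟩, a, mem_treePath haa',
        h.adj hvp⟩
      ⟨x, hxc, a, mem_treePath haa', hxa⟩ (h.linked_treePath haa' rfl) (ha'.linked rfl)
  · have hTpa := transGen_of_ne hpa hap
    exact isMinor_of_four (h.connected_subtree v) (h.connected_treePath haa')
      (h.connected_treePath hTpa) (connected_induce_singleton G a')
      (h.isForest.disjoint_subtree_treePath ha.1)
      (h.isForest.disjoint_subtree_treePath (.single hvp))
      (h.isForest.disjoint_subtree_singleton ha'.1)
      h.isForest.disjoint_treePath_treePath.symm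
      (h.isForest.disjoint_treePath_singleton .refl)
      (h.isForest.disjoint_treePath_singleton haa'.to_reflTransGen)
      (fun _ => ha.linked (mem_treePath haa'))
      (fun _ => ⟨v, .refl, p, mem_treePath hTpa, h.adj hvp⟩)
      (fun _ => ha'.linked rfl)
      (fun _ => (h.linked_treePath hTpa (mem_treePath haa')).symm)
      (fun _ => h.linked_treePath haa' rfl) (fun hadj => absurd hadj (by decide))

theorem eq_of_isCycleTop (h : NormalTree G r par depth) (hG : ¬ IsMinor diamondGraph G) {v a a' : V}
    (ha : IsCycleTop G par v a) (ha' : IsCycleTop G par v a') : a = a' := by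
  by_contra hne
  rcases ancestors_comparable ha.1.to_reflTransGen ha'.1.to_reflTransGen with haa' | haa'
  · exact hG (h.isMinor_diamondGraph_of_two_tops ha ha' (transGen_of_ne haa' (Ne.symm hne)))
  · exact hG (h.isMinor_diamondGraph_of_two_tops ha' ha (transGen_of_ne haa' hne))

theorem isMinor_diamondGraph_of_linked_diff (h : NormalTree G r par depth) {v c p a : V}
    (hcv : IsParent par c v) (ha : IsCycleTop G par c a) (hvp : IsParent par v p)
    (hpa : TransGen (IsParent par) p a)
    (hlink : Linked G (subtree par v \ subtree par c) {a}) : IsMinor diamondGraph G :=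
  have hva : TransGen (IsParent par) v a := .head hvp hpa
  h.isMinor_diamondGraph_of_child hcv (connected_induce_singleton G a) (h.connected_treePath hpa)
    (h.isForest.disjoint_subtree_singleton hva)
    (h.isForest.disjoint_subtree_treePath (.single hvp))
    (h.isForest.disjoint_treePath_singleton .refl).symm hlink (ha.linked rfl)
    (h.linked_treePath hpa (Set.mem_singleton a)).symm ⟨v, .refl, p, mem_treePath hpa, h.adj hvp⟩

theorem isMinor_diamondGraph_of_two_children (h : NormalTree G r par depth) {v c c' a : V}
    (hcv : IsParent par c v) (hcv' : IsParent par c' v) (hcc' : c ≠ c')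
    (ha : IsCycleTop G par c a) (ha' : IsCycleTop G par c' a) (hav : a ≠ v) :
    IsMinor diamondGraph G := by
  have hva : ∀ {c}, IsParent par c v → IsCycleTop G par c a → TransGen (IsParent par) v a :=
    fun hcv ha => (ha.of_isParent hcv hav.symm).1
  obtain ⟨p, hvp, hpa⟩ := TransGen.head'_iff.mp (hva hcv ha)
  have hdisj := h.isForest.disjoint_subtree_subtree hcv hcv' hcc'
  by_cases hap : a = p
  · subst hap
    exact isMinor_of_four (connected_induce_singleton G a) (connected_induce_singleton G v)
      (h.connected_subtree c) (h.connected_subtree c') (by simpa using hav)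
      (h.isForest.disjoint_subtree_singleton ha.1).symm
      (h.isForest.disjoint_subtree_singleton ha'.1).symm
      (h.isForest.disjoint_subtree_singleton (.single hcv)).symm
      (h.isForest.disjoint_subtree_singleton (.single hcv')).symm hdisj
      (fun _ => ⟨a, rfl, v, rfl, (h.adj hvp).symm⟩)
      (fun _ => (ha.linked (Set.mem_singleton a)).symm)
      (fun _ => (ha'.linked (Set.mem_singleton a)).symm)
      (fun _ => ⟨v, rfl, c, .refl, (h.adj hcv).symm⟩)
      (fun _ => ⟨v, rfl, c', .refl, (h.adj hcv').symm⟩) (fun hadj => absurd hadj (by decide))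
  · exact h.isMinor_diamondGraph_of_linked_diff hcv ha hvp (transGen_of_ne hpa hap)
      ((ha'.linked (Set.mem_singleton a)).mono (fun x hx => ⟨subtree_subset (.single hcv') hx,
        Set.disjoint_right.mp hdisj hx⟩) subset_rfl)

theorem exists_cactusTree (h : NormalTree G r par depth) (hG : ¬ IsMinor diamondGraph G) :
    ∃ hub, CactusTree G par hub depth ∧ ∀ v a, hub v = some a → IsCycleTop G par v a := by
  classical
  let hub : V → Option V := fun v =>
    if hv : ∃ a, IsCycleTop G par v a then some hv.choose else none
  have hub_eq : ∀ {v a}, hub v = some a ↔ IsCycleTop G par v a := by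
    intro v a
    by_cases hv : ∃ a, IsCycleTop G par v a
    · simp only [hub, dif_pos hv, Option.some.injEq]
      exact ⟨fun hva => hva ▸ hv.choose_spec, fun hva => h.eq_of_isCycleTop hG hv.choose_spec hva⟩
    · simp only [hub, dif_neg hv, reduceCtorEq, false_iff]
      exact fun hva => hv ⟨a, hva⟩
  have isLink_of_adj : ∀ {x y}, G.Adj x y → TransGen (IsParent par) x y →
      IsLink par hub x y := fun hxy hT =>
    or_iff_not_imp_left.mpr fun hpar => hub_eq.mpr ⟨hT, _, .refl, hxy, hpar⟩
  refine ⟨hub, ⟨h.isForest, fun {v a} hva => ?_, fun {x y} hxy => ?_,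
    fun {v c c' a} hc hc' ha ha' hav => ?_, fun {v c a} hc ha hva => ?_⟩, fun v a => hub_eq.mp⟩
  · obtain ⟨u, hu, -⟩ := TransGen.head'_iff.mp (hub_eq.mp hva).1
    exact ⟨u, hu, or_iff_not_imp_left.mpr fun hua =>
      hub_eq.mpr ((hub_eq.mp hva).of_isParent hu hua)⟩
  · exact (h.transGen_of_adj hxy).imp (isLink_of_adj hxy) (isLink_of_adj hxy.symm)
  · by_contra hcc'
    exact hG (h.isMinor_diamondGraph_of_two_children hc hc' hcc' (hub_eq.mp ha) (hub_eq.mp ha') hav)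
  · by_contra hpar
    obtain ⟨p, hvp, hpa⟩ := exists_isParent_of_transGen
      ((hub_eq.mp ha).of_isParent hc hva.ne).1 hpar
    exact hG (h.isMinor_diamondGraph_of_linked_diff hc (hub_eq.mp ha) hvp hpa
      ⟨v, ⟨.refl, fun hvc => h.isForest.not_transGen hvc (.single hc)⟩, a, rfl, hva⟩)

theorem isMinor_fourCycle_of_isCycleTop (h : NormalTree G r par depth) {v p a : V}
    (hvp : IsParent par v p) (ha : IsCycleTop G par v a) (hpa : p ≠ a)
    (hpar : ¬ IsParent par p a) : IsMinor fourCycle G := by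
  obtain ⟨p', hp', hp'a⟩ := exists_isParent_of_transGen (ha.of_isParent hvp hpa).1 hpar
  have hv : ∀ {y}, TransGen (IsParent par) p y → TransGen (IsParent par) v y := .head hvp
  exact isMinor_of_four (h.connected_subtree v) (h.connected_treePath hp'a)
    (connected_induce_singleton G p) (connected_induce_singleton G a)
    (h.isForest.disjoint_subtree_treePath (hv (.single hp')))
    (h.isForest.disjoint_subtree_singleton (.single hvp))
    (h.isForest.disjoint_subtree_singleton ha.1)
    (Set.disjoint_singleton_right.mpr fun hp => h.isForest.not_transGen hp.1 (.single hp'))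
    (h.isForest.disjoint_treePath_singleton .refl) (by simpa using hpa)
    (fun hadj => absurd hadj (by decide)) (fun _ => ⟨v, .refl, p, rfl, h.adj hvp⟩)
    (fun _ => ha.linked rfl) (fun _ => ⟨p', mem_treePath hp'a, p, rfl, (h.adj hp').symm⟩)
    (fun _ => h.linked_treePath hp'a rfl) (fun hadj => absurd hadj (by decide))

theorem isMinor_top_three_of_adj (h : NormalTree G r par depth) {x u a : V} (hxa : G.Adj x a)
    (hxu : IsParent par x u) (hua : TransGen (IsParent par) u a) :
    IsMinor (⊤ : SimpleGraph (Fin 3)) G := by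
  refine isMinor_of_lt (B := ![{x}, treePath par u a, {a}]) ?_ ?_ ?_
  · simp [Fin.forall_fin_succ, h.connected_treePath hua]
  · have hxP : x ∉ treePath par u a := fun hx => h.isForest.not_transGen hx.1 (.single hxu)
    have hPa : a ∉ treePath par u a := fun ha => h.isForest.not_transGen .refl ha.2
    simp [Fin.forall_fin_succ, hxP, hPa, hxa.ne']
  · have hxP : Linked G {x} (treePath par u a) := ⟨x, rfl, u, mem_treePath hua, h.adj hxu⟩
    have hxa : Linked G {x} {a} := ⟨x, rfl, a, rfl, hxa⟩
    have hPa : Linked G (treePath par u a) {a} := h.linked_treePath hua rfl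
    simp [Fin.forall_fin_succ, hxP, hxa, hPa]

theorem isMinor_top_three_of_isCycleTop (h : NormalTree G r par depth) {v a : V}
    (ha : IsCycleTop G par v a) : IsMinor (⊤ : SimpleGraph (Fin 3)) G := by
  obtain ⟨hva, x, hxv, hxa, hx⟩ := ha
  obtain ⟨u, hxu, hua⟩ := exists_isParent_of_transGen (.trans_right hxv hva) hx
  exact h.isMinor_top_three_of_adj hxa hxu hua

end NormalTree

end CycleTop

section CactusLabels

/-- The local conditions on the label `l` of the vertex with identifier `i`, given the identifiers
and labels `s` of the neighbours. In addition to the conditions for a cactus tree, the relation `R`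
must hold between the parent of a vertex, the parent of that parent, and the hub. -/
structure CactusCheck (R : ℕ → Option ℕ → ℕ → Prop) (i : ℕ) (l : TreeLabel)
    (s : Set (ℕ × TreeLabel)) : Prop where
  root : l.par = none → l.hub = none
  parent : ∀ p, l.par = some p → ∃ q ∈ s, q.1 = p ∧ q.2.depth < l.depth ∧
    ∀ a, l.hub = some a → (p = a ∨ q.2.hub = some a) ∧ R p q.2.par a
  edge : ∀ q ∈ s, (l.par = some q.1 ∨ l.hub = some q.1) ∨ q.2.par = some i ∨ q.2.hub = some i
  child_unique : ∀ q ∈ s, ∀ q' ∈ s, q.2.par = some i → q'.2.par = some i →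
    ∀ a ≠ i, q.2.hub = some a → q'.2.hub = some a → q.1 = q'.1
  closing : ∀ q ∈ s, ∀ q' ∈ s, q.2.par = some i → q.2.hub = some q'.1 → l.par = some q'.1

variable {V : Type} {G : SimpleGraph V} {ident : V → ℕ} {R : ℕ → Option ℕ → ℕ → Prop}

section Soundness

variable {c : V → TreeLabel}

theorem exists_adj_of_cactusCheck
    (hc : ∀ v, CactusCheck R (ident v) (c v) (labelView G ident c v)) {v : V} {p : ℕ}
    (hp : (c v).par = some p) : ∃ u, ident u = p ∧ G.Adj v u ∧ (c u).depth < (c v).depth ∧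
      ∀ a, (c v).hub = some a → (p = a ∨ (c u).hub = some a) ∧ R p (c u).par a := by
  obtain ⟨_, ⟨u, hvu, rfl⟩, hu⟩ := (hc v).parent p hp
  exact ⟨u, hu.1, hvu, hu.2⟩

theorem adj_of_cactusCheck (hid : Function.Injective ident)
    (hc : ∀ v, CactusCheck R (ident v) (c v) (labelView G ident c v)) {v u : V}
    (hvu : (c v).par = some (ident u)) : G.Adj u v := by
  obtain ⟨w, hw, hvw, -⟩ := exists_adj_of_cactusCheck hc hvu
  exact hid hw ▸ hvw.symm

theorem exists_par_of_cactusCheck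
    (hc : ∀ v, CactusCheck R (ident v) (c v) (labelView G ident c v)) {v : V} {a : ℕ}
    (ha : (c v).hub = some a) : ∃ p, (c v).par = some p :=
  Option.ne_none_iff_exists'.mp fun hnone =>
    Option.some_ne_none _ (ha.symm.trans ((hc v).root hnone))

theorem cactusTree_of_cactusCheck (hid : Function.Injective ident)
    (hc : ∀ v, CactusCheck R (ident v) (c v) (labelView G ident c v)) :
    CactusTree G (decode ident fun v => (c v).par) (decode ident fun v => (c v).hub)
      (fun v => (c v).depth) where
  isForest v u hvu := by
    obtain ⟨w, hw, -, hlt, -⟩ := exists_adj_of_cactusCheck hc ((decode_eq_some hid).mp hvu)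
    exact hid hw ▸ hlt
  hub_step {v a} hva := by
    rw [decode_eq_some hid] at hva
    obtain ⟨p, hp⟩ := exists_par_of_cactusCheck hc hva
    obtain ⟨u, rfl, -, -, hhub⟩ := exists_adj_of_cactusCheck hc hp
    refine ⟨u, (decode_eq_some hid).mpr hp, ?_⟩
    rw [decode_eq_some hid, ← hid.eq_iff]
    exact (hhub _ hva).1
  adj {x y} hxy := by
    simp only [IsLink, decode_eq_some hid]
    exact (hc x).edge _ ⟨y, hxy, rfl⟩
  child_unique {v x x' a} hx hx' ha ha' hav := by
    rw [decode_eq_some hid] at hx hx' ha ha'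
    exact hid ((hc v).child_unique _ ⟨x, adj_of_cactusCheck hid hc hx, rfl⟩ _
      ⟨x', adj_of_cactusCheck hid hc hx', rfl⟩ hx hx' _ (hid.ne hav) ha ha')
  closing {v x a} hx ha hva := by
    rw [decode_eq_some hid] at hx ha ⊢
    exact (hc v).closing _ ⟨x, adj_of_cactusCheck hid hc hx, rfl⟩ _ ⟨a, hva, rfl⟩ hx ha

theorem map_decode_par (hid : Function.Injective ident)
    (hc : ∀ v, CactusCheck R (ident v) (c v) (labelView G ident c v)) (v : V) :
    (decode ident (fun v => (c v).par) v).map ident = (c v).par := by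
  cases hp : (c v).par with
  | none => simp [decode, hp]
  | some p =>
    obtain ⟨u, rfl, -⟩ := exists_adj_of_cactusCheck hc hp
    rw [(decode_eq_some hid).mpr hp, Option.map_some]

end Soundness

theorem CactusTree.cactusCheck {par hub : V → Option V} {depth : V → ℕ}
    (h : CactusTree G par hub depth) (hid : Function.Injective ident)
    (hadj : ∀ {v u}, par v = some u → G.Adj v u)
    (hR : ∀ {v p a}, par v = some p → hub v = some a →
      R (ident p) ((par p).map ident) (ident a)) (v : V) :
    CactusCheck R (ident v) (treeLabel ident par hub depth v)
      (labelView G ident (treeLabel ident par hub depth) v) where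
  root hroot := by
    refine Option.map_eq_none_iff.mpr (Option.eq_none_iff_forall_ne_some.mpr fun a ha => ?_)
    obtain ⟨u, hu, -⟩ := h.hub_step ha
    simp [treeLabel, hu] at hroot
  parent p hp := by
    obtain ⟨u, hu, rfl⟩ := Option.map_eq_some_iff.mp hp
    refine ⟨_, ⟨u, hadj hu, rfl⟩, rfl, h.isForest hu, fun a ha => ?_⟩
    obtain ⟨a, hva, rfl⟩ := Option.map_eq_some_iff.mp ha
    obtain ⟨u', hu', hua⟩ := h.hub_step hva
    obtain rfl := Option.some.inj (hu.symm.trans hu')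
    exact ⟨by simpa [treeLabel, hid.eq_iff] using hua, hR hu hva⟩
  edge := by
    rintro _ ⟨w, hvw, rfl⟩
    simpa [treeLabel, hid.eq_iff, IsLink] using h.adj hvw
  child_unique := by
    rintro _ ⟨x, -, rfl⟩ _ ⟨x', -, rfl⟩ hx hx' a hav ha ha'
    obtain ⟨a, hxa, rfl⟩ := Option.map_eq_some_iff.mp ha
    simp only [treeLabel, Option.map_eq_some_iff, hid.eq_iff, exists_eq_right] at hx hx' ha'
    exact congrArg ident (h.child_unique hx hx' hxa ha' (ne_of_apply_ne ident hav))
  closing := by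
    rintro _ ⟨x, -, rfl⟩ _ ⟨a, hva, rfl⟩ hx ha
    simp only [treeLabel, Option.map_eq_some_iff, hid.eq_iff, exists_eq_right] at hx ha ⊢
    exact h.closing hx ha hva

theorem hasLogCertification_of_cactusTree {W : Type*} {H : SimpleGraph W} (k : ℕ)
    (R : ℕ → Option ℕ → ℕ → Prop) (hH : H.IsContained diamondGraph)
    (complete : ∀ (V : Type) (G : SimpleGraph V) (ident : V → ℕ) (r : V) (par : V → Option V)
      (depth : V → ℕ), NormalTree G r par depth → ¬ IsMinor H G → ∀ v p a, par v = some p →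
        IsCycleTop G par v a → R (ident p) ((par p).map ident) (ident a))
    (sound : ∀ (V : Type) (G : SimpleGraph V) (ident : V → ℕ) (par hub : V → Option V)
      (depth : V → ℕ), Function.Injective ident → CactusTree G par hub depth →
        (∀ v p a, par v = some p → hub v = some a →
          R (ident p) ((par p).map ident) (ident a)) → ¬ IsMinor H G) :
    HasLogCertification k (minorFree H) := by
  refine hasLogCertification_of_labels TreeLabel.toVec TreeLabel.toVec_injective (CactusCheck R)
    (k + 1) (fun V _ G ident hconn hid hG => ?_) fun V _ G ident _ hid c hc => ?_
  · obtain ⟨r⟩ := hconn.nonempty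
    obtain ⟨par, depth, htree⟩ := exists_normalTree hconn r
    obtain ⟨hub, hcactus, htop⟩ := htree.exists_cactusTree fun hdiamond =>
      hG (hdiamond.of_isContained hH)
    exact ⟨_, hid.toVec_treeLabel_le fun v => (htree.depth_lt_card v).le,
      hcactus.cactusCheck hid.injective htree.adj fun hvp hva =>
        complete V G ident r par depth htree hG _ _ _ hvp (htop _ _ hva)⟩
  · refine sound V G ident _ _ _ hid.injective (cactusTree_of_cactusCheck hid.injective hc)
      fun v p a hvp hva => ?_
    rw [decode_eq_some hid.injective] at hvp hva
    obtain ⟨u, hu, -, -, hhub⟩ := exists_adj_of_cactusCheck hc hvp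
    rw [map_decode_par hid.injective hc, ← hid.injective hu]
    exact hu ▸ (hhub _ hva).2

theorem hasLogCertification_minorFree_diamondGraph (k : ℕ) :
    HasLogCertification k (minorFree diamondGraph) :=
  hasLogCertification_of_cactusTree k (fun _ _ _ => True) (.refl _)
    (fun _ _ _ _ _ _ _ _ _ _ _ _ _ => trivial)
    fun _ _ _ _ _ _ _ hcactus _ => hcactus.not_isMinor_diamondGraph

theorem hasLogCertification_minorFree_fourCycle (k : ℕ) :
    HasLogCertification k (minorFree fourCycle) := by
  refine hasLogCertification_of_cactusTree k (fun p o a => p = a ∨ o = some a)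
    ⟨⟨⟨id, by decide⟩, Function.injective_id⟩⟩
    (fun V G ident r par depth htree hG v p a hvp ha => ?_)
    fun V G ident par hub depth hid hcactus htriangle =>
      hcactus.not_isMinor_fourCycle fun v p a hvp hva => ?_
  · by_contra! hR
    exact hG (htree.isMinor_fourCycle_of_isCycleTop hvp ha (ne_of_apply_ne ident hR.1)
      fun hpa => hR.2 (by rw [hpa, Option.map_some]))
  · simpa [hid.eq_iff, eq_comm] using htriangle v p a hvp hva

theorem hasLogCertification_minorFree_top_three (k : ℕ) :
    HasLogCertification k (minorFree (⊤ : SimpleGraph (Fin 3))) := by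
  refine hasLogCertification_of_cactusTree k (fun _ _ _ => False)
    ⟨⟨⟨![0, 1, 2], by decide⟩, by decide⟩⟩
    (fun _ _ _ _ _ _ htree hG _ _ _ _ ha => hG (htree.isMinor_top_three_of_isCycleTop ha))
    fun _ _ _ _ hub _ _ hcactus hhub => ?_
  obtain rfl : hub = fun _ => none := funext fun v =>
    Option.eq_none_iff_forall_ne_some.mpr fun a hva =>
      let ⟨p, hvp, _⟩ := hcactus.hub_step hva
      hhub v p a hvp hva
  exact hcactus.hubTree.not_isMinor_of_two_le_degree (by simp)

end CactusLabels

section SpanningMinor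

variable {V W : Type*} {G : SimpleGraph V} {H : SimpleGraph W}

theorem exists_adj_of_connected (hG : G.Connected) {C : Set V} {x y : V} (hx : x ∈ C)
    (hy : y ∉ C) : ∃ a ∈ C, ∃ b ∉ C, G.Adj a b := by
  obtain ⟨p⟩ := hG.preconnected x y
  obtain ⟨d, -, hd, hd'⟩ := p.exists_boundary_dart C hx hy
  exact ⟨d.fst, hd, d.snd, hd', d.adj⟩

theorem exists_connected_cover [Finite V] [Finite W] [Nonempty W] (hG : G.Connected)
    {B : W → Set V} (hconn : ∀ i, (G.induce (B i)).Connected)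
    (hdisj : ∀ i j, i ≠ j → Disjoint (B i) (B j)) :
    ∃ M : W → Set V, B ≤ M ∧ (∀ i, (G.induce (M i)).Connected) ∧
      (∀ i j, i ≠ j → Disjoint (M i) (M j)) ∧ ∀ v, ∃ i, v ∈ M i := by
  let models : Set (W → Set V) :=
    {M | (∀ i, (G.induce (M i)).Connected) ∧ ∀ i j, i ≠ j → Disjoint (M i) (M j)}
  obtain ⟨M, hBM, ⟨hMconn, hMdisj⟩, hmax⟩ :=
    (Set.toFinite models).exists_le_maximal (a := B) ⟨hconn, hdisj⟩
  refine ⟨M, hBM, hMconn, hMdisj, fun v => ?_⟩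
  by_contra! hv
  obtain ⟨i₀⟩ := ‹Nonempty W›
  obtain ⟨x, hx⟩ := (hMconn i₀).nonempty
  obtain ⟨a, ha, b, hb, hab⟩ := exists_adj_of_connected hG (C := ⋃ i, M i)
    (Set.mem_iUnion_of_mem i₀ hx) (y := v) (by simpa using hv)
  obtain ⟨i, hai⟩ := Set.mem_iUnion.mp ha
  have hbM : ∀ j, b ∉ M j := by simpa using hb
  let M' : W → Set V := fun j => M j ∪ {z | z = b ∧ j = i}
  have hM' : M' ∈ models := by
    refine ⟨fun j => ?_, fun j l hjl => Set.disjoint_left.mpr ?_⟩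
    · by_cases hj : j = i
      · have hunion : M' j = M j ∪ {b} := by simp [M', hj]
        exact hunion ▸ SimpleGraph.connected_induce_union (hMconn j).preconnected
          (connected_induce_singleton G b).preconnected (hj ▸ hai) (Set.mem_singleton b) hab
      · have hold : M' j = M j := by simp [M', hj]
        exact hold ▸ hMconn j
    · rintro z (hz | ⟨rfl, hj⟩) (hz' | ⟨hzb, hl⟩)
      exacts [Set.disjoint_left.mp (hMdisj j l hjl) hz hz', hbM j (hzb ▸ hz), hbM l hz',
        hjl (hj.trans hl.symm)]
  exact hbM i (hmax hM' (fun j => Set.subset_union_left) i (Or.inr ⟨rfl, rfl⟩))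

theorem IsMinor.exists_connected [Finite V] [Finite W] [Nonempty W] (h : IsMinor H G)
    (hG : G.Connected) : ∃ K : SimpleGraph W, H ≤ K ∧ K.Connected ∧ IsMinor K G := by
  obtain ⟨B, hconn, hdisj, hadj⟩ := h
  obtain ⟨M, hBM, hMconn, hMdisj, hcover⟩ := exists_connected_cover hG hconn hdisj
  choose f hf using hcover
  have hf_eq : ∀ {v i}, v ∈ M i → f v = i := fun {v i} hv => by
    by_contra hne
    exact Set.disjoint_left.mp (hMdisj _ _ hne) (hf v) hv
  have hf_surjective : Function.Surjective f := fun i =>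
    let ⟨x, hx⟩ := (hMconn i).nonempty
    ⟨x, hf_eq hx⟩
  let K : SimpleGraph W := SimpleGraph.fromRel fun i j => Linked G (M i) (M j)
  have hK : ∀ {i j}, K.Adj i j ↔ i ≠ j ∧ Linked G (M i) (M j) := fun {i j} => by
    simp only [K, SimpleGraph.fromRel_adj, or_iff_left_of_imp Linked.symm]
  have hreach : ∀ {u v}, G.Reachable u v → K.Reachable (f u) (f v) := by
    rintro u v ⟨p⟩
    induction p with
    | nil => rfl
    | @cons u w v huw _ ih =>
      refine SimpleGraph.Reachable.trans ?_ ih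
      by_cases huw' : f u = f w
      · rw [huw']
      · exact (hK.mpr ⟨huw', u, hf u, w, hf w, huw⟩).reachable
  refine ⟨K, fun i j hij => ?_, SimpleGraph.Connected.mk fun i j => ?_, M, hMconn, hMdisj,
    fun i j hij => (hK.mp hij).2⟩
  · exact hK.mpr ⟨hij.ne, Linked.mono (hadj i j hij) (hBM i) (hBM j)⟩
  · obtain ⟨u, rfl⟩ := hf_surjective i
    obtain ⟨v, rfl⟩ := hf_surjective j
    exact hreach (hG.preconnected u v)

end SpanningMinor

section SimpleLabels

theorem hasLogCertification_card_le (k N : ℕ) :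
    HasLogCertification k fun V _ => Nat.card V ≤ N := by
  refine hasLogCertification_of_labels (L := Fin N → ℕ) id Function.injective_id
    (fun i l s => (∃ j, l j = i) ∧ ∀ q ∈ s, q.2 = l) k
    (fun V _ G ident hG hid hN => ?_) fun _ _ _ _ hG hid c hc => ?_
  · obtain ⟨e⟩ : Nonempty (V ↪ Fin N) :=
      Function.Embedding.nonempty_of_card_le (by rwa [Fintype.card_fin, ← Nat.card_eq_fintype_card])
    have := hG.nonempty
    refine ⟨fun _ j => ident (Function.invFun e j), fun _ _ => ?_, fun v => ⟨⟨e v, ?_⟩, ?_⟩⟩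
    · exact (hid.le_pow _).trans (Nat.pow_le_pow_left (Nat.le_succ _) k)
    · exact congrArg ident (Function.leftInverse_invFun e.injective v)
    · rintro _ ⟨w, -, rfl⟩
      rfl
  · have hconst := eq_of_forall_adj_eq hG fun x y hxy => ((hc x).2 _ ⟨y, hxy, rfl⟩).symm
    choose j hj using fun v => (hc v).1
    have hj_injective : Function.Injective j := fun x y hxy =>
      hid.injective (by rw [← hj x, ← hj y, hxy, hconst x y])
    simpa using Nat.card_le_card_of_injective j hj_injective

/-- All edges share a vertex, so that a connected graph with this property is a star; the edgeless
graph on one vertex is included. -/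
def IsStar {V : Type*} (G : SimpleGraph V) : Prop := ∃ c, ∀ x y, G.Adj x y → x = c ∨ y = c

theorem hasLogCertification_isStar (k : ℕ) : HasLogCertification k fun _ G => IsStar G := by
  refine hasLogCertification_of_labels (L := ℕ) (fun l (_ : Unit) => l)
    (fun _ _ h => congrFun h ()) (fun i l s => ∀ q ∈ s, q.2 = l ∧ (i = l ∨ q.1 = l)) k
    (fun _ _ _ ident _ hid hstar => ?_) fun _ _ G ident hG hid c hc => ?_
  · obtain ⟨z, hz⟩ := hstar
    refine ⟨fun _ => ident z, fun _ _ => ?_, ?_⟩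
    · exact (hid.le_pow _).trans (Nat.pow_le_pow_left (Nat.le_succ _) k)
    · rintro v _ ⟨w, hvw, rfl⟩
      simpa [hid.injective.eq_iff] using hz v w hvw
  · have hconst := eq_of_forall_adj_eq hG fun x y hxy => (hc x _ ⟨y, hxy, rfl⟩).1.symm
    obtain ⟨v₀⟩ := hG.nonempty
    have hcentre : ∀ x y, G.Adj x y → ident x = c v₀ ∨ ident y = c v₀ := fun x y hxy => by
      simpa only [hconst v₀ x] using (hc x _ ⟨y, hxy, rfl⟩).2
    by_cases hz : ∃ z, ident z = c v₀
    · obtain ⟨z, hz⟩ := hz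
      exact ⟨z, fun x y hxy => (hcentre x y hxy).imp (fun hx => hid.injective (hx.trans hz.symm))
        fun hy => hid.injective (hy.trans hz.symm)⟩
    · exact ⟨v₀, fun x y hxy => absurd ((hcentre x y hxy).elim (⟨x, ·⟩) (⟨y, ·⟩)) hz⟩

/-- No vertex has three distinct neighbours; stated without degrees, so that no decidability or
local finiteness of `G` is needed. -/
def DegreeLeTwo {V : Type*} (G : SimpleGraph V) : Prop :=
  ∀ x a b c, G.Adj x a → G.Adj x b → G.Adj x c → a = b ∨ a = c ∨ b = c

theorem hasLogCertification_degreeLeTwo (k : ℕ) :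
    HasLogCertification k fun _ G => DegreeLeTwo G := by
  refine hasLogCertification_of_labels (L := Unit) (fun _ (i : Empty) => i.elim)
    (fun _ _ _ => rfl) (fun _ _ s => ∀ p ∈ s, ∀ q ∈ s, ∀ r ∈ s, p = q ∨ p = r ∨ q = r) k
    (fun _ _ _ _ _ hid hdeg => ⟨fun _ => (), fun _ i => i.elim, fun v => ?_⟩)
    fun _ _ _ _ _ hid c hc v x y z hx hy hz => ?_
  · rintro _ ⟨x, hx, rfl⟩ _ ⟨y, hy, rfl⟩ _ ⟨z, hz, rfl⟩
    simpa [hid.injective.eq_iff] using hdeg v x y z hx hy hz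
  · simpa [hid.injective.eq_iff] using hc v _ ⟨x, hx, rfl⟩ _ ⟨y, hy, rfl⟩ _ ⟨z, hz, rfl⟩

end SimpleLabels

section SmallMinors

variable {V W : Type*} {G : SimpleGraph V}

theorem graphOfList_isContained [DecidableEq W] {l : List (W × W)} {f : W → V}
    (hf : Function.Injective f) (hadj : ∀ p ∈ l, G.Adj (f p.1) (f p.2)) :
    (graphOfList l).IsContained G := by
  refine ⟨⟨⟨f, fun {i j} hij => ?_⟩, hf⟩⟩
  rcases hij.2 with hl | hl
  exacts [hadj _ hl, (hadj _ hl).symm]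

theorem exists_adj_of_ncard_lt [Finite V] (hG : G.Connected) {C : Set V} (hC : C.Nonempty)
    (hlt : C.ncard < Nat.card V) : ∃ a ∈ C, ∃ b ∉ C, G.Adj a b := by
  obtain ⟨x, hx⟩ := hC
  obtain ⟨y, -, hy⟩ :=
    Set.exists_mem_notMem_of_ncard_lt_ncard (hlt.trans_eq (Set.ncard_univ V).symm)
  exact exists_adj_of_connected hG hx hy

theorem exists_two_neighbors [Finite V] (hG : G.Connected) (hV : 3 ≤ Nat.card V) :
    ∃ b a c, a ≠ c ∧ G.Adj b a ∧ G.Adj b c := by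
  obtain ⟨x⟩ := hG.nonempty
  obtain ⟨x, -, y, -, hxy⟩ :=
    exists_adj_of_ncard_lt hG (Set.singleton_nonempty x) (by rw [Set.ncard_singleton]; omega)
  obtain ⟨a, ha, b, hb, hab⟩ := exists_adj_of_ncard_lt hG (Set.insert_nonempty x {y})
    ((Set.ncard_insert_le x {y}).trans_lt (by rw [Set.ncard_singleton]; omega))
  simp only [Set.mem_insert_iff, Set.mem_singleton_iff, not_or] at ha hb
  rcases ha with rfl | rfl
  exacts [⟨a, y, b, Ne.symm hb.2, hxy, hab⟩, ⟨a, x, b, Ne.symm hb.1, hxy.symm, hab⟩]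

/-- Two disjoint edges. -/
abbrev twoEdges : SimpleGraph (Fin 4) := graphOfList [(0, 1), (2, 3)]

theorem IsStar.not_isMinor_twoEdges (h : IsStar G) : ¬ IsMinor twoEdges G := by
  rintro ⟨B, -, hdisj, hadj⟩
  obtain ⟨z, hz⟩ := h
  have hmem : ∀ i j, twoEdges.Adj i j → z ∈ B i ∪ B j := fun i j hij => by
    obtain ⟨x, hx, y, hy, hxy⟩ := hadj i j hij
    rcases hz x y hxy with rfl | rfl
    exacts [Or.inl hx, Or.inr hy]
  have hunion : Disjoint (B 0 ∪ B 1) (B 2 ∪ B 3) := by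
    simp only [Set.disjoint_union_left, Set.disjoint_union_right]
    exact ⟨⟨hdisj _ _ (by decide), hdisj _ _ (by decide)⟩, hdisj _ _ (by decide),
      hdisj _ _ (by decide)⟩
  exact Set.disjoint_left.mp hunion (hmem 0 1 (by decide)) (hmem 2 3 (by decide))

theorem isStar_of_not_isContained_twoEdges [Finite V] (hG : G.Connected) (hV : 4 ≤ Nat.card V)
    (h : ¬ twoEdges.IsContained G) : IsStar G := by
  have hmeet : ∀ {x y u v}, G.Adj x y → G.Adj u v → x = u ∨ x = v ∨ y = u ∨ y = v := by
    intro x y u v hxy huv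
    by_contra! hne
    refine h (graphOfList_isContained (f := ![x, y, u, v]) ?_ ?_)
    · simp [Function.Injective, Fin.forall_fin_succ, hxy.ne, hxy.ne', huv.ne, huv.ne', hne,
        hne.1.symm, hne.2.1.symm, hne.2.2.1.symm, hne.2.2.2.symm]
    · simp [hxy, huv]
  obtain ⟨b, a, c, hac, hba, hbc⟩ := exists_two_neighbors hG (by omega)
  refine ⟨b, fun x y hxy => ?_⟩
  by_contra! hb
  have hedge : G.Adj a c := by
    have hab := hmeet hxy hba
    have hcb := hmeet hxy hbc
    grind [G.adj_comm]
  obtain ⟨u, hu, w, hw, huw⟩ := exists_adj_of_ncard_lt hG (C := {a, b, c}) ⟨a, by simp⟩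
    (Set.ncard_insert_le a {b, c} |>.trans (Nat.succ_le_succ (Set.ncard_insert_le b {c}))
      |>.trans_lt (by rw [Set.ncard_singleton]; omega))
  simp only [Set.mem_insert_iff, Set.mem_singleton_iff, not_or] at hu hw
  grind [hba.ne, hbc.ne, hedge.ne]

/-- The star with three leaves, centred at `0`. -/
abbrev clawGraph : SimpleGraph (Fin 4) := graphOfList [(0, 1), (0, 2), (0, 3)]

theorem degreeLeTwo_of_not_isMinor_clawGraph (h : ¬ IsMinor clawGraph G) : DegreeLeTwo G := by
  intro x a b c ha hb hc
  by_contra! hne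
  refine h ((IsMinor.refl _).isContained_right
    (graphOfList_isContained (f := ![x, a, b, c]) ?_ ?_))
  · simp [Function.Injective, Fin.forall_fin_succ, ha.ne, ha.ne', hb.ne, hb.ne', hc.ne, hc.ne',
      hne, hne.1.symm, hne.2.1.symm, hne.2.2.symm]
  · simp [ha, hb, hc]

theorem DegreeLeTwo.mem_support_of_adj (h : DegreeLeTwo G) {x x' : V} {p : G.Walk x x'}
    (hp : p.IsPath) {y y' : V} (hy : y ∉ p.support) (hy' : y' ∉ p.support) (hyy' : y ≠ y')
    (hxy : G.Adj x y) (hxy' : G.Adj x' y') {z w : V} (hz : z ∈ p.support) (hzw : G.Adj z w) :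
    w ∈ p.support ∨ w = y ∨ w = y' := by
  induction p generalizing y with
  | nil =>
    obtain rfl := List.mem_singleton.mp hz
    grind [h z y y' w hxy hxy' hzw]
  | @cons x u x' hxu q ih =>
    rw [SimpleGraph.Walk.cons_isPath_iff] at hp
    simp only [SimpleGraph.Walk.support_cons, List.mem_cons, not_or] at hy hy' hz ⊢
    rcases hz with rfl | hz
    · have := q.start_mem_support
      grind [h z y u w hxy hxu hzw]
    · grind [ih hp.1 hp.2 hy'.2 (Ne.symm hy'.1) hxu.symm hxy' hz]

theorem exists_isPath_of_connected_induce {B : Set V} (h : (G.induce B).Connected) {x y : V}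
    (hx : x ∈ B) (hy : y ∈ B) : ∃ p : G.Walk x y, p.IsPath ∧ ∀ z ∈ p.support, z ∈ B := by
  obtain ⟨q, hq⟩ := (h.preconnected ⟨x, hx⟩ ⟨y, hy⟩).exists_isPath
  refine ⟨q.map (SimpleGraph.Embedding.induce B).toHom, hq.map Subtype.val_injective,
    fun z hz => ?_⟩
  have hmap : z ∈ q.support.map Subtype.val :=
    (congrArg (z ∈ ·) (SimpleGraph.Walk.support_map _ q)).mp hz
  obtain ⟨z, -, rfl⟩ := List.mem_map.mp hmap
  exact z.2

theorem DegreeLeTwo.not_isMinor_clawGraph (h : DegreeLeTwo G) : ¬ IsMinor clawGraph G := by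
  rintro ⟨B, hconn, hdisj, hadj⟩
  have hleaf : ∀ i, i ≠ 0 → ∃ x ∈ B 0, ∃ y ∈ B i, G.Adj x y := fun i hi =>
    hadj 0 i (by revert i; decide)
  have hnot : ∀ {i j y}, i ≠ j → y ∈ B i → y ∉ B j := fun hij hy hy' =>
    Set.disjoint_left.mp (hdisj _ _ hij) hy hy'
  obtain ⟨x₁, hx₁, y₁, hy₁, hxy₁⟩ := hleaf 1 (by decide)
  obtain ⟨x₂, hx₂, y₂, hy₂, hxy₂⟩ := hleaf 2 (by decide)
  obtain ⟨x₃, hx₃, y₃, hy₃, hxy₃⟩ := hleaf 3 (by decide)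
  obtain ⟨p, hp, hsub⟩ := exists_isPath_of_connected_induce (hconn 0) hx₁ hx₂
  have hstep : ∀ {z w}, z ∈ p.support → G.Adj z w → w ∈ p.support ∨ w = y₁ ∨ w = y₂ :=
    h.mem_support_of_adj hp (fun hy => hnot (by decide) hy₁ (hsub _ hy))
      (fun hy => hnot (by decide) hy₂ (hsub _ hy))
      (fun hy => hnot (by decide) hy₁ (hy ▸ hy₂)) hxy₁ hxy₂
  by_cases hx₃p : x₃ ∈ p.support
  · rcases hstep hx₃p hxy₃ with hy | rfl | rfl
    exacts [hnot (by decide) hy₃ (hsub _ hy), hnot (by decide) hy₃ hy₁, hnot (by decide) hy₃ hy₂]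
  · obtain ⟨a, -, b, hb, ha, hbp, hab⟩ := exists_adj_of_connected_induce (hconn 0)
      (C := {z | z ∈ p.support}) hx₁ p.start_mem_support hx₃ hx₃p
    rcases hstep ha hab with hy | rfl | rfl
    exacts [hbp hy, hnot (by decide) hy₁ hb, hnot (by decide) hy₂ hb]

/-- The disjoint union of a triangle and a single vertex. -/
abbrev trianglePlusVertex : SimpleGraph (Fin 4) := graphOfList [(0, 1), (0, 2), (1, 2)]

namespace NormalTree

variable {r : V} {par : V → Option V} {depth : V → ℕ}

theorem reflTransGen_of_not_isMinor_trianglePlusVertex (h : NormalTree G r par depth) {x y : V}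
    (hxy : TransGen (IsParent par) x y) (hadj : G.Adj x y) (hpar : ¬ IsParent par x y)
    (hG : ¬ IsMinor trianglePlusVertex G) (v : V) :
    ReflTransGen (IsParent par) x v ∧ ReflTransGen (IsParent par) v y := by
  obtain ⟨u, hxu, huy⟩ := exists_isParent_of_transGen hxy hpar
  by_contra hv
  have hvx : x ≠ v := fun hvx => hv (hvx ▸ ⟨.refl, hxy.to_reflTransGen⟩)
  have hvy : y ≠ v := fun hvy => hv (hvy ▸ ⟨hxy.to_reflTransGen, .refl⟩)
  have hvu : v ∉ treePath par u y := fun hvu => hv ⟨hvu.1.head hxu, hvu.2.to_reflTransGen⟩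
  refine hG (isMinor_of_four (connected_induce_singleton G x) (h.connected_treePath huy)
    (connected_induce_singleton G y) (connected_induce_singleton G v)
    (Set.disjoint_singleton_left.mpr fun hx => h.isForest.not_transGen hx.1 (.single hxu))
    (Set.disjoint_singleton.mpr hadj.ne) (Set.disjoint_singleton.mpr hvx)
    (h.isForest.disjoint_treePath_singleton .refl) (Set.disjoint_singleton_right.mpr hvu)
    (Set.disjoint_singleton.mpr hvy) (fun _ => ⟨x, rfl, u, mem_treePath huy, h.adj hxu⟩)
    (fun _ => ⟨x, rfl, y, rfl, hadj⟩) ?_ (fun _ => h.linked_treePath huy (Set.mem_singleton y))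
    ?_ ?_)
  all_goals exact fun hadj => absurd hadj (by decide)

theorem depth_of_adj_of_not_isMinor_trianglePlusVertex (h : NormalTree G r par depth) {x y : V}
    (hxy : TransGen (IsParent par) x y) (hadj : G.Adj x y) (hpar : ¬ IsParent par x y)
    (hG : ¬ IsMinor trianglePlusVertex G) {z w : V} (hzw : G.Adj z w) :
    depth z = depth w + 1 ∨ depth w = depth z + 1 ∨ depth z = depth x ∧ depth w = depth y ∨
      depth z = depth y ∧ depth w = depth x := by
  have hchain := h.reflTransGen_of_not_isMinor_trianglePlusVertex hxy hadj hpar hG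
  have hstep : ∀ {z w}, G.Adj z w → TransGen (IsParent par) z w →
      depth z = depth w + 1 ∨ depth z = depth x ∧ depth w = depth y := by
    intro z w hzw hT
    by_cases hp : IsParent par z w
    · exact Or.inl (h.depth_eq hp)
    · have hchain' := h.reflTransGen_of_not_isMinor_trianglePlusVertex hT hzw hp hG
      exact Or.inr ⟨(h.isForest.depth_le (hchain z).1).antisymm (h.isForest.depth_le (hchain' x).1),
        (h.isForest.depth_le (hchain' y).2).antisymm (h.isForest.depth_le (hchain w).2)⟩
  rcases h.transGen_of_adj hzw with hT | hT
  · have := hstep hzw hT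
    tauto
  · have := hstep hzw.symm hT
    tauto

/-- All vertices lie on the tree path from `x` to `y`, so they are determined by their depth, and
`G` is the cycle that consists of this path and the edge `xy`. -/
theorem degreeLeTwo_of_not_isMinor_trianglePlusVertex (h : NormalTree G r par depth) {x y : V}
    (hxy : TransGen (IsParent par) x y) (hadj : G.Adj x y) (hpar : ¬ IsParent par x y)
    (hG : ¬ IsMinor trianglePlusVertex G) : DegreeLeTwo G := by
  have hchain := h.reflTransGen_of_not_isMinor_trianglePlusVertex hxy hadj hpar hG
  have hdepth_injective : ∀ {v w}, depth v = depth w → v = w := fun {v w} hvw =>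
    (ancestors_comparable (hchain v).1 (hchain w).1).elim
      (fun h_vw => h.isForest.eq_of_depth_le h_vw hvw.le)
      fun h_wv => (h.isForest.eq_of_depth_le h_wv hvw.ge).symm
  have hneighbor : ∀ {z w}, G.Adj z w → depth y ≤ depth w ∧ depth w ≤ depth x ∧
      (depth z = depth w + 1 ∨ depth w = depth z + 1 ∨ depth z = depth x ∧ depth w = depth y ∨
        depth z = depth y ∧ depth w = depth x) := fun {z w} hzw =>
    ⟨h.isForest.depth_le (hchain w).2, h.isForest.depth_le (hchain w).1,
      h.depth_of_adj_of_not_isMinor_trianglePlusVertex hxy hadj hpar hG hzw⟩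
  intro z a b c ha hb hc
  have hlt := h.isForest.depth_lt hxy
  have ha := hneighbor ha
  have hb := hneighbor hb
  have hc := hneighbor hc
  by_contra! hne
  have hab := mt hdepth_injective hne.1
  have hac := mt hdepth_injective hne.2.1
  have hbc := mt hdepth_injective hne.2.2
  omega

end NormalTree

theorem degreeLeTwo_of_not_isMinor_trianglePlusVertex [Finite V] (hG : G.Connected)
    (htriangle : IsMinor (⊤ : SimpleGraph (Fin 3)) G) (h : ¬ IsMinor trianglePlusVertex G) :
    DegreeLeTwo G := by
  have := Fintype.ofFinite V
  obtain ⟨r⟩ := hG.nonempty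
  obtain ⟨par, depth, htree⟩ := exists_normalTree hG r
  obtain ⟨x, y, hadj, hxy, hyx⟩ : ∃ x y, G.Adj x y ∧ ¬ IsParent par x y ∧ ¬ IsParent par y x := by
    by_contra! hparent
    have hhub : HubTree G par (fun _ => none) depth :=
      ⟨htree.isForest, nofun, fun {x y} hxy => by
        simpa [IsLink, IsParent] using or_iff_not_imp_left.mpr (hparent x y hxy)⟩
    exact hhub.not_isMinor_of_two_le_degree (by simp) htriangle
  rcases htree.transGen_of_adj hadj with hT | hT
  exacts [htree.degreeLeTwo_of_not_isMinor_trianglePlusVertex hT hadj hxy h,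
    htree.degreeLeTwo_of_not_isMinor_trianglePlusVertex hT hadj.symm hyx h]

end SmallMinors

section FourVertices

variable {V W : Type*} {G : SimpleGraph V}

/-- Every connected graph on the vertex set of `L` that contains `L` has a subgraph isomorphic
to `U`. If so, a connected graph with the minor `L` also has the minor `U`. -/
def ConnectedForces (L U : SimpleGraph W) : Prop :=
  ∀ K : SimpleGraph W, L ≤ K → K.Connected → U.IsContained K

theorem ConnectedForces.refl (U : SimpleGraph W) : ConnectedForces U U :=
  fun _ hUK _ => .of_le hUK

theorem ConnectedForces.isMinor [Finite V] [Finite W] {L U : SimpleGraph W}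
    (hLU : ConnectedForces L U) (hG : G.Connected) (hL : IsMinor L G) : IsMinor U G := by
  cases isEmpty_or_nonempty W
  · exact ⟨isEmptyElim, isEmptyElim, isEmptyElim, isEmptyElim⟩
  · obtain ⟨K, hLK, hK, hKG⟩ := hL.exists_connected hG
    exact hKG.of_isContained (hLU K hLK hK)

theorem ConnectedForces.hasLogCertification {k : ℕ} {X : Type*} [Finite W] {L U : SimpleGraph W}
    {H : SimpleGraph X} (hLU : ConnectedForces L U) (hU : HasLogCertification k (minorFree U))
    (hLH : L.IsContained H) (hHU : H.IsContained U) : HasLogCertification k (minorFree H) :=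
  hU.congr fun _ _ _ hG => not_congr
    ⟨fun h => h.of_isContained hHU, fun h => hLU.isMinor hG (h.of_isContained hLH)⟩

theorem ConnectedForces.hasLogCertification_of_bot (k : ℕ) [Finite W] {U : SimpleGraph W}
    (hU : ConnectedForces ⊥ U) : HasLogCertification k (minorFree U) := by
  have := Fintype.ofFinite W
  refine (hasLogCertification_card_le k (Fintype.card W - 1)).congr fun V _ G hG => ?_
  have := hG.nonempty
  have hV : 0 < Fintype.card V := Fintype.card_pos
  rw [Nat.card_eq_fintype_card]
  refine ⟨fun hcard hminor => ?_, fun hfree => ?_⟩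
  · have := hminor.card_le
    omega
  · by_contra! hcard
    have hbot : (⊥ : SimpleGraph W).IsContained G :=
      SimpleGraph.bot_isContained_iff_card_le.mpr (by omega)
    exact hfree (hU.isMinor hG ((IsMinor.refl ⊥).isContained_right hbot))

theorem connectedForces_of_card_le_two [Fintype W] (hW : Fintype.card W ≤ 2)
    (U : SimpleGraph W) : ConnectedForces ⊥ U := by
  refine fun K _ hK => .of_le fun i j hij => ?_
  have : Nontrivial W := ⟨i, j, hij.ne⟩
  obtain ⟨b, hib⟩ := hK.preconnected.exists_adj_of_nontrivial i
  by_contra hne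
  have hbj : b ≠ j := fun hbj => hne (hbj ▸ hib)
  exact hW.not_gt (Fintype.two_lt_card_iff.mpr ⟨i, j, b, hij.ne, hib.ne, hbj.symm⟩)

/-- A path on three vertices together with `n` isolated vertices. -/
abbrev pathThree (n : ℕ) : SimpleGraph (Fin (n + 3)) := graphOfList [(0, 1), (1, 2)]

theorem connectedForces_pathThree (n : ℕ) : ConnectedForces ⊥ (pathThree n) := by
  intro K _ hK
  obtain ⟨b, a, c, hac, hba, hbc⟩ := exists_two_neighbors hK (by simp)
  have habc : Function.Injective ![a, b, c] := by
    simp [Function.Injective, Fin.forall_fin_succ, hba.ne, hba.ne', hbc.ne, hbc.ne', hac, hac.symm]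
  obtain ⟨σ, hσ⟩ := Equiv.Perm.exists_extending_pair (Fin.castLE (Nat.le_add_left 3 n)) ![a, b, c]
    (Fin.castLE_injective _) habc
  have hσ0 : σ 0 = a := hσ 0
  have hσ1 : σ 1 = b := hσ 1
  have hσ2 : σ 2 = c := hσ 2
  exact graphOfList_isContained σ.injective (by simp [hσ0, hσ1, hσ2, hba.symm, hbc])

/-- The path with the edges `01`, `12`, `23`. -/
abbrev pathFour : SimpleGraph (Fin 4) := graphOfList [(0, 1), (1, 2), (2, 3)]

theorem connectedForces_twoEdges_pathFour : ConnectedForces twoEdges pathFour := by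
  intro K hK hconn
  have h01 : K.Adj 0 1 := hK (by decide)
  have h23 : K.Adj 2 3 := hK (by decide)
  obtain ⟨a, ha, b, hb, hab⟩ := exists_adj_of_connected hconn (C := {0, 1}) (x := 0) (y := 2)
    (by simp) (by simp)
  replace hb : b = 2 ∨ b = 3 := by revert hb; clear hab; decide +revert
  rcases ha with rfl | rfl <;> rcases hb with rfl | rfl
  · exact graphOfList_isContained (f := ![1, 0, 2, 3]) (by decide) (by simp [h01.symm, hab, h23])
  · exact graphOfList_isContained (f := ![1, 0, 3, 2]) (by decide)
      (by simp [h01.symm, hab, h23.symm])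
  · exact graphOfList_isContained (f := ![0, 1, 2, 3]) (by decide) (by simp [h01, hab, h23])
  · exact graphOfList_isContained (f := ![0, 1, 3, 2]) (by decide) (by simp [h01, hab, h23.symm])

/-- A triangle with a pendant edge at the vertex `0`. -/
abbrev pawGraph : SimpleGraph (Fin 4) := graphOfList [(0, 1), (0, 2), (1, 2), (0, 3)]

theorem connectedForces_trianglePlusVertex_pawGraph :
    ConnectedForces trianglePlusVertex pawGraph := by
  intro K hK hconn
  have htriangle : ∀ i j, i ≠ j → i ≠ 3 → j ≠ 3 → K.Adj i j := fun i j hij hi hj =>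
    hK (by revert i j; decide)
  obtain ⟨b, h3b⟩ := hconn.preconnected.exists_adj_of_nontrivial 3
  have hb : b = 0 ∨ b = 1 ∨ b = 2 := by
    have := h3b.ne'
    clear h3b
    decide +revert
  rcases hb with rfl | rfl | rfl
  · exact graphOfList_isContained (f := ![0, 1, 2, 3]) (by decide) (by simp [htriangle, h3b.symm])
  · exact graphOfList_isContained (f := ![1, 0, 2, 3]) (by decide) (by simp [htriangle, h3b.symm])
  · exact graphOfList_isContained (f := ![2, 0, 1, 3]) (by decide) (by simp [htriangle, h3b.symm])

theorem hasLogCertification_minorFree_pathFour (k : ℕ) :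
    HasLogCertification k (minorFree pathFour) := by
  refine ((hasLogCertification_isStar k).union (hasLogCertification_card_le k 3)).congr
    fun V _ G hG => ⟨?_, fun hfree => ?_⟩
  · rintro (hstar | hcard) hminor
    · exact hstar.not_isMinor_twoEdges (hminor.of_isContained (graphOfList_isContained
        (f := id) Function.injective_id (by decide)))
    · have hW := hminor.card_le
      rw [Nat.card_eq_fintype_card] at hcard
      simp only [Fintype.card_fin] at hW
      omega
  · rw [or_iff_not_imp_right, not_le]
    refine fun hcard => isStar_of_not_isContained_twoEdges hG hcard fun h => hfree ?_
    exact connectedForces_twoEdges_pathFour.isMinor hG ((IsMinor.refl _).isContained_right h)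

theorem hasLogCertification_minorFree_clawGraph (k : ℕ) :
    HasLogCertification k (minorFree clawGraph) :=
  (hasLogCertification_degreeLeTwo k).congr fun _ _ _ _ =>
    ⟨DegreeLeTwo.not_isMinor_clawGraph, degreeLeTwo_of_not_isMinor_clawGraph⟩

theorem hasLogCertification_minorFree_pawGraph (k : ℕ) :
    HasLogCertification k (minorFree pawGraph) := by
  refine ((hasLogCertification_minorFree_top_three k).union
    (hasLogCertification_degreeLeTwo k)).congr fun V _ G hG => ⟨?_, fun hfree => ?_⟩
  · rintro (htriangle | hdegree) hminor
    · exact htriangle (hminor.of_isContained ⟨⟨⟨![0, 1, 2], by decide⟩, by decide⟩⟩)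
    · exact hdegree.not_isMinor_clawGraph (hminor.of_isContained (graphOfList_isContained
        (f := id) Function.injective_id (by decide)))
  · refine or_iff_not_imp_left.mpr fun htriangle => ?_
    exact degreeLeTwo_of_not_isMinor_trianglePlusVertex hG (not_not.mp htriangle) fun h =>
      hfree (connectedForces_trianglePlusVertex_pawGraph.isMinor hG h)

theorem isContained_iff_exists_perm [Finite W] {A B : SimpleGraph W} :
    A.IsContained B ↔ ∃ σ : Equiv.Perm W, ∀ i j, A.Adj i j → B.Adj (σ i) (σ j) :=
  ⟨fun ⟨f⟩ => ⟨Equiv.ofBijective f (Finite.injective_iff_bijective.mp f.injective),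
    fun _ _ hij => f.toHom.map_adj hij⟩, fun ⟨σ, hσ⟩ => ⟨⟨⟨σ, fun {i j} => hσ i j⟩, σ.injective⟩⟩⟩

instance [Fintype W] [DecidableEq W] (A B : SimpleGraph W) [DecidableRel A.Adj]
    [DecidableRel B.Adj] : Decidable (A.IsContained B) :=
  decidable_of_iff _ isContained_iff_exists_perm.symm

theorem exists_sublist_eq_graphOfList (H : SimpleGraph (Fin 4)) :
    ∃ l, l.Sublist [((0 : Fin 4), (1 : Fin 4)), (0, 2), (0, 3), (1, 2), (1, 3), (2, 3)] ∧
      H = graphOfList l := by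
  classical
  refine ⟨_, List.filter_sublist (p := fun p => H.Adj p.1 p.2), ?_⟩
  ext i j
  fin_cases i <;> fin_cases j <;> simp [graphOfList, H.adj_comm]

theorem isContained_cases_fin_four (H : SimpleGraph (Fin 4)) :
    H.IsContained (pathThree 1) ∨
    twoEdges.IsContained H ∧ H.IsContained pathFour ∨
    clawGraph.IsContained H ∧ H.IsContained clawGraph ∨
    trianglePlusVertex.IsContained H ∧ H.IsContained pawGraph ∨
    fourCycle.IsContained H ∧ H.IsContained fourCycle ∨
    diamondGraph.IsContained H ∧ H.IsContained diamondGraph ∨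
    (⊤ : SimpleGraph (Fin 4)).IsContained H := by
  obtain ⟨l, hl, rfl⟩ := exists_sublist_eq_graphOfList H
  rw [← List.mem_sublists] at hl
  revert l
  decide +kernel

theorem hasLogCertification_minorFree_fin_four (H : SimpleGraph (Fin 4)) (k : ℕ) :
    HasLogCertification k (minorFree H) := by
  rcases isContained_cases_fin_four H with hH | ⟨hL, hU⟩ | ⟨hL, hU⟩ | ⟨hL, hU⟩ | ⟨hL, hU⟩ |
    ⟨hL, hU⟩ | hL
  · have hpath := connectedForces_pathThree 1
    exact hpath.hasLogCertification (hpath.hasLogCertification_of_bot k)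
      (SimpleGraph.bot_isContained_iff_card_le.mpr (by simp)) hH
  · exact connectedForces_twoEdges_pathFour.hasLogCertification
      (hasLogCertification_minorFree_pathFour k) hL hU
  · exact (ConnectedForces.refl _).hasLogCertification
      (hasLogCertification_minorFree_clawGraph k) hL hU
  · exact connectedForces_trianglePlusVertex_pawGraph.hasLogCertification
      (hasLogCertification_minorFree_pawGraph k) hL hU
  · exact (ConnectedForces.refl _).hasLogCertification
      (hasLogCertification_minorFree_fourCycle k) hL hU
  · exact (ConnectedForces.refl _).hasLogCertification
      (hasLogCertification_minorFree_diamondGraph k) hL hU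
  · exact (ConnectedForces.refl _).hasLogCertification
      (hasLogCertification_minorFree_top_four k) hL (.of_le le_top)

theorem isContained_pathThree_of_ne_top {H : SimpleGraph (Fin 3)} (hH : H ≠ ⊤) :
    H.IsContained (pathThree 0) := by
  obtain ⟨i, j, hij, hnot⟩ := SimpleGraph.ne_top_iff_exists_not_adj.mp hH
  obtain ⟨σ, hσ⟩ := Equiv.Perm.exists_extending_pair ![i, j] ![0, 2]
    (by simpa [Function.Injective, Fin.forall_fin_succ] using ⟨hij, hij.symm⟩) (by decide)
  have hi : σ i = 0 := hσ 0
  have hj : σ j = 2 := hσ 1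
  have hadj : ∀ x y : Fin 3, x ≠ y → ¬ (x = 0 ∧ y = 2) → ¬ (x = 2 ∧ y = 0) →
      (pathThree 0).Adj x y := by decide
  refine ⟨⟨⟨σ, fun {x y} hxy => hadj _ _ (σ.injective.ne hxy.ne) ?_ ?_⟩, σ.injective⟩⟩
  · rintro ⟨hx, hy⟩
    exact hnot (σ.injective (hi.trans hx.symm) ▸ σ.injective (hj.trans hy.symm) ▸ hxy)
  · rintro ⟨hx, hy⟩
    exact hnot (σ.injective (hi.trans hy.symm) ▸ σ.injective (hj.trans hx.symm) ▸ hxy.symm)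

theorem hasLogCertification_minorFree_fin_three (H : SimpleGraph (Fin 3)) (k : ℕ) :
    HasLogCertification k (minorFree H) := by
  by_cases hH : H = ⊤
  · exact hH ▸ hasLogCertification_minorFree_top_three k
  · have hpath := connectedForces_pathThree 0
    exact hpath.hasLogCertification (hpath.hasLogCertification_of_bot k)
      (SimpleGraph.bot_isContained_iff_card_le.mpr (by simp))
      (isContained_pathThree_of_ne_top hH)

theorem HasLogCertification.of_iso {X : Type*} [Finite X] {k : ℕ} {H : SimpleGraph W}
    {K : SimpleGraph X} (h : HasLogCertification k (minorFree K)) (e : H ≃g K) :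
    HasLogCertification k (minorFree H) :=
  (ConnectedForces.refl K).hasLogCertification h e.symm.isContained e.isContained

end FourVertices

theorem theorem1 {W : Type*} [Fintype W] (H : SimpleGraph W) (hH : Fintype.card W ≤ 4) (k : ℕ) :
    HasLogCertification k (minorFree H) := by
  obtain hW | hW | hW : Fintype.card W ≤ 2 ∨ Fintype.card W = 3 ∨ Fintype.card W = 4 := by omega
  · exact (connectedForces_of_card_le_two hW H).hasLogCertification_of_bot k
  · exact (hasLogCertification_minorFree_fin_three _ k).of_iso
      (.map (Fintype.equivFinOfCardEq hW) H)
  · exact (hasLogCertification_minorFree_fin_four _ k).of_iso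
      (.map (Fintype.equivFinOfCardEq hW) H)
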